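/- **Setting.** Let $(W,S)$ be a finite Coxeter system with length function $\ell$, acting faithfully by isometries on a Euclidean space $V$, with simple roots $\Delta=\{\alpha_s\mid s\in S\}$: these form a linear basis of $V$, each $s\in S$ acts as the orthogonal reflection $v\mapsto v-2\frac{\langle\alpha_s,v\rangle}{\langle\alpha_s,\alpha_s\rangle}\alpha_s$, the open cone $\{x\mid\langle\alpha_s,x\rangle>0\ \forall s\in S\}$ meets no reflecting hyperplane of $W$ (it is the interior of the fundamental chamber), and the root system $\Phi=W(\Delta)$ contains exactly two opposite roots orthogonal to each reflecting hyperplane. The fundamental weights $\omega_s$ are defined by $\langle\alpha_s,\omega_t\rangle=\delta_{s=t}\langle\alpha_s,\alpha_s\rangle/2$. Let $w_\circ$ be the longest element of $W$. For a word $Q=q_1\cdots q_m$ on $S$, the *subword complex* $\mathcal{SC}(Q)$ is the simplicial complex of sets of positions $I\subseteq[m]$ whose complement contains a reduced expression of $w_\circ$. For a facet $I$ and $k\in[m]$, let $\sigma_I^{[1,k-1]}$ be the product, in this order, of the $q_z$ with $z\in[1,k-1]\setminus I$, and put $$\mathsf r(I,k)=\sigma_I^{[1,k-1]}(\alpha_{q_k}),\qquad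 \mathsf w(I,k)=\sigma_I^{[1,k-1]}(\omega_{q_k}),\qquad \mathsf B(I)=\sum_{k=1}^m\mathsf w(I,k).$$ The *brick polytope* is $\mathcal B(Q)=\operatorname{conv}\{\mathsf B(I)\mid I\text{ facet of }\mathcal{SC}(Q)\}$. The word $Q$ is *realizing* if its Demazure product is $w_\circ$ and, for every facet $I$ of $\mathcal{SC}(Q)$, the root configuration $(\mathsf r(I,i))_{i\in I}$ is a linear basis of $V$. A polytope *realizes* a simplicial complex if its boundary complex is a simplicial complex isomorphic to it. A *Coxeter element* $c$ is the product of all simple reflections in some order. For a reduced expression $\mathsf c$ of $c$, let $\mathsf w_\circ(\mathsf c)$ be the $\mathsf c$-sorting word of $w_\circ$, i.e. the reduced expression of $w_\circ$ which is the lexicographically first (as a sequence of positions) reduced subword of $\mathsf c^\infty=\mathsf c\,\mathsf c\,\mathsf c\cdots$ for $w_\circ$. The *almost positive roots* are $\Phi_{\ge-1}=-\Delta\cup\Phi^+$, where $\Phi^+$ is the set of roots that are nonnegative combinations of $\Delta$. For $s\in S$ let $\sigma_s(\beta)=\beta$ if $\beta\in-(\Delta\setminus\{\alpha_s\})$ and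 $\sigma_s(\beta)=s(\beta)$ for the other $\beta\in\Phi_{\ge-1}$. The *$c$-compatibility relations* $\parallel_c$ on $\Phi_{\ge-1}$, for all Coxeter elements $c$, are the family of relations determined by: (i) $-\alpha_s\parallel_c\beta$ if and only if $\beta\in\operatorname{span}(\Delta\setminus\{\alpha_s\})$; (ii) if $\ell(sc)<\ell(c)$, then $\beta\parallel_c\gamma$ if and only if $\sigma_s(\beta)\parallel_{scs}\sigma_s(\gamma)$. The *$c$-cluster complex* of $W$ is the simplicial complex of sets of pairwise $c$-compatible almost positive roots. **Theorem.** For every reduced expression $\mathsf c$ of a Coxeter element $c$ of $W$, the word $\mathsf c\,\mathsf w_\circ(\mathsf c)$ is realizing. The brick polytope $\mathcal B(\mathsf c\,\mathsf w_\circ(\mathsf c))$ has nonempty interior in $V$, and for every interior point $p$ its polar with respect to $p$, $$\{y\in V\mid\langle x-p,y\rangle\le1\ \text{ for all }x\in\mathcal B(\mathsf c\,\mathsf w_\circ(\mathsf c))\},$$ realizes the subword complex $\mathcal{SC}(\mathsf c\,\mathsf w_\circ(\mathsf c))$, and it also realizes the $c$-cluster complex of $W$. -/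

import Mathlib

open scoped RealInnerProductSpace

namespace BrickPolytope

section Convex

variable {V : Type*} [NormedAddCommGroup V] [InnerProductSpace ℝ V]

/-- The (one-sided) polar of a subset of a Euclidean space, with respect to the origin. -/
def polar (P : Set V) : Set V := {y | ∀ x ∈ P, ⟪x, y⟫ ≤ 1}

/-- The polar of `P` when the point `p` is taken as the origin. -/
def polarAt (p : V) (P : Set V) : Set V := polar ((fun x => x - p) '' P)

/-- A polytope is the convex hull of finitely many points. -/
def IsPolytope (P : Set V) : Prop := ∃ T : Finset V, P = convexHull ℝ (T : Set V)

/-- The proper faces of a polytope, including the empty face. -/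
def properFaces (P : Set V) : Set (Set V) := {F | IsExposed ℝ P F ∧ F ≠ P}

/-- `P` realizes the abstract simplicial complex `K` (a lower set of finite sets, so the empty
face is allowed): `P` is a polytope and its boundary complex is a simplicial complex isomorphic
to `K`, through a placement `φ` of the vertices. Every face of `K` spans a simplex, and these
simplices are exactly the proper faces of `P`. -/
def Realizes {ι : Type*} (P : Set V) (K : LowerSet (Finset ι)) : Prop :=
  IsPolytope P ∧ ∃ φ : ι → V,
    Set.InjOn φ {i | {i} ∈ K} ∧
    (∀ A ∈ K, AffineIndependent ℝ (fun a : A => φ a)) ∧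
    properFaces P = {F | ∃ A ∈ K, F = convexHull ℝ (φ '' (A : Set ι))}

end Convex

section Words

variable {B W : Type*} [Group W] {M : CoxeterMatrix B} (cs : CoxeterSystem M W)

/-- The subword of `Q` formed by the letters at the positions in `A`. -/
def subword (Q : List B) (A : Finset (Fin Q.length)) : List B :=
  ((List.finRange Q.length).filter (fun k => k ∈ A)).map Q.get

/-- The word `u` is a reduced expression of `w`. -/
def IsReducedExpr (w : W) (u : List B) : Prop := cs.IsReduced u ∧ cs.wordProd u = w

/-- The element `w` has maximal length; in a finite Coxeter group this is the element `w∘`. -/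
def IsLongest (w : W) : Prop := ∀ u, cs.length u ≤ cs.length w

open Classical in
/-- The Demazure product of a word: letters are multiplied on the right, from left to right,
and those which would decrease the length are skipped. -/
noncomputable def demazure (Q : List B) : W :=
  Q.foldl (fun w i => if cs.length (w * cs.simple i) = cs.length w + 1
    then w * cs.simple i else w) 1

/-- The subword complex of `Q` and `w`: its faces are the sets of positions of `Q` whose
complement contains a reduced expression of `w`. -/
def subwordComplex (Q : List B) (w : W) : LowerSet (Finset (Fin Q.length)) where
  carrier := {I | ∃ A, Disjoint A I ∧ IsReducedExpr cs w (subword Q A)}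
  lower' := by
    rintro I J hJI ⟨A, hA, hw⟩
    exact ⟨A, hA.mono_right hJI, hw⟩

/-- The facets of the subword complex, i.e. its inclusion-maximal faces. -/
def IsFacet (Q : List B) (w : W) (I : Finset (Fin Q.length)) : Prop :=
  Maximal (fun J => J ∈ subwordComplex cs Q w) I

/-- A Coxeter element is the product of all simple reflections in some order. -/
def IsCoxeterElement (w : W) : Prop :=
  ∃ l : List B, l.Nodup ∧ (∀ i, i ∈ l) ∧ cs.wordProd l = w

/-- The subword of the infinite word `Q Q Q ⋯` at the positions `p 0, p 1, …`. -/
def powSubword (Q : List B) {N : ℕ} (p : Fin N → ℕ) : List B :=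
  (List.ofFn p).filterMap (fun k => Q[k % Q.length]?)

/-- The increasing sequence of positions `p` in `Q Q Q ⋯` carries a reduced expression of `w`
(it consists of `ℓ(w)` letters with product `w`). -/
def IsReducedPositions (Q : List B) (w : W) (p : Fin (cs.length w) → ℕ) : Prop :=
  StrictMono p ∧ cs.wordProd (powSubword Q p) = w

/-- `u` is the `Q`-sorting word of `w`: the lexicographically first (as a sequence of positions)
reduced subword of `Q Q Q ⋯` for `w`. -/
def IsSortingWord (Q : List B) (w : W) (u : List B) : Prop :=
  ∃ p : Fin (cs.length w) → ℕ, IsReducedPositions cs Q w p ∧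
    (∀ p', IsReducedPositions cs Q w p' → toLex p ≤ toLex p') ∧ u = powSubword Q p

/-- A sorting word exists as soon as all letters occur in `Q`. -/
theorem exists_isSortingWord (Q : List B) (hc : ∀ i, i ∈ Q) (w : W) :
    ∃ u, IsSortingWord cs Q w u := by
  classical
  obtain ⟨v, hv, rfl⟩ := cs.exists_isReduced w
  have hp : ∃ p, IsReducedPositions cs Q (cs.wordProd v) p := by
    have key : ∀ i, ∃ a, Q[a]? = some i ∧ a < Q.length := fun i => by
      obtain ⟨a, ha, h⟩ := List.getElem_of_mem (hc i)
      exact ⟨a, by simp [ha, h], ha⟩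
    choose f hf hlt using key
    have hlen : cs.length (cs.wordProd v) = v.length := hv
    refine ⟨fun k => f (v.get (k.cast hlen)) + Q.length * k, ?_, ?_⟩
    · intro a b hab
      have h1 := hlt (v.get (a.cast hlen))
      have h2 : Q.length * (a + 1) ≤ Q.length * (b : ℕ) := Nat.mul_le_mul_left _ hab
      simp only
      nlinarith
    · congr 1
      have : ∀ (N : ℕ) (h : N = v.length),
          powSubword Q (fun k : Fin N => f (v.get (k.cast h)) + Q.length * k) = v := by
        rintro N rfl
        have e : ∀ i (k : ℕ), Q[(f i + Q.length * k) % Q.length]? = some i := fun i k => by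
          rw [Nat.add_mul_mod_self_left, Nat.mod_eq_of_lt (hlt i), hf]
        apply List.map_injective_iff.2 (Option.some_injective B)
        have h3 : ∀ (l : List ℕ) (g : ℕ → Option B), (∀ x ∈ l, (g x).isSome) →
            (l.filterMap g).map some = l.map g := by
          intro l g
          induction l with
          | nil => simp
          | cons x l ih =>
            intro h
            obtain ⟨y, hy⟩ := Option.isSome_iff_exists.1 (h x (by simp))
            simp [hy, ih (fun z hz => h z (by simp [hz]))]
        unfold powSubword
        rw [h3]
        · apply List.ext_getElem <;> simp [Nat.mod_eq_of_lt (hlt _), hf]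
        · intro x hx
          obtain ⟨k, rfl⟩ := (List.mem_ofFn' _ _).1 hx
          simp only [e, Option.isSome_some]
      exact this _ hlen
  obtain ⟨p, hp, hmin⟩ := WellFounded.has_min
    (wellFounded_lt (α := Lex (Fin (cs.length (cs.wordProd v)) → ℕ)))
    {q | IsReducedPositions cs Q (cs.wordProd v) (ofLex q)}
    (hp.imp fun p h => h)
  exact ⟨_, ofLex p, hp, fun p' h' => not_lt.1 (hmin (toLex p') h'), rfl⟩

end Words

/-- A finite Coxeter group `(W, S)` acting essentially, as a group of isometries, on the
Euclidean space `V`, with simple roots `α`. The open cone where all simple roots are positive is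
a chamber (it meets no reflecting hyperplane), so it is the interior of the fundamental chamber;
`α i` is orthogonal to the reflecting hyperplane of the `i`-th simple reflection and points
towards that chamber. The Cartan matrix is `2⟪α s, α t⟫ / ⟪α s, α s⟫`. The lengths of the simple
roots are free, except that the orbit `Φ = W(Δ)` contains exactly two opposite roots on each of
its lines. -/
structure RootData {B W : Type*} [Group W] {M : CoxeterMatrix B} (cs : CoxeterSystem M W)
    (V : Type*) [NormedAddCommGroup V] [InnerProductSpace ℝ V] where
  /-- the simple roots, a linear basis of `V` -/
  α : Module.Basis B ℝ V
  /-- the action of `W` on `V` -/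
  ρ : W →* (V ≃ₗᵢ[ℝ] V)
  faithful : Function.Injective ρ
  simple_eq : ∀ i, ρ (cs.simple i) = (ℝ ∙ α i)ᗮ.reflection
  chamber : ∀ x, (∀ j, 0 < ⟪α j, x⟫) → ∀ w i, ⟪ρ w (α i), x⟫ ≠ 0
  reduced : ∀ w i j (r : ℝ), ρ w (α i) = r • α j → r = 1 ∨ r = -1

namespace RootData

variable {B W : Type*} [Group W] {M : CoxeterMatrix B} {cs : CoxeterSystem M W}
  {V : Type*} [NormedAddCommGroup V] [InnerProductSpace ℝ V] [FiniteDimensional ℝ V]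
  (D : RootData cs V)

/-- The fundamental weights: the basis dual to `2 α i / ⟪α i, α i⟫`. -/
noncomputable def weight (i : B) : V :=
  (⟪D.α i, D.α i⟫ / 2) •
    (InnerProductSpace.toDual ℝ V).symm (LinearMap.toContinuousLinearMap (D.α.coord i))

theorem inner_weight [DecidableEq B] (i j : B) :
    ⟪D.α i, D.weight j⟫ = if i = j then ⟪D.α i, D.α i⟫ / 2 else 0 := by
  rw [real_inner_comm, weight, inner_smul_left, InnerProductSpace.toDual_symm_apply]
  by_cases h : i = j
  · subst h; simp
  · simp [h]

/-- `σ_I^{[1,k-1]}`: the product of the letters of `Q` at the positions before `k` that are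
not in `I`. -/
def prefixProd (_D : RootData cs V) (Q : List B) (I : Finset (Fin Q.length))
    (k : Fin Q.length) : W :=
  cs.wordProd (subword Q {z | z < k ∧ z ∉ I})

/-- The root function of `I`. -/
noncomputable def rootFn (Q : List B) (I : Finset (Fin Q.length)) (k : Fin Q.length) : V :=
  D.ρ (D.prefixProd Q I k) (D.α (Q.get k))

/-- The weight function of `I`. -/
noncomputable def weightFn (Q : List B) (I : Finset (Fin Q.length)) (k : Fin Q.length) : V :=
  D.ρ (D.prefixProd Q I k) (D.weight (Q.get k))

/-- The brick vector of `I`. -/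
noncomputable def brickVector (Q : List B) (I : Finset (Fin Q.length)) : V :=
  ∑ k, D.weightFn Q I k

/-- The brick polytope of `Q`, for the subword complex of `Q` and `w`. -/
noncomputable def brickPolytope (Q : List B) (w : W) : Set V :=
  convexHull ℝ {v | ∃ I, IsFacet cs Q w I ∧ v = D.brickVector Q I}

/-- `Q` is realizing: its Demazure product is the longest element `w`, and the root
configuration of every facet of its subword complex is a linear basis of `V`. -/
def IsRealizing (Q : List B) (w : W) : Prop :=
  demazure cs Q = w ∧ ∀ I, IsFacet cs Q w I →
    LinearIndependent ℝ (fun i : I => D.rootFn Q I i) ∧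
    Submodule.span ℝ (Set.range fun i : I => D.rootFn Q I i) = ⊤

/-- The almost positive roots: the negatives of the simple roots and the positive roots. -/
def almostPositive : Set V :=
  {β | (∃ i, β = -D.α i) ∨ ((∃ w i, β = D.ρ w (D.α i)) ∧ ∀ j, 0 ≤ D.α.repr β j)}

open Classical in
/-- The truncated simple reflection on almost positive roots: it fixes the negatives of the
other simple roots and is the `i`-th simple reflection on all other almost positive roots. -/
noncomputable def sigma (i : B) (β : V) : V :=
  if ∃ j, j ≠ i ∧ β = -D.α j then β else D.ρ (cs.simple i) β

/-- The `c`-compatibility relations on almost positive roots, for all Coxeter elements `c`: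
the family of relations generated by the two rules
* `-α i` and `β` are `c`-compatible when `β` lies in the span of the other simple roots;
* if `i` is initial in `c`, then `β, γ` are `c`-compatible if and only if `sigma i β, sigma i γ`
  are `(s c s)`-compatible, for the `i`-th simple reflection `s`.
Any two almost positive roots can be moved by the second rule to a pair whose first member is
the negative of a simple root, so these rules decide all pairs. -/
inductive Compatible (D : RootData cs V) : W → V → V → Prop
  | neg_simple {c : W} {i : B} {β : V} (hc : IsCoxeterElement cs c)
      (hβ : β ∈ D.almostPositive) (h : D.α.repr β i = 0) : Compatible D c (-D.α i) β
  | of_rotate {c : W} {i : B} {β γ : V} (hc : IsCoxeterElement cs c)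
      (hi : cs.IsLeftDescent c i) (hβ : β ∈ D.almostPositive) (hγ : γ ∈ D.almostPositive)
      (h : Compatible D (cs.simple i * c * cs.simple i) (D.sigma i β) (D.sigma i γ)) :
      Compatible D c β γ
  | rotate {c : W} {i : B} {β γ : V} (hc : IsCoxeterElement cs c)
      (hi : cs.IsLeftDescent c i) (hβ : β ∈ D.almostPositive) (hγ : γ ∈ D.almostPositive)
      (h : Compatible D c β γ) :
      Compatible D (cs.simple i * c * cs.simple i) (D.sigma i β) (D.sigma i γ)

/-- The `c`-cluster complex: its faces are the finite sets of pairwise `c`-compatible almost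
positive roots (so its facets are the `c`-clusters). -/
def clusterComplex (c : W) : LowerSet (Finset V) where
  carrier := {F | (F : Set V) ⊆ D.almostPositive ∧
    (F : Set V).Pairwise (fun β γ => D.Compatible c β γ)}
  lower' := by
    rintro F G hGF ⟨h1, h2⟩
    have h : (G : Set V) ⊆ F := Finset.coe_subset.2 hGF
    exact ⟨h.trans h1, h2.mono h⟩

end RootData

end BrickPolytope

/-! Let Q be the word c w∘(c), and let w_k and r_k be the weight and the root at position k for the
product of all letters before k, none omitted. The key fact about sorting words is
`isSortingWord_spec`: a prefix product acts on a fundamental weight ω_s as the power of c whose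
exponent is the number of letters s read so far. It gives (1 - c) w_k = r_k for every k, and 1 - c
is invertible because a Coxeter element fixes no nonzero vector.

Fix a facet I. Comparing the full prefix products with those that omit I writes c as a product of
reflections along the r_x with x ∈ I, with dim V factors. Expanding (1 - c) v along these factors
shows that the r_x form a basis. With v = w_y, comparison of coefficients shows that the weights w_y
(y ∈ I) are dual, up to positive factors, to the root configuration of I (`inner_ρ_turn`), and that
⟨w_y, r_x⟩ = 0 for x < y in I. For arbitrary positions x < y this product is at most 0. Hence a
vector has at most one expansion as a nonnegative combination of the weights of a face: pair two
expansions with the root at the first position where they differ (`eq_of_sum_eq`).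

A flip at i ∈ I moves the brick vector by a positive multiple of the root at i
(`exists_facet_flip`). A linear form that is maximal at the brick vector of I is therefore
nonnegative on the root configuration, so it lies in the cone of the weights of I. Since every
linear form has a maximum, these cones cover V. They are the normal cones of the brick polytope, and
the boundary of its polar is the simplicial complex spanned by their rays (`FanPolytope.realizes`).

For the cluster complex, both complexes are shown to be determined by pairs. A set of positions is a
face exactly when ⟨w_y, r_x⟩ = 0 for all x < y in it, because the sum of its weights lies in the
cone of some facet. On the other side, compatibility of distinct positive roots amounts to the
nonnegativity of ⟨(1 - c)⁻¹ β, γ⟩ in both orders, a condition preserved by the rotations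
(`eulerCompatible_conj_iff`). For the roots attached to two positions after c, one of these two
signs is automatic and the other inequality becomes the orthogonality above
(`eulerCompatible_clusterRoot_iff`). -/

namespace BrickPolytope

/-! ### Polytopes with a simplicial normal fan, and their polars. -/

section FanPolytope

variable {V : Type*} [NormedAddCommGroup V] [InnerProductSpace ℝ V] {ι : Type*}

/-- A family of facets with vertices `b I`, rays `w i` and edge directions `r I i`: the rays of a
facet are dual to its edge directions, every edge leads to another facet, and a vector has at most
one expansion as a nonnegative combination of the rays of a facet. -/
structure FanPolytope (F : Finset (Finset ι)) (b : Finset ι → V) (w : ι → V)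
    (r : Finset ι → ι → V) : Prop where
  nonempty : F.Nonempty
  card_eq : ∀ I ∈ F, I.card = Module.finrank ℝ V
  inner_eq_zero : ∀ I ∈ F, ∀ x ∈ I, ∀ y ∈ I, x ≠ y → ⟪w y, r I x⟫ = 0
  inner_pos : ∀ I ∈ F, ∀ x ∈ I, 0 < ⟪w x, r I x⟫
  exists_flip : ∀ I ∈ F, ∀ i ∈ I, ∃ J ∈ F, i ∉ J ∧ (∀ k ∈ I, k ≠ i → k ∈ J) ∧
    ∃ t : ℝ, 0 < t ∧ b I - b J = t • r I i
  unique : ∀ I ∈ F, ∀ J ∈ F, ∀ f g : ι → ℝ, (∀ i, 0 ≤ f i) → (∀ i, 0 ≤ g i) →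
    ∑ i ∈ I, f i • w i = ∑ j ∈ J, g j • w j → ∀ i ∈ I, 0 < f i → i ∈ J

namespace FanPolytope

variable {F : Finset (Finset ι)} {b : Finset ι → V} {w : ι → V} {r : Finset ι → ι → V}
  (h : FanPolytope F b w r)
include h

theorem inner_sum {I : Finset ι} (hI : I ∈ F) (f : ι → ℝ) {x : ι} (hx : x ∈ I) :
    ⟪∑ i ∈ I, f i • w i, r I x⟫ = f x * ⟪w x, r I x⟫ := by
  rw [sum_inner, Finset.sum_eq_single_of_mem x hx, real_inner_smul_left]
  intro y hy hyx
  rw [real_inner_smul_left, h.inner_eq_zero I hI x hx y hy (Ne.symm hyx), mul_zero]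

theorem linearIndependent_ray {I : Finset ι} (hI : I ∈ F) :
    LinearIndependent ℝ (fun i : I => w i) := by
  classical
  rw [Fintype.linearIndependent_iff]
  intro g hg x
  have key := h.inner_sum hI (fun i => if hi : i ∈ I then g ⟨i, hi⟩ else 0) x.2
  rw [← Finset.sum_coe_sort] at key
  simp only [Finset.coe_mem, dite_true] at key
  rw [hg, inner_zero_left] at key
  exact (mul_eq_zero.1 key.symm).resolve_right (h.inner_pos I hI x x.2).ne'

theorem linearIndependent_edge {I : Finset ι} (hI : I ∈ F) :
    LinearIndependent ℝ (fun i : I => r I i) := by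
  rw [Fintype.linearIndependent_iff]
  intro g hg x
  have key : ⟪w x, ∑ i : I, g i • r I i⟫ = g x * ⟪w x, r I x⟫ := by
    rw [_root_.inner_sum, Finset.sum_eq_single_of_mem x (Finset.mem_univ _), real_inner_smul_right]
    intro y _ hyx
    rw [real_inner_smul_right, h.inner_eq_zero I hI y y.2 x x.2 (by simpa using hyx), mul_zero]
  rw [hg, inner_zero_right] at key
  exact (mul_eq_zero.1 key.symm).resolve_right (h.inner_pos I hI x x.2).ne'

variable [FiniteDimensional ℝ V]

theorem span_edge {I : Finset ι} (hI : I ∈ F) :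
    Submodule.span ℝ (Set.range fun i : I => r I i) = ⊤ :=
  (h.linearIndependent_edge hI).span_eq_top_of_card_eq_finrank' (by simp [h.card_eq I hI])

/-- The difference of the two sides is orthogonal to the edge directions at `I`, which span `V`. -/
theorem eq_sum {I : Finset ι} (hI : I ∈ F) (v : V) :
    v = ∑ i ∈ I, (⟪v, r I i⟫ / ⟪w i, r I i⟫) • w i := by
  rw [← sub_eq_zero]
  set u := v - ∑ i ∈ I, (⟪v, r I i⟫ / ⟪w i, r I i⟫) • w i with hu
  have h1 : ∀ x ∈ I, ⟪u, r I x⟫ = 0 := fun x hx => by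
    rw [hu, inner_sub_left, h.inner_sum hI (fun i => ⟪v, r I i⟫ / ⟪w i, r I i⟫) hx,
      div_mul_cancel₀ _ (h.inner_pos I hI x hx).ne', sub_self]
  have h2 : ∀ z ∈ Submodule.span ℝ (Set.range fun i : I => r I i), ⟪u, z⟫ = 0 := fun z hz => by
    induction hz using Submodule.span_induction with
    | mem z hz => obtain ⟨i, rfl⟩ := hz; exact h1 i i.2
    | zero => simp
    | add x y _ _ hx hy => rw [inner_add_right, hx, hy, add_zero]
    | smul a x _ hx => rw [real_inner_smul_right, hx, mul_zero]
  exact inner_self_eq_zero.1 (h2 u (by rw [h.span_edge hI]; trivial))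

omit [FiniteDimensional ℝ V] in
theorem inner_edge_nonneg {I : Finset ι} (hI : I ∈ F) {v : V}
    (hv : ∀ J ∈ F, ⟪v, b J⟫ ≤ ⟪v, b I⟫) {i : ι} (hi : i ∈ I) : 0 ≤ ⟪v, r I i⟫ := by
  obtain ⟨J, hJ, -, -, t, ht, hb⟩ := h.exists_flip I hI i hi
  have h1 := hv J hJ
  have h2 : ⟪v, b I - b J⟫ = t * ⟪v, r I i⟫ := by rw [hb, real_inner_smul_right]
  rw [inner_sub_right] at h2
  exact nonneg_of_mul_nonneg_right (by linarith) ht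

/-- A vector lies in the cone of any facet at which it is maximal. -/
theorem exists_expansion_of_max {I : Finset ι} (hI : I ∈ F) {v : V}
    (hv : ∀ J ∈ F, ⟪v, b J⟫ ≤ ⟪v, b I⟫) :
    ∃ f : ι → ℝ, (∀ i, 0 ≤ f i) ∧ v = ∑ i ∈ I, f i • w i := by
  classical
  refine ⟨fun i => if i ∈ I then ⟪v, r I i⟫ / ⟪w i, r I i⟫ else 0, fun i => ?_, ?_⟩
  · dsimp only
    split_ifs with hi
    · exact div_nonneg (h.inner_edge_nonneg hI hv hi) (h.inner_pos I hI i hi).le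
    · exact le_rfl
  · refine (h.eq_sum hI v).trans (Finset.sum_congr rfl fun i hi => ?_)
    simp only [if_pos hi]

theorem exists_expansion (v : V) :
    ∃ I ∈ F, ∃ f : ι → ℝ, (∀ i, 0 ≤ f i) ∧ v = ∑ i ∈ I, f i • w i := by
  obtain ⟨I, hI, hmax⟩ := F.exists_max_image (fun I => ⟪v, b I⟫) h.nonempty
  exact ⟨I, hI, h.exists_expansion_of_max hI hmax⟩

/-- Push `w i` into the interior of the cone of `I` by adding ε times the sum of its rays. A facet
where the pushed vector is maximal has it in its cone, and uniqueness of expansions forces that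
facet to contain, hence to equal, `I`. Then let ε tend to 0. -/
theorem inner_vertex_le {I J : Finset ι} (hI : I ∈ F) (hJ : J ∈ F) {i : ι} (hi : i ∈ I) :
    ⟪w i, b J⟫ ≤ ⟪w i, b I⟫ := by
  classical
  have key : ∀ ε : ℝ, 0 < ε →
      ⟪w i + ε • ∑ k ∈ I, w k, b J⟫ ≤ ⟪w i + ε • ∑ k ∈ I, w k, b I⟫ := fun ε hε => by
    set v := w i + ε • ∑ k ∈ I, w k with hv
    obtain ⟨K, hK, hmax⟩ := F.exists_max_image (fun K => ⟪v, b K⟫) h.nonempty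
    obtain ⟨g, hg, hvg⟩ := h.exists_expansion_of_max hK hmax
    have hvf : v = ∑ k ∈ I, ((if k = i then 1 else 0) + ε) • w k := by
      simp [hv, add_smul, Finset.sum_add_distrib, Finset.smul_sum, hi]
    have hf : ∀ k, 0 < (if k = i then (1 : ℝ) else 0) + ε := fun k => by split_ifs <;> linarith
    have hIK : I ⊆ K := fun k hk =>
      h.unique I hI K hK _ g (fun k => (hf k).le) hg (hvf.symm.trans hvg) k hk (hf k)
    have : I = K := Finset.eq_of_subset_of_card_le hIK (by rw [h.card_eq I hI, h.card_eq K hK])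
    rw [this]
    exact hmax J hJ
  have key' : ∀ ε : ℝ, 0 < ε →
      ⟪w i, b J⟫ ≤ ⟪w i, b I⟫ + ε * ⟪∑ k ∈ I, w k, b I - b J⟫ := fun ε hε => by
    have := key ε hε
    simp only [inner_add_left, real_inner_smul_left, inner_sub_right] at this ⊢
    linarith
  have hlim : Filter.Tendsto (fun ε : ℝ => ⟪w i, b I⟫ + ε * ⟪∑ k ∈ I, w k, b I - b J⟫)
      (nhdsWithin 0 (Set.Ioi 0)) (nhds (⟪w i, b I⟫ + 0 * ⟪∑ k ∈ I, w k, b I - b J⟫)) :=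
    tendsto_nhdsWithin_of_tendsto_nhds (Continuous.tendsto (by fun_prop) _)
  rw [zero_mul, add_zero] at hlim
  exact ge_of_tendsto hlim (Filter.eventually_of_mem self_mem_nhdsWithin key')

/-- If `w i` is also maximal at `J`, it lies in the cone of `J`; its trivial expansion over `I` is
the only one. -/
theorem mem_of_inner_vertex_le {I J : Finset ι} (hI : I ∈ F) (hJ : J ∈ F) {i : ι} (hi : i ∈ I)
    (hle : ⟪w i, b I⟫ ≤ ⟪w i, b J⟫) : i ∈ J := by
  classical
  obtain ⟨g, hg, hv⟩ := h.exists_expansion_of_max hJ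
    (fun K hK => (h.inner_vertex_le hI hK hi).trans hle)
  refine h.unique I hI J hJ (fun k => if k = i then 1 else 0) g
    (fun k => by split_ifs <;> norm_num) hg ?_ i hi (by simp)
  rw [← hv]
  simp [hi]

/-- The edge directions at one vertex are multiples of differences of vertices, and they already
span `V`. -/
theorem interior_nonempty : (interior (convexHull ℝ (b '' (F : Set (Finset ι))))).Nonempty := by
  obtain ⟨I, hI⟩ := h.nonempty
  rw [interior_convexHull_nonempty_iff_affineSpan_eq_top,
    AffineSubspace.affineSpan_eq_top_iff_vectorSpan_eq_top_of_nonempty _ _ _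
      (⟨b I, I, hI, rfl⟩ : (b '' (F : Set (Finset ι))).Nonempty), eq_top_iff, ← h.span_edge hI,
    Submodule.span_le]
  rintro _ ⟨i, rfl⟩
  obtain ⟨J, hJ, -, -, t, ht, hb⟩ := h.exists_flip I hI i i.2
  have : r I i = t⁻¹ • (b I - b J) := by rw [hb, smul_smul, inv_mul_cancel₀ ht.ne', one_smul]
  simp only [this]
  exact Submodule.smul_mem _ _ (vsub_mem_vectorSpan ℝ ⟨I, hI, rfl⟩ ⟨J, hJ, rfl⟩)

omit h [FiniteDimensional ℝ V] in
theorem inner_le_of_mem_convexHull {S : Set V} {v : V} {a : ℝ} (hS : ∀ x ∈ S, ⟪v, x⟫ ≤ a) {x : V}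
    (hx : x ∈ convexHull ℝ S) : ⟪v, x⟫ ≤ a := by
  have : convexHull ℝ S ⊆ {x | ⟪v, x⟫ ≤ a} :=
    convexHull_min hS (convex_halfSpace_le (innerₗ V v).isLinear a)
  exact this hx

theorem inner_interior_lt {p : V} (hp : p ∈ interior (convexHull ℝ (b '' (F : Set (Finset ι)))))
    {I : Finset ι} (hI : I ∈ F) {i : ι} (hi : i ∈ I) : ⟪w i, p⟫ < ⟪w i, b I⟫ := by
  have hw : 0 < ⟪w i, w i⟫ := by
    rw [real_inner_self_pos]
    intro h0
    simpa [h0] using h.inner_pos I hI i hi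
  have hcont : Filter.Tendsto (fun ε : ℝ => p + ε • w i) (nhdsWithin 0 (Set.Ioi 0))
      (nhds (p + (0 : ℝ) • w i)) :=
    tendsto_nhdsWithin_of_tendsto_nhds (Continuous.tendsto (by fun_prop) _)
  rw [zero_smul, add_zero] at hcont
  obtain ⟨ε, hε1, hε2⟩ := ((hcont.eventually (isOpen_interior.mem_nhds hp)).and
    self_mem_nhdsWithin).exists
  have := inner_le_of_mem_convexHull (v := w i) (a := ⟪w i, b I⟫) (S := b '' (F : Set (Finset ι)))
    (by rintro _ ⟨J, hJ, rfl⟩; exact h.inner_vertex_le hI hJ hi) (interior_subset hε1)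
  rw [inner_add_right, real_inner_smul_right] at this
  have h3 : 0 < ε * ⟪w i, w i⟫ := mul_pos hε2 hw
  linarith

/-- The rays can be scaled to be the vertices of the polar. -/
theorem exists_polar_vertices {p : V}
    (hp : p ∈ interior (convexHull ℝ (b '' (F : Set (Finset ι))))) :
    ∃ (φ : ι → V) (κ : ι → ℝ), (∀ i, 0 < κ i ∧ φ i = κ i • w i) ∧
      ∀ I ∈ F, ∀ i ∈ I, (∀ J ∈ F, ⟪φ i, b J - p⟫ ≤ 1) ∧
        ∀ J ∈ F, ⟪φ i, b J - p⟫ = 1 ↔ i ∈ J := by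
  classical
  -- The scaling uses an arbitrary facet containing `i`; `inner_vertex_le` in both directions shows
  -- that all such facets give the same value. The value 1 only keeps the factor positive for an
  -- index in no facet.
  refine ⟨_, fun i => if hi : ∃ I ∈ F, i ∈ I then (⟪w i, b hi.choose - p⟫)⁻¹ else 1,
    fun i => ⟨?_, rfl⟩, fun I hI i hi => ?_⟩
  · dsimp only
    split_ifs with hi
    · rw [inner_sub_right]
      exact inv_pos.2 (sub_pos.2 (h.inner_interior_lt hp hi.choose_spec.1 hi.choose_spec.2))
    · exact one_pos
  · have hex : ∃ I ∈ F, i ∈ I := ⟨I, hI, hi⟩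
    have hc := hex.choose_spec
    simp only [dif_pos hex, real_inner_smul_left]
    set K := hex.choose
    have hpos : 0 < ⟪w i, b K - p⟫ := by
      rw [inner_sub_right]; exact sub_pos.2 (h.inner_interior_lt hp hc.1 hc.2)
    have hle : ∀ J ∈ F, ⟪w i, b J - p⟫ ≤ ⟪w i, b K - p⟫ := fun J hJ => by
      have := h.inner_vertex_le hc.1 hJ hc.2
      simp only [inner_sub_right]; linarith
    refine ⟨fun J hJ => ?_, fun J hJ => ⟨fun he => ?_, fun hiJ => ?_⟩⟩
    · rw [inv_mul_le_iff₀ hpos, mul_one]; exact hle J hJ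
    · rw [inv_mul_eq_iff_eq_mul₀ hpos.ne', mul_one, inner_sub_right, inner_sub_right] at he
      exact h.mem_of_inner_vertex_le hc.1 hJ hc.2 (by linarith)
    · have h1 := hle J hJ
      have h2 := h.inner_vertex_le hJ hc.1 hiJ
      rw [inv_mul_eq_iff_eq_mul₀ hpos.ne', mul_one, inner_sub_right, inner_sub_right]
      rw [inner_sub_right, inner_sub_right] at h1
      linarith

omit h [FiniteDimensional ℝ V] in
theorem mem_polarAt_convexHull {S : Set V} {p y : V} :
    y ∈ polarAt p (convexHull ℝ S) ↔ ∀ x ∈ S, ⟪y, x - p⟫ ≤ 1 := by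
  simp only [polarAt, polar, Set.mem_ofPred_eq, Set.forall_mem_image]
  constructor
  · intro H x hx
    rw [real_inner_comm]
    exact H (subset_convexHull ℝ S hx)
  · intro H x hx
    have := inner_le_of_mem_convexHull (v := y) (a := 1 + ⟪y, p⟫) (S := S)
      (fun x hx => by have := H x hx; rw [inner_sub_right] at this; linarith) hx
    rw [real_inner_comm, inner_sub_right]
    linarith

omit h [FiniteDimensional ℝ V] in
theorem convex_polarAt_convexHull (S : Set V) (p : V) : Convex ℝ (polarAt p (convexHull ℝ S)) := by
  intro x hx y hy a c ha hc hac
  rw [mem_polarAt_convexHull] at *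
  intro z hz
  rw [inner_add_left, real_inner_smul_left, real_inner_smul_left]
  nlinarith [hx z hz, hy z hz]

/-- Inside the polar, every vector is a combination of the polar vertices of a facet at which it
is maximal, with nonnegative coefficients summing up to the maximum. -/
theorem exists_polar_expansion {p : V} {φ : ι → V} {κ : ι → ℝ}
    (hφ : ∀ i, 0 < κ i ∧ φ i = κ i • w i)
    (hv : ∀ I ∈ F, ∀ i ∈ I, (∀ J ∈ F, ⟪φ i, b J - p⟫ ≤ 1) ∧
        ∀ J ∈ F, ⟪φ i, b J - p⟫ = 1 ↔ i ∈ J)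
    {I : Finset ι} (hI : I ∈ F) {y : V} (hy : ∀ J ∈ F, ⟪y, b J - p⟫ ≤ ⟪y, b I - p⟫) :
    ∃ c : ι → ℝ, (∀ i, 0 ≤ c i) ∧ y = ∑ i ∈ I, c i • φ i ∧ ∑ i ∈ I, c i = ⟪y, b I - p⟫ := by
  obtain ⟨f, hf, he⟩ := h.exists_expansion_of_max hI (v := y) fun J hJ => by
    have := hy J hJ
    rw [inner_sub_right, inner_sub_right] at this
    linarith
  have he' : y = ∑ i ∈ I, (f i / κ i) • φ i := by
    refine he.trans (Finset.sum_congr rfl fun i _ => ?_)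
    rw [(hφ i).2, smul_smul, div_mul_cancel₀ _ (hφ i).1.ne']
  refine ⟨fun i => f i / κ i, fun i => div_nonneg (hf i) (hφ i).1.le, he', ?_⟩
  conv_rhs => rw [he', sum_inner]
  refine Finset.sum_congr rfl fun i hi => ?_
  rw [real_inner_smul_left, ((hv I hI i hi).2 I hI).2 hi, mul_one]

omit h [FiniteDimensional ℝ V] in
theorem sum_smul_mem_convexHull {I : Finset ι} {A : Set ι} {φ : ι → V} {c : ι → ℝ}
    (hc : ∀ i, 0 ≤ c i) (hsum : ∑ i ∈ I, c i = 1) (hA : ∀ i ∈ I, c i ≠ 0 → i ∈ A) :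
    ∑ i ∈ I, c i • φ i ∈ convexHull ℝ (φ '' A) := by
  classical
  rw [← Finset.sum_filter_of_ne (p := fun i => c i ≠ 0)
    (fun i _ hi h0 => hi (by rw [h0, zero_smul]))]
  refine (convex_convexHull ℝ _).sum_mem (fun i _ => hc i) ?_ fun i hi =>
    subset_convexHull ℝ _ ⟨i, hA i (Finset.mem_filter.1 hi).1 (Finset.mem_filter.1 hi).2, rfl⟩
  rw [Finset.sum_filter_ne_zero, hsum]

/-- Each point of the polar is a combination of the polar vertices of a facet where it is maximal,
with coefficients of sum at most 1. A proper exposed face is thus the hull of the polar vertices it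
contains, and these share a facet. Conversely, a face `A` of `K` is exposed by the sum of the
vectors `b J - p` over the facets `J` containing `A`. -/
theorem realizes {p : V} (hp : p ∈ interior (convexHull ℝ (b '' (F : Set (Finset ι)))))
    {K : LowerSet (Finset ι)} (hK : ∀ A, A ∈ K ↔ ∃ I ∈ F, A ⊆ I) :
    Realizes (polarAt p (convexHull ℝ (b '' (F : Set (Finset ι))))) K := by
  classical
  obtain ⟨φ, κ, hφ, hv⟩ := h.exists_polar_vertices hp
  have hmem : ∀ y, y ∈ polarAt p (convexHull ℝ (b '' (F : Set (Finset ι)))) ↔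
      ∀ J ∈ F, ⟪y, b J - p⟫ ≤ 1 := fun y => by
    rw [mem_polarAt_convexHull, Set.forall_mem_image]; rfl
  have hconv := convex_polarAt_convexHull (b '' (F : Set (Finset ι))) p
  set P := polarAt p (convexHull ℝ (b '' (F : Set (Finset ι)))) with hP
  have h0 : (0 : V) ∈ P := (hmem 0).2 fun J _ => by simp
  have hφP : ∀ I ∈ F, ∀ i ∈ I, φ i ∈ P := fun I hI i hi => (hmem _).2 (hv I hI i hi).1
  have hexp : ∀ y ∈ P, ∃ I ∈ F, ∃ c : ι → ℝ, (∀ i, 0 ≤ c i) ∧ y = ∑ i ∈ I, c i • φ i ∧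
      ∑ i ∈ I, c i = ⟪y, b I - p⟫ ∧ ∑ i ∈ I, c i ≤ 1 := fun y hy => by
    obtain ⟨I, hI, hmax⟩ := F.exists_max_image (fun I => ⟪y, b I - p⟫) h.nonempty
    obtain ⟨c, h1, h2, h3⟩ := h.exists_polar_expansion hφ hv hI hmax
    exact ⟨I, hI, c, h1, h2, h3, h3.trans_le ((hmem y).1 hy I hI)⟩
  have hli : ∀ I ∈ F, LinearIndependent ℝ (fun i : I => φ i) := fun I hI => by
    have := (h.linearIndependent_ray hI).units_smul
      (fun i : I => Units.mk0 (κ i) (hφ i).1.ne')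
    convert this using 2 with i
    exact (hφ i).2
  -- The point 0 is added to the generators so that it can carry the missing weight when the
  -- coefficients sum to less than 1.
  refine ⟨⟨insert 0 ((F.biUnion id).image φ), ?_⟩, φ, ?_, ?_, ?_⟩
  · apply Set.Subset.antisymm
    · intro y hy
      obtain ⟨I, hI, c, hc, rfl, -, hle⟩ := hexp y hy
      set C := convexHull ℝ ((insert 0 ((F.biUnion id).image φ) : Finset V) : Set V)
      have hC0 : (0 : V) ∈ C := subset_convexHull ℝ _ (by simp)
      have hCφ : ∀ i ∈ I, φ i ∈ C := fun i hi => subset_convexHull ℝ _ (by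
        simp only [Finset.coe_insert, Finset.coe_image]
        exact Or.inr ⟨i, Finset.mem_coe.2 (Finset.mem_biUnion.2 ⟨I, hI, hi⟩), rfl⟩)
      have hCc : Convex ℝ C := convex_convexHull ℝ _
      have := hCc.sum_mem (t := Finset.insertNone I) (w := fun o => o.elim (1 - ∑ i ∈ I, c i) c)
        (z := fun o => o.elim 0 φ) ?_ ?_ ?_
      · simpa [Finset.sum_insertNone] using this
      · rintro (_ | i) _
        · exact sub_nonneg.2 hle
        · exact hc i
      · simp [Finset.sum_insertNone]
      · rintro (_ | i) hi
        · exact hC0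
        · exact hCφ i (Finset.some_mem_insertNone.1 hi)
    · refine convexHull_min ?_ hconv
      intro y hy
      simp only [Finset.coe_insert, Finset.coe_image, Set.mem_insert_iff, Set.mem_image,
        Finset.mem_coe, Finset.mem_biUnion, id] at hy
      obtain rfl | ⟨i, ⟨I, hI, hi⟩, rfl⟩ := hy
      · exact h0
      · exact hφP I hI i hi
  · intro i hi j hj hij
    by_contra hne
    obtain ⟨I, hI, hiI⟩ := (hK _).1 hi
    obtain ⟨I', hI', hjI'⟩ := (hK _).1 hj
    rw [Finset.singleton_subset_iff] at hiI hjI'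
    have hjI : j ∈ I := ((hv I' hI' j hjI').2 I hI).1
      (by rw [← hij]; exact ((hv I hI i hiI).2 I hI).2 hiI)
    exact hne (congrArg Subtype.val ((hli I hI).injective (a₁ := ⟨i, hiI⟩) (a₂ := ⟨j, hjI⟩) hij))
  · intro A hA
    obtain ⟨I, hI, hAI⟩ := (hK _).1 hA
    exact ((hli I hI).comp (fun a : A => (⟨a, hAI a.2⟩ : I))
      (fun a a' haa => Subtype.ext (congrArg (fun z : I => (z : ι)) haa))).affineIndependent
  · ext G
    constructor
    · rintro ⟨hG, hGP⟩
      by_cases hne : G.Nonempty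
      swap
      · obtain ⟨I, hI⟩ := h.nonempty
        exact ⟨∅, (hK _).2 ⟨I, hI, Finset.empty_subset _⟩, by
          simpa using Set.not_nonempty_iff_eq_empty.1 hne⟩
      have hGc : Convex ℝ G := hG.convex hconv
      obtain ⟨l, hl⟩ := hG hne
      obtain ⟨y₁, hy₁⟩ := hne
      set M := l y₁ with hM
      have hy₁' : y₁ ∈ P ∧ ∀ y ∈ P, l y ≤ M := by rw [hl] at hy₁; exact hy₁
      have hGmem : ∀ y, y ∈ G ↔ y ∈ P ∧ l y = M := fun y => by
        rw [hl]
        exact ⟨fun hy => ⟨hy.1, le_antisymm (hy₁'.2 y hy.1) (hy.2 y₁ hy₁'.1)⟩,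
          fun hy => ⟨hy.1, fun z hz => by rw [hy.2]; exact hy₁'.2 z hz⟩⟩
      -- Every vector lies in `P` after scaling by a positive number. If the maximum of `l` were 0,
      -- then `l` would be nonpositive everywhere, hence zero, and the face would be all of `P`.
      have hM0 : 0 < M := by
        refine lt_of_le_of_ne (by simpa using hy₁'.2 0 h0) fun hM0 => hGP ?_
        have hlz : ∀ z, l z ≤ 0 := fun z => by
          have hs : 0 < 1 + ∑ J ∈ F, |⟪z, b J - p⟫| :=
            add_pos_of_pos_of_nonneg one_pos (Finset.sum_nonneg fun _ _ => abs_nonneg _)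
          have hz : (1 + ∑ J ∈ F, |⟪z, b J - p⟫|)⁻¹ • z ∈ P := (hmem _).2 fun J hJ => by
            rw [real_inner_smul_left, inv_mul_le_iff₀ hs, mul_one]
            have := Finset.single_le_sum (f := fun J => |⟪z, b J - p⟫|)
              (fun _ _ => abs_nonneg _) hJ
            have h2 := le_abs_self ⟪z, b J - p⟫
            linarith
          have := hy₁'.2 _ hz
          rw [map_smul, smul_eq_mul, inv_mul_le_iff₀ hs, ← hM0, mul_zero] at this
          exact this
        ext y
        rw [hGmem]
        refine ⟨fun hy => hy.1, fun hy => ⟨hy, ?_⟩⟩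
        have h1 := hlz (-y)
        rw [map_neg] at h1
        linarith [hlz y]
      have hlφ : ∀ I ∈ F, ∀ i ∈ I, l (φ i) ≤ M := fun I hI i hi => hy₁'.2 _ (hφP I hI i hi)
      set A := (F.biUnion id).filter (fun i => l (φ i) = M) with hA
      have hexpG : ∀ y ∈ G, ∃ I ∈ F, ∃ c : ι → ℝ, (∀ i, 0 ≤ c i) ∧ y = ∑ i ∈ I, c i • φ i ∧
          ∑ i ∈ I, c i = 1 ∧ ⟪y, b I - p⟫ = 1 ∧ ∀ i ∈ I, c i ≠ 0 → i ∈ A := fun y hy => by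
        obtain ⟨hyP, hyM⟩ := (hGmem y).1 hy
        obtain ⟨I, hI, c, hc, he, h1, hle⟩ := hexp y hyP
        -- The left side is nonnegative and the right side is nonpositive. So the coefficients sum
        -- to 1 and are supported on vertices where `l` attains `M`.
        have h2 : ∑ i ∈ I, c i * (M - l (φ i)) = M * ∑ i ∈ I, c i - M := by
          have : ∑ i ∈ I, c i * l (φ i) = M := by
            rw [← hyM, he, map_sum]
            exact Finset.sum_congr rfl fun i _ => by rw [map_smul, smul_eq_mul]
          rw [Finset.sum_congr rfl fun i _ => mul_sub (c i) M (l (φ i)), Finset.sum_sub_distrib,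
            ← Finset.sum_mul, this, mul_comm]
        have h3 : ∀ i ∈ I, 0 ≤ c i * (M - l (φ i)) := fun i hi =>
          mul_nonneg (hc i) (sub_nonneg.2 (hlφ I hI i hi))
        have h4 := Finset.sum_nonneg h3
        have h5 : ∑ i ∈ I, c i = 1 := by
          rw [h2] at h4
          exact le_antisymm hle (by nlinarith)
        rw [h5, mul_one, sub_self, Finset.sum_eq_zero_iff_of_nonneg h3] at h2
        refine ⟨I, hI, c, hc, he, h5, h1 ▸ h5, fun i hi hci => ?_⟩
        have := (mul_eq_zero.1 (h2 i hi)).resolve_left hci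
        exact Finset.mem_filter.2 ⟨Finset.mem_biUnion.2 ⟨I, hI, hi⟩, by linarith⟩
      have hAG : ∀ i ∈ A, φ i ∈ G := fun i hi => by
        obtain ⟨h1, h2⟩ := Finset.mem_filter.1 hi
        obtain ⟨I, hI, hiI⟩ := Finset.mem_biUnion.1 h1
        exact (hGmem _).2 ⟨hφP I hI i hiI, h2⟩
      have hAne : A.Nonempty := by
        obtain ⟨I, hI, c, hc, he, h1, h2, h3⟩ := hexpG y₁ hy₁
        obtain ⟨i, hi, hci⟩ := Finset.exists_ne_zero_of_sum_ne_zero (h1.trans_ne one_ne_zero)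
        exact ⟨i, h3 i hi hci⟩
      have hcard : (0 : ℝ) < A.card := by exact_mod_cast hAne.card_pos
      -- The barycenter of the vertices in the face is tight for some facet `I`. As each vertex has
      -- value at most 1 there, all are tight, so `A ⊆ I`.
      have hy₀ : ∑ i ∈ A, (A.card : ℝ)⁻¹ • φ i ∈ G :=
        hGc.sum_mem (fun _ _ => (inv_pos.2 hcard).le)
          (by rw [Finset.sum_const, nsmul_eq_mul, mul_inv_cancel₀ hcard.ne']) hAG
      refine ⟨A, (hK _).2 ?_, Set.Subset.antisymm (fun y hy => ?_) ?_⟩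
      · obtain ⟨I, hI, -, -, -, -, h1, -⟩ := hexpG _ hy₀
        refine ⟨I, hI, fun i hi => ?_⟩
        have hle : ∀ i ∈ A, 0 ≤ 1 - ⟪φ i, b I - p⟫ := fun i hi => by
          obtain ⟨J, hJ, hiJ⟩ := Finset.mem_biUnion.1 (Finset.mem_filter.1 hi).1
          exact sub_nonneg.2 ((hv J hJ i hiJ).1 I hI)
        have h2 : ∑ i ∈ A, (1 - ⟪φ i, b I - p⟫) = 0 := by
          rw [sum_inner] at h1
          rw [Finset.sum_congr rfl fun i _ => real_inner_smul_left (φ i) (b I - p) (A.card : ℝ)⁻¹,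
            ← Finset.mul_sum, inv_mul_eq_iff_eq_mul₀ hcard.ne', mul_one] at h1
          rw [Finset.sum_sub_distrib, h1]
          simp
        have h3 := (Finset.sum_eq_zero_iff_of_nonneg hle).1 h2 i hi
        obtain ⟨J, hJ, hiJ⟩ := Finset.mem_biUnion.1 (Finset.mem_filter.1 hi).1
        exact ((hv J hJ i hiJ).2 I hI).1 (by linarith)
      · obtain ⟨I, hI, c, hc, rfl, h1, -, h3⟩ := hexpG y hy
        exact sum_smul_mem_convexHull hc h1 h3
      · refine convexHull_min ?_ hGc
        rintro _ ⟨i, hi, rfl⟩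
        exact hAG i hi
    · rintro ⟨A, hA, rfl⟩
      obtain ⟨I, hI, hAI⟩ := (hK _).1 hA
      set S := F.filter (fun J => A ⊆ J) with hS
      set x := ∑ J ∈ S, (b J - p) with hx
      have hIS : I ∈ S := Finset.mem_filter.2 ⟨hI, hAI⟩
      have hcard : (0 : ℝ) < S.card := by exact_mod_cast Finset.card_pos.2 ⟨I, hIS⟩
      have hsub : convexHull ℝ (φ '' (A : Set ι)) ⊆ {y | y ∈ P ∧ ⟪x, y⟫ = S.card} := by
        refine convexHull_min ?_ (hconv.inter
          (convex_hyperplane (f := fun y => ⟪x, y⟫) (innerₗ V x).isLinear _))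
        rintro _ ⟨i, hi, rfl⟩
        refine ⟨hφP I hI i (hAI hi), ?_⟩
        show ⟪x, φ i⟫ = S.card
        rw [hx, sum_inner, Finset.sum_congr rfl (g := fun _ => (1 : ℝ))]
        · simp
        · intro J hJ
          obtain ⟨hJ, hAJ⟩ := Finset.mem_filter.1 hJ
          rw [real_inner_comm]
          exact ((hv I hI i (hAI hi)).2 J hJ).2 (hAJ hi)
      have hle : ∀ y ∈ P, ⟪x, y⟫ ≤ S.card := fun y hy => by
        rw [hx, sum_inner]
        calc ∑ J ∈ S, ⟪b J - p, y⟫ ≤ ∑ J ∈ S, (1 : ℝ) := Finset.sum_le_sum fun J hJ => by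
              rw [real_inner_comm]
              exact (hmem y).1 hy J (Finset.mem_filter.1 hJ).1
          _ = S.card := by simp
      have hsup : ∀ y ∈ P, ⟪x, y⟫ = S.card → y ∈ convexHull ℝ (φ '' (A : Set ι)) := by
        intro y hy hyx
        have hone : ∀ J ∈ S, ⟪y, b J - p⟫ = 1 := by
          have h1 : ∀ J ∈ S, 0 ≤ 1 - ⟪y, b J - p⟫ := fun J hJ =>
            sub_nonneg.2 ((hmem y).1 hy J (Finset.mem_filter.1 hJ).1)
          have h2 : ∑ J ∈ S, (1 - ⟪y, b J - p⟫) = 0 := by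
            rw [Finset.sum_sub_distrib, ← _root_.inner_sum, ← hx, real_inner_comm, hyx]
            simp
          intro J hJ
          have := (Finset.sum_eq_zero_iff_of_nonneg h1).1 h2 J hJ
          linarith
        obtain ⟨c, hc, he, hsum⟩ := h.exists_polar_expansion hφ hv hI (y := y) fun J hJ => by
          rw [hone I hIS]; exact (hmem y).1 hy J hJ
        rw [hone I hIS] at hsum
        rw [he]
        refine sum_smul_mem_convexHull hc hsum fun i hi hci => ?_
        by_contra hiA
        -- Flipping `i ∉ A` gives a facet that still contains `A`, so `y` is tight for it. But `φ i`
        -- is not tight there, which is impossible if it has a positive coefficient.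
        obtain ⟨J, hJ, hiJ, hIJ, -⟩ := h.exists_flip I hI i hi
        have hJS : J ∈ S := Finset.mem_filter.2 ⟨hJ, fun k hk =>
          hIJ k (hAI hk) (fun hki => hiA (by rw [← hki]; exact hk))⟩
        have h1 : ∀ k ∈ I, 0 ≤ c k * (1 - ⟪φ k, b J - p⟫) := fun k hk =>
          mul_nonneg (hc k) (sub_nonneg.2 ((hv I hI k hk).1 J hJ))
        have h2 : ∑ k ∈ I, c k * (1 - ⟪φ k, b J - p⟫) = 0 := by
          have h3 := hone J hJS
          rw [he, sum_inner] at h3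
          simp only [real_inner_smul_left] at h3
          simp only [mul_sub, mul_one, Finset.sum_sub_distrib]
          rw [h3, hsum, sub_self]
        have h3 := (mul_eq_zero.1 ((Finset.sum_eq_zero_iff_of_nonneg h1).1 h2 i hi)).resolve_left hci
        exact hiJ (((hv I hI i hi).2 J hJ).1 (by linarith))
      refine ⟨fun hne => ⟨innerSL ℝ x, Set.Subset.antisymm (fun y hy => ?_) ?_⟩, fun heq => ?_⟩
      · obtain ⟨h1, h2⟩ := hsub hy
        refine ⟨h1, fun z hz => ?_⟩
        simp only [innerSL_apply_apply]
        rw [h2]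
        exact hle z hz
      · rintro y ⟨hy, hmax⟩
        obtain ⟨z, hz⟩ := hne
        obtain ⟨hz1, hz2⟩ := hsub hz
        have := hmax z hz1
        simp only [innerSL_apply_apply] at this
        rw [hz2] at this
        exact hsup y hy (le_antisymm (hle y hy) this)
      · have h1 : (0 : V) ∈ convexHull ℝ (φ '' (A : Set ι)) := heq.symm ▸ h0
        have := (hsub h1).2
        rw [inner_zero_right] at this
        exact hcard.ne this

end FanPolytope

/-- Carries a realization along an injective relabelling of vertices, by composing the placement
with a left inverse. This takes the result from the subword complex to the cluster complex. -/
theorem Realizes.map {κ : Type*} {P : Set V} {K : LowerSet (Finset ι)}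
    {L : LowerSet (Finset κ)} (hP : Realizes P K) (e : ι → κ) (he : Function.Injective e)
    (hL : ∀ G : Finset κ, G ∈ L ↔ ∃ A ∈ K, (e '' (A : Set ι)) = G) : Realizes P L := by
  classical
  obtain ⟨h1, φ, h2, h3, h4⟩ := hP
  -- A left inverse of `e` needs a default value in `ι`; when `ι` is empty, only the empty face
  -- occurs.
  rcases isEmpty_or_nonempty ι with hι | hι
  · refine ⟨h1, fun _ => 0, ?_, ?_, ?_⟩
    · intro i hi
      obtain ⟨A, -, hA⟩ := (hL _).1 hi
      exfalso
      have : i ∈ (({i} : Finset κ) : Set κ) := by simp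
      rw [← hA] at this
      obtain ⟨a, -, -⟩ := this
      exact hι.false a
    · intro G hG
      obtain ⟨A, -, hA⟩ := (hL _).1 hG
      have : IsEmpty G := ⟨fun g => by
        have hg := g.2
        rw [← Finset.mem_coe, ← hA] at hg
        obtain ⟨a, -, -⟩ := hg
        exact hι.false a⟩
      exact affineIndependent_of_subsingleton ℝ _
    · rw [h4]
      ext X
      constructor
      · rintro ⟨A, hA, rfl⟩
        have hA0 : (A : Set ι) = ∅ := Set.eq_empty_of_isEmpty _
        exact ⟨∅, (hL _).2 ⟨A, hA, by simp [hA0]⟩, by simp [hA0]⟩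
      · rintro ⟨G, hG, rfl⟩
        obtain ⟨A, hA, hAG⟩ := (hL _).1 hG
        have hA0 : (A : Set ι) = ∅ := Set.eq_empty_of_isEmpty _
        exact ⟨A, hA, by rw [← hAG]; simp [hA0]⟩
  have hinv : ∀ i, Function.invFun e (e i) = i := Function.leftInverse_invFun he
  refine ⟨h1, φ ∘ Function.invFun e, ?_, ?_, ?_⟩
  · intro i hi j hj hij
    obtain ⟨A, hA, hAi⟩ := (hL _).1 hi
    obtain ⟨A', hA', hAj⟩ := (hL _).1 hj
    have hi' : i ∈ e '' (A : Set ι) := by rw [hAi]; simp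
    have hj' : j ∈ e '' (A' : Set ι) := by rw [hAj]; simp
    obtain ⟨a, ha, rfl⟩ := hi'
    obtain ⟨a', ha', rfl⟩ := hj'
    simp only [Function.comp, hinv] at hij
    rw [h2 (K.lower (Finset.singleton_subset_iff.2 ha) hA)
      (K.lower (Finset.singleton_subset_iff.2 ha') hA') hij]
  · intro G hG
    obtain ⟨A, hA, hAG⟩ := (hL _).1 hG
    have hmem : ∀ g : G, Function.invFun e g ∈ A := fun g => by
      have hg := g.2
      rw [← Finset.mem_coe, ← hAG] at hg
      obtain ⟨a, ha, hag⟩ := hg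
      rw [← hag, hinv]
      exact ha
    refine (h3 A hA).comp_embedding ⟨fun g : G => (⟨Function.invFun e g, hmem g⟩ : A), ?_⟩
    intro g g' hgg
    have hgg' : Function.invFun e g = Function.invFun e g' := congrArg Subtype.val hgg
    have hr : ∀ g : G, e (Function.invFun e g) = g := fun g => by
      have hg := g.2
      rw [← Finset.mem_coe, ← hAG] at hg
      obtain ⟨a, ha, hag⟩ := hg
      rw [← hag, hinv]
    exact Subtype.ext (by rw [← hr g, hgg', hr g'])
  · rw [h4]
    have him : ∀ A : Finset ι, (φ ∘ Function.invFun e) '' (e '' (A : Set ι)) = φ '' A := fun A => by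
      rw [Set.image_image]
      simp only [Function.comp, hinv]
    ext X
    constructor
    · rintro ⟨A, hA, rfl⟩
      exact ⟨A.image e, (hL _).2 ⟨A, hA, by simp⟩, by rw [Finset.coe_image, him]⟩
    · rintro ⟨G, hG, rfl⟩
      obtain ⟨A, hA, hAG⟩ := (hL _).1 hG
      exact ⟨A, hA, by rw [← hAG, him]⟩

end FanPolytope
end BrickPolytope

/-! ### Roots, signs and lengths. -/

namespace BrickPolytope
namespace RootData

variable {B W : Type*} [Group W] {M : CoxeterMatrix B} {cs : CoxeterSystem M W}
  {V : Type*} [NormedAddCommGroup V] [InnerProductSpace ℝ V]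
  (D : RootData cs V)

/-- Elements of the root system `W(Δ)`. -/
def IsRoot (β : V) : Prop := ∃ w i, β = D.ρ w (D.α i)

/-- Nonnegative combinations of the simple roots. -/
def Nonneg (v : V) : Prop := ∀ j, 0 ≤ D.α.repr v j

theorem ρ_mul (a b : W) (v : V) : D.ρ (a * b) v = D.ρ a (D.ρ b v) := by
  rw [map_mul]; rfl

theorem ρ_one (v : V) : D.ρ 1 v = v := by
  rw [map_one]; rfl

theorem ρ_inv_ρ (a : W) (v : V) : D.ρ a⁻¹ (D.ρ a v) = v := by
  rw [← ρ_mul, inv_mul_cancel, ρ_one]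

theorem ρ_ρ_inv (a : W) (v : V) : D.ρ a (D.ρ a⁻¹ v) = v := by
  rw [← ρ_mul, mul_inv_cancel, ρ_one]

theorem inner_ρ (a : W) (u v : V) : ⟪D.ρ a u, D.ρ a v⟫ = ⟪u, v⟫ :=
  LinearIsometryEquiv.inner_map_map _ _ _

theorem inner_ρ_left (a : W) (u v : V) : ⟪D.ρ a u, v⟫ = ⟪u, D.ρ a⁻¹ v⟫ := by
  rw [← D.inner_ρ a u, ρ_ρ_inv]

theorem inner_ρ_right (a : W) (u v : V) : ⟪u, D.ρ a v⟫ = ⟪D.ρ a⁻¹ u, v⟫ := by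
  rw [← D.inner_ρ a _ v, ρ_ρ_inv]

theorem ρ_ext {a b : W} (h : ∀ v, D.ρ a v = D.ρ b v) : a = b :=
  D.faithful (LinearIsometryEquiv.ext h)

theorem inner_α_self_pos (i : B) : 0 < ⟪D.α i, D.α i⟫ :=
  real_inner_self_pos.2 (D.α.ne_zero i)

theorem ρ_simple (i : B) (v : V) :
    D.ρ (cs.simple i) v = v - (2 * ⟪D.α i, v⟫ / ⟪D.α i, D.α i⟫) • D.α i := by
  rw [D.simple_eq, Submodule.reflection_orthogonal_apply, Submodule.reflection_singleton_apply,
    real_inner_self_eq_norm_sq, neg_sub, two_smul, ← add_smul, mul_div_assoc, two_mul]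
  rfl

theorem ρ_conj {g : W} {i : B} {β : V} (h : D.ρ g (D.α i) = β) (v : V) :
    D.ρ (g * cs.simple i * g⁻¹) v = v - (2 * ⟪β, v⟫ / ⟪β, β⟫) • β := by
  rw [ρ_mul, ρ_mul, ρ_simple, map_sub, ρ_ρ_inv, map_smul, ← inner_ρ_left, h, ← h, inner_ρ]

theorem conj_eq_of_root_eq {g g' : W} {i i' : B} (h : D.ρ g (D.α i) = D.ρ g' (D.α i')) :
    g * cs.simple i * g⁻¹ = g' * cs.simple i' * g'⁻¹ :=
  D.ρ_ext fun v => by rw [D.ρ_conj h, D.ρ_conj rfl]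

theorem conj_eq_of_root_eq_neg {g g' : W} {i i' : B} (h : D.ρ g (D.α i) = -D.ρ g' (D.α i')) :
    g * cs.simple i * g⁻¹ = g' * cs.simple i' * g'⁻¹ :=
  D.ρ_ext fun v => by
    rw [D.ρ_conj h, D.ρ_conj rfl, inner_neg_left, inner_neg_neg, smul_neg, mul_neg, neg_div,
      neg_smul, neg_neg]

theorem repr_ρ_simple_of_ne {i j : B} (h : i ≠ j) (v : V) :
    D.α.repr (D.ρ (cs.simple i) v) j = D.α.repr v j := by
  classical
  rw [ρ_simple, map_sub, map_smul, Module.Basis.repr_self, Finsupp.sub_apply, Finsupp.smul_apply,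
    Finsupp.single_apply, if_neg h, smul_zero, sub_zero]

theorem repr_ρ_simple_self (i : B) (v : V) :
    D.α.repr (D.ρ (cs.simple i) v) i = D.α.repr v i - 2 * ⟪D.α i, v⟫ / ⟪D.α i, D.α i⟫ := by
  rw [ρ_simple, map_sub, map_smul, Module.Basis.repr_self, Finsupp.sub_apply, Finsupp.smul_apply,
    Finsupp.single_eq_same, smul_eq_mul, mul_one]

/-- A simple reflection changes only the coordinate along its own simple root. -/
theorem repr_ρ_wordProd_of_notMem {l : List B} {j : B} (h : j ∉ l) (v : V) :
    D.α.repr (D.ρ (cs.wordProd l) v) j = D.α.repr v j := by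
  induction l with
  | nil => rw [cs.wordProd_nil, ρ_one]
  | cons i l ih =>
    rw [List.mem_cons, not_or] at h
    rw [cs.wordProd_cons, ρ_mul, D.repr_ρ_simple_of_ne (Ne.symm h.1), ih h.2]

theorem repr_α [DecidableEq B] (i j : B) : D.α.repr (D.α i) j = if i = j then 1 else 0 := by
  rw [Module.Basis.repr_self, Finsupp.single_apply]

theorem nonneg_α (i : B) : D.Nonneg (D.α i) := fun j => by
  classical
  rw [repr_α]; split_ifs <;> norm_num

theorem isRoot_α (i : B) : D.IsRoot (D.α i) := ⟨1, i, (D.ρ_one _).symm⟩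

variable {D}

theorem IsRoot.map {β : V} (h : D.IsRoot β) (w : W) : D.IsRoot (D.ρ w β) := by
  obtain ⟨g, i, rfl⟩ := h
  exact ⟨w * g, i, (D.ρ_mul _ _ _).symm⟩

theorem IsRoot.neg {β : V} (h : D.IsRoot β) : D.IsRoot (-β) := by
  obtain ⟨g, i, rfl⟩ := h
  refine ⟨g * cs.simple i, i, ?_⟩
  have : D.ρ (cs.simple i) (D.α i) = - D.α i := by
    rw [ρ_simple, mul_div_assoc, div_self (D.inner_α_self_pos i).ne', mul_one, two_smul]
    abel
  rw [ρ_mul, this, map_neg]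

theorem IsRoot.ne_zero {β : V} (h : D.IsRoot β) : β ≠ 0 := by
  obtain ⟨g, i, rfl⟩ := h
  exact fun h0 => D.α.ne_zero i ((map_eq_zero_iff _ (D.ρ g).injective).1 h0)

theorem IsRoot.inner_self_pos {β : V} (h : D.IsRoot β) : 0 < ⟪β, β⟫ :=
  real_inner_self_pos.2 h.ne_zero

theorem Nonneg.not_neg {β : V} (h : D.Nonneg β) (h0 : β ≠ 0) : ¬ D.Nonneg (-β) := fun hn => by
  refine h0 ((map_eq_zero_iff _ D.α.repr.injective).1 (Finsupp.ext fun j => ?_))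
  have h1 := h j
  have h2 := hn j
  rw [map_neg, Finsupp.neg_apply] at h2
  exact le_antisymm (neg_nonneg.1 h2) h1

theorem Nonneg.add {u v : V} (hu : D.Nonneg u) (hv : D.Nonneg v) : D.Nonneg (u + v) := fun j => by
  rw [map_add]; exact add_nonneg (hu j) (hv j)

theorem Nonneg.smul {u : V} (hu : D.Nonneg u) {a : ℝ} (ha : 0 ≤ a) : D.Nonneg (a • u) := fun j => by
  rw [map_smul]; exact mul_nonneg ha (hu j)

variable (D)

theorem ρ_simple_α (i : B) : D.ρ (cs.simple i) (D.α i) = - D.α i := by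
  rw [ρ_simple, mul_div_assoc, div_self (D.inner_α_self_pos i).ne', mul_one, two_smul]
  abel

theorem ext_inner_α {u v : V} (h : ∀ j, ⟪D.α j, u⟫ = ⟪D.α j, v⟫) : u = v :=
  ext_inner_left ℝ fun x => LinearMap.congr_fun
    (D.α.ext h : (innerₗ V).flip u = (innerₗ V).flip v) x

variable [FiniteDimensional ℝ V]

theorem inner_weight_left (j : B) (v : V) :
    ⟪D.weight j, v⟫ = ⟪D.α j, D.α j⟫ / 2 * D.α.repr v j := by
  rw [weight, real_inner_smul_left, InnerProductSpace.toDual_symm_apply]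
  rfl

theorem inner_weight_nonneg (j : B) {v : V} (h : D.Nonneg v) : 0 ≤ ⟪D.weight j, v⟫ := by
  rw [inner_weight_left]
  exact mul_nonneg (half_pos (D.inner_α_self_pos j)).le (h j)

theorem inner_weight_pos_iff (j : B) (v : V) : 0 < ⟪D.weight j, v⟫ ↔ 0 < D.α.repr v j := by
  rw [inner_weight_left]
  exact mul_pos_iff_of_pos_left (half_pos (D.inner_α_self_pos j))

theorem inner_weight_eq_zero_iff (j : B) (v : V) : ⟪D.weight j, v⟫ = 0 ↔ D.α.repr v j = 0 := by
  rw [inner_weight_left]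
  exact mul_eq_zero_iff_left (half_pos (D.inner_α_self_pos j)).ne'

theorem ρ_simple_weight_self (i : B) :
    D.ρ (cs.simple i) (D.weight i) = D.weight i - D.α i := by
  classical
  rw [ρ_simple, inner_weight, if_pos rfl, mul_div_cancel₀ _ two_ne_zero,
    div_self (D.inner_α_self_pos i).ne', one_smul]

theorem ρ_simple_weight_of_ne {i j : B} (h : i ≠ j) :
    D.ρ (cs.simple i) (D.weight j) = D.weight j := by
  classical
  rw [ρ_simple, inner_weight, if_neg h, mul_zero, zero_div, zero_smul, sub_zero]

theorem ρ_wordProd_weight_of_notMem {l : List B} {j : B} (h : j ∉ l) :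
    D.ρ (cs.wordProd l) (D.weight j) = D.weight j := by
  induction l with
  | nil => rw [cs.wordProd_nil, ρ_one]
  | cons i l ih =>
    rw [List.mem_cons, not_or] at h
    rw [cs.wordProd_cons, ρ_mul, ih h.2, D.ρ_simple_weight_of_ne (Ne.symm h.1)]

variable {D}

/-- A root with coordinates of both signs would be orthogonal to a suitable point of the open
chamber, contrary to `chamber`. -/
theorem IsRoot.nonneg_or_neg {β : V} (h : D.IsRoot β) : D.Nonneg β ∨ D.Nonneg (-β) := by
  classical
  have : Fintype B := FiniteDimensional.fintypeBasisIndex D.α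
  by_contra hcon
  simp only [Nonneg, not_or, not_forall, not_le, map_neg, Finsupp.neg_apply] at hcon
  obtain ⟨⟨j, hj⟩, k, hk⟩ := hcon
  set f := D.α.repr β with hf
  set P := ∑ i, max (f i) 0
  set N := ∑ i, max (-f i) 0
  have hP : 0 < P := Finset.sum_pos' (fun i _ => le_max_right _ _)
    ⟨k, Finset.mem_univ _, lt_max_of_lt_left (by linarith)⟩
  have hN : 0 < N := Finset.sum_pos' (fun i _ => le_max_right _ _)
    ⟨j, Finset.mem_univ _, lt_max_of_lt_left (by linarith)⟩
  -- The values `P` on negative coordinates and `N` on the others balance: `⟪β, x⟫` is `N * P - P *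
  -- N`.
  set x : V := ∑ i, ((if f i < 0 then P else N) * (2 / ⟪D.α i, D.α i⟫)) • D.weight i with hx
  have hαx : ∀ i, ⟪D.α i, x⟫ = if f i < 0 then P else N := fun i => by
    rw [hx, inner_sum, Finset.sum_eq_single i]
    · rw [real_inner_smul_right, inner_weight, if_pos rfl]
      have := (D.inner_α_self_pos i).ne'
      field_simp
    · intro l _ hl
      rw [real_inner_smul_right, inner_weight, if_neg hl.symm, mul_zero]
    · simp
  have hβx : ⟪β, x⟫ = 0 := by
    rw [← D.α.sum_repr β, sum_inner]
    calc ∑ i, ⟪D.α.repr β i • D.α i, x⟫ = ∑ i, (N * max (f i) 0 - P * max (-f i) 0) := by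
          refine Finset.sum_congr rfl fun i _ => ?_
          rw [real_inner_smul_left, hαx]
          split_ifs with hi
          · rw [max_eq_right hi.le, max_eq_left (by linarith)]; ring
          · rw [max_eq_left (not_lt.1 hi), max_eq_right (by linarith [not_lt.1 hi])]; ring
      _ = 0 := by rw [Finset.sum_sub_distrib, ← Finset.mul_sum, ← Finset.mul_sum]; ring
  obtain ⟨w, i, rfl⟩ := h
  exact D.chamber x (fun i => by rw [hαx]; split_ifs <;> assumption) w i hβx

theorem IsRoot.nonneg_of_repr_pos {β : V} (h : D.IsRoot β) {j : B} (hj : 0 < D.α.repr β j) :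
    D.Nonneg β := h.nonneg_or_neg.resolve_right fun hn => by
  have := hn j
  rw [map_neg, Finsupp.neg_apply] at this
  linarith

theorem IsRoot.neg_of_repr_neg {β : V} (h : D.IsRoot β) {j : B} (hj : D.α.repr β j < 0) :
    D.Nonneg (-β) := h.neg.nonneg_of_repr_pos (j := j) (by
  rw [map_neg, Finsupp.neg_apply]; linarith)

-- The image of `α j` under the `i`-th reflection still has coordinate 1 along `α j`, so it is a
-- positive root; its coordinate along `α i` is then nonnegative.
variable (D) in
theorem inner_α_nonpos {i j : B} (h : i ≠ j) : ⟪D.α i, D.α j⟫ ≤ 0 := by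
  classical
  have h1 : D.Nonneg (D.ρ (cs.simple i) (D.α j)) :=
    ((D.isRoot_α j).map _).nonneg_of_repr_pos (j := j) (by
      rw [D.repr_ρ_simple_of_ne h, repr_α, if_pos rfl]; exact one_pos)
  have h2 := h1 i
  rw [repr_ρ_simple_self, repr_α, if_neg h.symm, zero_sub, neg_nonneg] at h2
  by_contra hcon
  have : 0 < 2 * ⟪D.α i, D.α j⟫ / ⟪D.α i, D.α i⟫ :=
    div_pos (by linarith) (D.inner_α_self_pos i)
  linarith

/-- Only the coordinate along `α i` changes. If the image were negative, all other coordinates of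
`β` would vanish, and `reduced` would give `β = α i`. -/
theorem IsRoot.ρ_simple_nonneg {β : V} (h : D.IsRoot β) (hpos : D.Nonneg β) {i : B}
    (hi : β ≠ D.α i) : D.Nonneg (D.ρ (cs.simple i) β) := by
  classical
  refine (h.map _).nonneg_or_neg.resolve_right fun hn => hi ?_
  have h0 : ∀ k, k ≠ i → D.α.repr β k = 0 := fun k hk => by
    have := hn k
    rw [map_neg, Finsupp.neg_apply, D.repr_ρ_simple_of_ne hk.symm] at this
    exact le_antisymm (by linarith) (hpos k)
  have h1 : β = D.α.repr β i • D.α i := by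
    refine D.α.repr.injective (Finsupp.ext fun k => ?_)
    rw [map_smul, Finsupp.smul_apply, repr_α]
    split_ifs with hk
    · subst hk; simp
    · rw [h0 k (Ne.symm hk), smul_zero]
  obtain ⟨w, j, hw⟩ := id h
  rcases D.reduced w j i _ (hw.symm.trans h1) with h2 | h2
  · rw [h1, h2, one_smul]
  · have := hpos i
    rw [h2] at this
    linarith

/-- A positive root which becomes negative under the inverse of a word is the root of one of its
letters. -/
theorem IsRoot.exists_split {l : List B} {γ : V} (hγ : D.IsRoot γ) (hpos : D.Nonneg γ)
    (hneg : D.Nonneg (-D.ρ (cs.wordProd l)⁻¹ γ)) :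
    ∃ a t b, l = a ++ t :: b ∧ γ = D.ρ (cs.wordProd a) (D.α t) := by
  induction l generalizing γ with
  | nil =>
    rw [cs.wordProd_nil, inv_one, ρ_one] at hneg
    exact absurd hneg (hpos.not_neg hγ.ne_zero)
  | cons i l ih =>
    by_cases hi : γ = D.α i
    · exact ⟨[], i, l, rfl, by rw [cs.wordProd_nil, ρ_one, hi]⟩
    · rw [cs.wordProd_cons, mul_inv_rev, cs.inv_simple, ρ_mul] at hneg
      obtain ⟨a, t, b, rfl, h⟩ := ih (hγ.map _) (hγ.ρ_simple_nonneg hpos hi) hneg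
      refine ⟨i :: a, t, b, rfl, ?_⟩
      rw [cs.wordProd_cons, ρ_mul, ← h, ← ρ_mul, cs.simple_mul_simple_self, ρ_one]

variable (D)

/-- The exchange property: `α i` is the root of a letter of the reversed reduced word, so
multiplying by the reflection deletes that letter. -/
theorem length_mul_simple_lt {w : W} {i : B} (h : D.Nonneg (-D.ρ w (D.α i))) :
    cs.length (w * cs.simple i) < cs.length w := by
  obtain ⟨l, hl, rfl⟩ := cs.exists_isReduced w
  have h1 : cs.wordProd l = (cs.wordProd l.reverse)⁻¹ := by rw [cs.wordProd_reverse, inv_inv]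
  rw [h1] at h
  obtain ⟨a, t, b, hs, ha⟩ := (D.isRoot_α i).exists_split (D.nonneg_α i) h
  have h2 : cs.simple i = cs.wordProd a * cs.simple t * (cs.wordProd a)⁻¹ := by
    have := D.conj_eq_of_root_eq (g := 1) (i := i) (g' := cs.wordProd a) (i' := t)
      (by rw [ρ_one, ha])
    simpa only [one_mul, inv_one, mul_one] using this
  have h3 : cs.wordProd l * cs.simple i = cs.wordProd (a ++ b).reverse := by
    rw [h1, hs, h2, cs.wordProd_reverse, cs.wordProd_append, cs.wordProd_append, cs.wordProd_cons]
    simp [mul_assoc]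
  have h4 : l.length = a.length + (b.length + 1) := by
    rw [← l.length_reverse, hs]; simp
  calc cs.length (cs.wordProd l * cs.simple i) ≤ (a ++ b).reverse.length := by
        rw [h3]; exact cs.length_wordProd_le _
    _ < l.length := by rw [h4, List.length_reverse, List.length_append]; omega
    _ = cs.length (cs.wordProd l) := hl.symm

theorem length_lt_mul_simple {w : W} {i : B} (h : D.Nonneg (D.ρ w (D.α i))) :
    cs.length w < cs.length (w * cs.simple i) := by
  have := D.length_mul_simple_lt (w := w * cs.simple i) (i := i) (by
    rw [ρ_mul, ρ_simple_α, map_neg, neg_neg]; exact h)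
  rwa [mul_assoc, cs.simple_mul_simple_self, mul_one] at this

theorem nonneg_iff_length {w : W} {i : B} :
    D.Nonneg (D.ρ w (D.α i)) ↔ cs.length (w * cs.simple i) = cs.length w + 1 := by
  constructor
  · intro h
    have := D.length_lt_mul_simple h
    rcases cs.length_mul_simple w i with h1 | h1 <;> omega
  · intro h
    refine ((D.isRoot_α i).map w).nonneg_or_neg.resolve_right fun hn => ?_
    have := D.length_mul_simple_lt hn
    omega

theorem eq_one_of_nonneg {w : W} (h : ∀ i, D.Nonneg (D.ρ w (D.α i))) : w = 1 := by
  by_contra hw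
  obtain ⟨i, hi⟩ := cs.exists_rightDescent_of_ne_one hw
  have := D.length_lt_mul_simple (h i)
  exact absurd hi (by unfold CoxeterSystem.IsRightDescent; omega)

theorem nonneg_of_forall_α {w : W} (h : ∀ i, D.Nonneg (-D.ρ w (D.α i))) {v : V}
    (hv : D.Nonneg v) : D.Nonneg (-D.ρ w v) := by
  have : Fintype B := FiniteDimensional.fintypeBasisIndex D.α
  rw [← D.α.sum_repr v, map_sum, ← Finset.sum_neg_distrib]
  have : ∀ s : Finset B, D.Nonneg (∑ i ∈ s, -D.ρ w (D.α.repr v i • D.α i)) := fun s =>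
    Finset.sum_induction _ D.Nonneg (fun _ _ => Nonneg.add) (fun j => by simp) fun i _ => by
      rw [map_smul, ← smul_neg]
      exact (h i).smul (hv i)
  exact this _

end RootData

variable {B W : Type*} [Group W] {M : CoxeterMatrix B} {cs : CoxeterSystem M W}

theorem IsLongest.inv {w : W} (h : IsLongest cs w) : IsLongest cs w⁻¹ := fun u => by
  rw [cs.length_inv]; exact h u

namespace RootData

variable {V : Type*} [NormedAddCommGroup V] [InnerProductSpace ℝ V] [FiniteDimensional ℝ V]
  (D : RootData cs V)

theorem longest_α {w : W} (h : IsLongest cs w) (i : B) : D.Nonneg (-D.ρ w (D.α i)) :=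
  ((D.isRoot_α i).map w).nonneg_or_neg.resolve_left fun hn =>
    absurd (D.length_lt_mul_simple hn) (not_lt.2 (h _))

theorem longest_nonneg {w : W} (h : IsLongest cs w) {v : V} (hv : D.Nonneg v) :
    D.Nonneg (-D.ρ w v) := D.nonneg_of_forall_α (D.longest_α h) hv

/-- The element `w₀⁻¹ * w` keeps all simple roots positive, so no simple reflection shortens it. -/
theorem eq_longest {w w₀ : W} (h₀ : IsLongest cs w₀) (h : ∀ i, D.Nonneg (-D.ρ w (D.α i))) :
    w = w₀ := by
  have h1 : w₀⁻¹ * w = 1 := D.eq_one_of_nonneg fun i => by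
    have := D.longest_nonneg h₀.inv (h i)
    rwa [map_neg, neg_neg, ← ρ_mul] at this
  exact (inv_mul_eq_one.1 h1).symm

/-- The Demazure product of a word containing a reduced expression of the longest element. -/
theorem demazure_append (D : RootData cs V) {w₀ : W} (h₀ : IsLongest cs w₀) (c u : List B)
    (hu : cs.IsReduced u) (hprod : cs.wordProd u = w₀) : demazure cs (c ++ u) = w₀ := by
  classical
  unfold demazure
  rw [List.foldl_append]
  generalize List.foldl _ (1 : W) c = x
  -- Invariant: the Demazure product `x` makes negative every positive root that the reduced product
  -- `v` makes negative. When `v` has become the longest element, so has `x`.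
  have key : ∀ (u : List B) (x v : W),
      (∀ β, D.IsRoot β → D.Nonneg β → D.Nonneg (-D.ρ v β) → D.Nonneg (-D.ρ x β)) →
      cs.length (v * cs.wordProd u) = cs.length v + u.length →
      ∀ β, D.IsRoot β → D.Nonneg β → D.Nonneg (-D.ρ (v * cs.wordProd u) β) →
      D.Nonneg (-D.ρ (u.foldl (fun w i => if cs.length (w * cs.simple i) = cs.length w + 1
        then w * cs.simple i else w) x) β) := by
    intro u
    induction u with
    | nil => intro x v H _; simpa using H
    | cons s u ih =>
      intro x v H hlen
      have h1 := cs.length_mul_le (v * cs.simple s) (cs.wordProd u)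
      have h2 := cs.length_wordProd_le u
      have h3 := cs.length_mul_le v (cs.simple s)
      rw [cs.length_simple] at h3
      rw [cs.wordProd_cons, ← mul_assoc, List.length_cons] at hlen
      have hv : D.Nonneg (D.ρ v (D.α s)) := D.nonneg_iff_length.2 (by omega)
      rw [cs.wordProd_cons, ← mul_assoc, List.foldl_cons]
      refine ih _ _ ?_ (by omega)
      intro β hβ hβ0 hneg
      by_cases hβs : β = D.α s
      · subst hβs
        split_ifs with hx
        · rw [ρ_mul, ρ_simple_α, map_neg, neg_neg]
          exact D.nonneg_iff_length.2 hx
        · exact ((D.isRoot_α s).map x).nonneg_or_neg.resolve_left fun h =>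
            hx (D.nonneg_iff_length.1 h)
      · have hδ := hβ.ρ_simple_nonneg hβ0 hβs
        rw [ρ_mul] at hneg
        have hxδ := H _ (hβ.map _) hδ hneg
        split_ifs with hx
        · rw [ρ_mul]; exact hxδ
        · have hxs : D.Nonneg (-D.ρ x (D.α s)) :=
            ((D.isRoot_α s).map x).nonneg_or_neg.resolve_left fun h =>
              hx (D.nonneg_iff_length.1 h)
          -- For a skipped letter the reflected root is `β - k • α s`. If `k` is nonnegative, the
          -- negativity of `x (α s)` suffices; otherwise the positivity of `v (α s)` makes `v β`
          -- negative and the invariant applies to `β`.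
          set k := 2 * ⟪D.α s, β⟫ / ⟪D.α s, D.α s⟫ with hk
          have he : D.ρ (cs.simple s) β = β - k • D.α s := D.ρ_simple s β
          rcases le_total 0 k with hk0 | hk0
          · have : -D.ρ x β = -D.ρ x (D.ρ (cs.simple s) β) + k • -D.ρ x (D.α s) := by
              rw [he, map_sub, map_smul, smul_neg]; abel
            rw [this]
            exact hxδ.add (hxs.smul hk0)
          · refine H β hβ hβ0 ?_
            have : -D.ρ v β = -D.ρ v (D.ρ (cs.simple s) β) + (-k) • D.ρ v (D.α s) := by
              rw [he, map_sub, map_smul, neg_smul]; abel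
            rw [this]
            exact hneg.add (hv.smul (by linarith))
  refine D.eq_longest h₀ fun i => key u x 1 ?_ ?_ _ (D.isRoot_α i) (D.nonneg_α i) ?_
  · intro β hβ hβ0 h1
    rw [ρ_one] at h1
    exact absurd h1 (hβ0.not_neg hβ.ne_zero)
  · rw [one_mul, cs.length_one, zero_add]; exact hu
  · rw [one_mul, hprod]; exact D.longest_α h₀ i

end RootData
end BrickPolytope

/-! ### Orbits of fundamental weights under a Coxeter element. -/

namespace BrickPolytope
namespace RootData

variable {B W : Type*} [Group W] {M : CoxeterMatrix B} {cs : CoxeterSystem M W}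
  {V : Type*} [NormedAddCommGroup V] [InnerProductSpace ℝ V]
  (D : RootData cs V)

/-- Only the first reflection of the word affects the coordinate along its simple root. It must
therefore act trivially, and the rest of the word also fixes `v`. -/
theorem inner_α_eq_zero_of_fixed {l : List B} (hl : l.Nodup) {v : V}
    (h : D.ρ (cs.wordProd l) v = v) : ∀ i ∈ l, ⟪D.α i, v⟫ = 0 := by
  induction l generalizing v with
  | nil => simp
  | cons i l ih =>
    obtain ⟨hi, hl⟩ := List.nodup_cons.1 hl
    rw [cs.wordProd_cons, ρ_mul] at h
    have h1 := congrArg (fun x => D.α.repr x i) h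
    simp only [repr_ρ_simple_self, D.repr_ρ_wordProd_of_notMem hi] at h1
    have h2 : ⟪D.α i, D.ρ (cs.wordProd l) v⟫ = 0 := by
      have h3 : 2 * ⟪D.α i, D.ρ (cs.wordProd l) v⟫ / ⟪D.α i, D.α i⟫ = 0 := by linarith
      simpa [D.α.ne_zero i] using h3
    rw [ρ_simple, h2, mul_zero, zero_div, zero_smul, sub_zero] at h
    intro j hj
    rcases List.mem_cons.1 hj with rfl | hj
    · rwa [h] at h2
    · exact ih hl h j hj

theorem coxeter_fixed {l : List B} (hl : l.Nodup) (hfull : ∀ i, i ∈ l) {v : V}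
    (h : D.ρ (cs.wordProd l) v = v) : v = 0 :=
  D.ext_inner_α fun j => by rw [D.inner_α_eq_zero_of_fixed hl h j (hfull j), inner_zero_right]

theorem coxeter_sub_injective {l : List B} (hl : l.Nodup) (hfull : ∀ i, i ∈ l) {u v : V}
    (h : u - D.ρ (cs.wordProd l) u = v - D.ρ (cs.wordProd l) v) : u = v := by
  rw [← sub_eq_zero]
  refine D.coxeter_fixed hl hfull ?_
  rw [map_sub]
  rw [sub_eq_sub_iff_sub_eq_sub] at h
  exact h.symm

theorem repr_wordProd_α_self {a : List B} {t : B} (h : t ∉ a) :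
    D.α.repr (D.ρ (cs.wordProd a) (D.α t)) t = 1 := by
  rw [D.repr_ρ_wordProd_of_notMem h, Module.Basis.repr_self, Finsupp.single_eq_same]

variable [FiniteDimensional ℝ V]

/-- The root of the first occurrence of the letter `t` in the powers of `c`. -/
noncomputable def firstRoot (c : W) (t : B) : V := D.weight t - D.ρ c (D.weight t)

theorem firstRoot_eq {a b : List B} {t : B} (ha : t ∉ a) (hb : t ∉ b) :
    D.firstRoot (cs.wordProd (a ++ t :: b)) t = D.ρ (cs.wordProd a) (D.α t) := by
  rw [firstRoot, cs.wordProd_append, cs.wordProd_cons, ρ_mul, ρ_mul,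
    D.ρ_wordProd_weight_of_notMem hb, ρ_simple_weight_self, map_sub,
    D.ρ_wordProd_weight_of_notMem ha]
  abel

theorem ρ_pow_firstRoot (c : W) (t : B) (a : ℕ) : D.ρ (c ^ a) (D.firstRoot c t) =
    D.ρ (c ^ a) (D.weight t) - D.ρ (c ^ (a + 1)) (D.weight t) := by
  rw [firstRoot, map_sub, pow_succ, ρ_mul]

/-- Since `g` is an isometry, the pairing of `g β` with `weight k` is minus that of `β` with `weight
t`, so the coordinate along `α k` is negative. -/
theorem neg_of_weight_eq_neg {g : W} {t k : B} (h : D.ρ g (D.weight t) = -D.weight k) {β : V}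
    (hβ : D.IsRoot (D.ρ g β)) (hpos : 0 < D.α.repr β t) : D.Nonneg (-D.ρ g β) := by
  refine hβ.neg_of_repr_neg (j := k) ?_
  have h1 : 0 < ⟪D.weight k, -D.ρ g β⟫ := by
    rw [inner_neg_right, ← inner_neg_left, ← h, inner_ρ]
    exact (D.inner_weight_pos_iff t β).2 hpos
  rw [inner_weight_pos_iff, map_neg, Finsupp.neg_apply] at h1
  linarith

theorem repr_simple_pos [Fintype B] {y : V} {s t : B} (hy : D.Nonneg y) (hst : s ≠ t)
    (ht : D.α.repr y t = 0) (hs : 0 < D.α.repr y s) (hadj : ⟪D.α s, D.α t⟫ ≠ 0) :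
    0 < D.α.repr (D.ρ (cs.simple t) y) t := by
  have h1 : ⟪D.α t, y⟫ < 0 := by
    rw [← D.α.sum_repr y, inner_sum, ← neg_pos, ← Finset.sum_neg_distrib]
    refine Finset.sum_pos' (fun i _ => ?_) ⟨s, Finset.mem_univ _, ?_⟩
    · rw [real_inner_smul_right, ← mul_neg]
      by_cases hi : i = t
      · rw [hi, ht, zero_mul]
      · exact mul_nonneg (hy i) (neg_nonneg.2 (D.inner_α_nonpos (Ne.symm hi)))
    · rw [real_inner_smul_right, ← mul_neg]
      refine mul_pos hs (neg_pos.2 (lt_of_le_of_ne (D.inner_α_nonpos hst.symm) ?_))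
      rwa [real_inner_comm]
  rw [repr_ρ_simple_self, ht, zero_sub, neg_pos]
  exact div_neg_of_neg_of_pos (by linarith) (D.inner_α_self_pos t)

/-- These two positive coordinates feed `neg_of_weight_eq_neg`, so that the runs of two
nonorthogonal letters interlace: once the run of one has ended, that of the other ends within one
round. -/
theorem firstRoot_repr_pos [Fintype B] {a b : List B} {s t : B} (hc : (a ++ t :: b).Nodup)
    (hs : s ∈ a) (hadj : ⟪D.α s, D.α t⟫ ≠ 0) :
    0 < D.α.repr (D.firstRoot (cs.wordProd (a ++ t :: b)) t) s ∧
    0 < D.α.repr (D.ρ (cs.wordProd (a ++ t :: b))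
      (D.firstRoot (cs.wordProd (a ++ t :: b)) s)) t := by
  classical
  obtain ⟨a₁, a₂, rfl⟩ := List.append_of_mem hs
  have hN := hc
  simp only [List.append_assoc, List.cons_append, List.nodup_append, List.nodup_cons,
    List.mem_append, List.mem_cons, not_or] at hN
  obtain ⟨-, ⟨⟨hsa₂, hst, hsb⟩, -, ⟨htb, -⟩, h4⟩, h5⟩ := hN
  have hta₁ : t ∉ a₁ := fun h => h5 t h t (by simp) rfl
  have hsa₁ : s ∉ a₁ := fun h => h5 s h s (by simp) rfl
  have hta₂ : t ∉ a₂ := fun h => h4 t h t (by simp) rfl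
  have hta : t ∉ a₁ ++ s :: a₂ := by simp [hta₁, hta₂, Ne.symm hst]
  constructor
  · rw [D.firstRoot_eq hta htb, cs.wordProd_append, cs.wordProd_cons, ρ_mul, ρ_mul,
      D.repr_ρ_wordProd_of_notMem hsa₁]
    have h1 := D.repr_wordProd_α_self hta₂
    refine D.repr_simple_pos (s := t) (((D.isRoot_α t).map _).nonneg_of_repr_pos (j := t) ?_)
      (Ne.symm hst) ?_ ?_ (by rwa [real_inner_comm])
    · rw [h1]; exact one_pos
    · rw [D.repr_ρ_wordProd_of_notMem hsa₂, repr_α, if_neg (Ne.symm hst)]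
    · rw [h1]; exact one_pos
  · have h2 : D.firstRoot (cs.wordProd (a₁ ++ s :: a₂ ++ t :: b)) s =
        D.ρ (cs.wordProd a₁) (D.α s) := by
      rw [List.append_assoc, List.cons_append]
      exact D.firstRoot_eq hsa₁ (by simp [hsa₂, hst, hsb])
    rw [h2, cs.wordProd_append, cs.wordProd_cons t, ρ_mul, ρ_mul,
      D.repr_ρ_wordProd_of_notMem hta]
    have h1 : D.α.repr (D.ρ (cs.wordProd b) (D.ρ (cs.wordProd a₁) (D.α s))) s = 1 := by
      rw [D.repr_ρ_wordProd_of_notMem hsb, D.repr_wordProd_α_self hsa₁]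
    refine D.repr_simple_pos (s := s)
      ((((D.isRoot_α s).map _).map _).nonneg_of_repr_pos (j := s) ?_) hst ?_ ?_ hadj
    · rw [h1]; exact one_pos
    · rw [D.repr_ρ_wordProd_of_notMem htb, D.repr_ρ_wordProd_of_notMem hta₁, repr_α, if_neg hst]
    · rw [h1]; exact one_pos

theorem exists_firstRoot_split {c : List B} (hc : c.Nodup) (hfull : ∀ i, i ∈ c) (t : B) :
    ∃ a b, c = a ++ t :: b ∧ t ∉ a ∧ t ∉ b ∧
      D.firstRoot (cs.wordProd c) t = D.ρ (cs.wordProd a) (D.α t) := by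
  obtain ⟨a, b, rfl⟩ := List.append_of_mem (hfull t)
  have h := hc
  rw [List.nodup_append, List.nodup_cons] at h
  have hta : t ∉ a := fun h' => h.2.2 t h' t (by simp) rfl
  exact ⟨a, b, rfl, hta, h.2.1.1, D.firstRoot_eq hta h.2.1.1⟩

theorem isRoot_firstRoot {c : List B} (hc : c.Nodup) (hfull : ∀ i, i ∈ c) (t : B) :
    D.IsRoot (D.firstRoot (cs.wordProd c) t) := by
  obtain ⟨a, b, -, -, -, h⟩ := D.exists_firstRoot_split hc hfull t
  rw [h]
  exact (D.isRoot_α t).map _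

theorem repr_firstRoot_self {c : List B} (hc : c.Nodup) (hfull : ∀ i, i ∈ c) (t : B) :
    D.α.repr (D.firstRoot (cs.wordProd c) t) t = 1 := by
  obtain ⟨a, b, -, hta, -, h⟩ := D.exists_firstRoot_split hc hfull t
  rw [h, D.repr_wordProd_α_self hta]

theorem exists_eq_firstRoot {c : List B} (hc : c.Nodup) {β : V} (hβ : D.IsRoot β)
    (hpos : D.Nonneg β) (hneg : D.Nonneg (-D.ρ (cs.wordProd c)⁻¹ β)) :
    ∃ k, β = D.firstRoot (cs.wordProd c) k := by
  obtain ⟨a, t, b, rfl, h⟩ := hβ.exists_split hpos hneg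
  rw [List.nodup_append, List.nodup_cons] at hc
  exact ⟨t, by rw [h, D.firstRoot_eq (fun h' => hc.2.2 t h' t (by simp) rfl) hc.2.1.1]⟩

/-- In the orbit of a fundamental weight under a Coxeter element, the first step along a negative
root starts at the negative of a fundamental weight. -/
theorem exists_weight_eq_neg {c : List B} (hc : c.Nodup) (hfull : ∀ i, i ∈ c) {t : B} {a : ℕ}
    (h : D.Nonneg (-D.ρ (cs.wordProd c ^ a) (D.firstRoot (cs.wordProd c) t))) :
    ∃ a' ≤ a, ∃ k, D.ρ (cs.wordProd c ^ a') (D.weight t) = -D.weight k := by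
  classical
  set C := cs.wordProd c with hC
  have hr := D.isRoot_firstRoot hc hfull t
  have hex : ∃ a, D.Nonneg (-D.ρ (C ^ a) (D.firstRoot C t)) := ⟨a, h⟩
  have hspec := Nat.find_spec hex
  have hle : Nat.find hex ≤ a := Nat.find_min' hex h
  refine ⟨Nat.find hex, hle, ?_⟩
  rcases Nat.eq_zero_or_pos (Nat.find hex) with hz | hp
  · rw [hz, pow_zero, ρ_one] at hspec
    refine absurd hspec (Nonneg.not_neg (hr.nonneg_of_repr_pos (j := t) ?_) hr.ne_zero)
    rw [D.repr_firstRoot_self hc hfull]; exact one_pos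
  · obtain ⟨m, hm⟩ := Nat.exists_eq_succ_of_ne_zero hp.ne'
    have hmin := Nat.find_min hex (m := m) (by omega)
    rw [hm] at hspec ⊢
    have hpos := (hr.map (C ^ m)).nonneg_or_neg.resolve_right hmin
    -- At the first sign change, minus the new root is positive and is made negative by `C⁻¹`, so it
    -- is a first root `(1 - C) ω_k`. The step along the orbit is `(1 - C) C^(m+1) ω_t`, and
    -- injectivity of `1 - C` identifies the weights.
    obtain ⟨k, hk⟩ := D.exists_eq_firstRoot hc (hr.map (C ^ (m + 1))).neg hspec (by
      rw [map_neg, neg_neg, pow_succ', ρ_mul, ← hC, ρ_inv_ρ]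
      exact hpos)
    refine ⟨k, D.coxeter_sub_injective hc hfull ?_⟩
    rw [map_neg, ← hC, ← ρ_mul, ← pow_succ', ← ρ_pow_firstRoot, neg_sub_neg, ← neg_sub,
      ← neg_inj, neg_neg]
    exact hk

/-- The sum of the images of `β` under all powers of the Coxeter element is fixed by it, hence zero.
It cannot consist of nonnegative vectors only. -/
theorem exists_neg [Finite W] {c : List B} (hc : c.Nodup) (hfull : ∀ i, i ∈ c) {β : V}
    (hβ : D.IsRoot β) : ∃ a, D.Nonneg (-D.ρ (cs.wordProd c ^ a) β) := by
  by_contra hcon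
  push Not at hcon
  set C := cs.wordProd c with hC
  have hpos : ∀ a, D.Nonneg (D.ρ (C ^ a) β) := fun a =>
    (hβ.map _).nonneg_or_neg.resolve_right (hcon a)
  have hsum : ∑ a ∈ Finset.range (orderOf C), D.ρ (C ^ a) β = 0 := by
    refine D.coxeter_fixed hc hfull ?_
    have h1 : ∀ a, D.ρ C (D.ρ (C ^ a) β) = D.ρ (C ^ (a + 1)) β := fun a => by
      rw [← ρ_mul, ← pow_succ']
    rw [← hC, map_sum, Finset.sum_congr rfl fun a _ => h1 a, ← sub_eq_zero,
      ← Finset.sum_sub_distrib, Finset.sum_range_sub (fun a => D.ρ (C ^ a) β), pow_orderOf_eq_one,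
      pow_zero, sub_self]
  refine hβ.ne_zero ((map_eq_zero_iff _ D.α.repr.injective).1 (Finsupp.ext fun j => ?_))
  have h1 := congrArg (fun x => D.α.repr x j) hsum
  simp only [map_sum, map_zero, Finsupp.coe_finsetSum, Finset.sum_apply, Finsupp.zero_apply] at h1
  have h2 := Finset.single_le_sum (f := fun a => D.α.repr (D.ρ (C ^ a) β) j)
    (fun a _ => hpos a j) (Finset.mem_range.2 (orderOf_pos C))
  have h3 := hpos 0 j
  simp only [pow_zero, ρ_one] at h2 h3
  exact le_antisymm (h2.trans h1.le) h3

/-- The lengths of the initial runs of positive roots in the orbits of a Coxeter element. -/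
theorem exists_run_lengths [Finite W] [DecidableEq B] {c : List B} (hc : c.Nodup)
    (hfull : ∀ i, i ∈ c) : ∃ d : B → ℕ,
      (∀ t, ∃ k, D.ρ (cs.wordProd c ^ d t) (D.weight t) = -D.weight k) ∧
      (∀ t a, a < d t → D.Nonneg (D.ρ (cs.wordProd c ^ a) (D.firstRoot (cs.wordProd c) t))) ∧
      ∀ s t, c.idxOf s < c.idxOf t → ⟪D.α s, D.α t⟫ ≠ 0 → d t ≤ d s ∧ d s ≤ d t + 1 := by
  have : Fintype B := FiniteDimensional.fintypeBasisIndex D.α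
  set C := cs.wordProd c with hC
  have hdead : ∀ t, ∃ a, ∃ k, D.ρ (C ^ a) (D.weight t) = -D.weight k := fun t => by
    obtain ⟨a, ha⟩ := D.exists_neg hc hfull (D.isRoot_firstRoot hc hfull t)
    obtain ⟨a', -, h⟩ := D.exists_weight_eq_neg hc hfull ha
    exact ⟨a', h⟩
  classical
  have hle : ∀ t a, D.Nonneg (-D.ρ (C ^ a) (D.firstRoot C t)) → Nat.find (hdead t) ≤ a :=
    fun t a h => by
      obtain ⟨a', ha', h'⟩ := D.exists_weight_eq_neg hc hfull h
      exact (Nat.find_min' (hdead t) h').trans ha'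
  -- The run length of `t` is the first exponent taking its weight to the negative of a fundamental
  -- weight.
  refine ⟨fun t => Nat.find (hdead t), fun t => Nat.find_spec (hdead t), fun t a ha => ?_,
    fun s t hst hadj => ?_⟩
  · exact ((D.isRoot_firstRoot hc hfull t).map _).nonneg_or_neg.resolve_right
      fun h => (hle t a h).not_gt ha
  · have hlt := List.idxOf_lt_length_of_mem (hfull t)
    have hsplit : c = c.take (c.idxOf t) ++ t :: c.drop (c.idxOf t + 1) := by
      conv_lhs => rw [← List.take_append_drop (c.idxOf t) c, List.drop_eq_getElem_cons hlt,
        List.getElem_idxOf]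
    have hs : s ∈ c.take (c.idxOf t) := (List.mem_take_iff_idxOf_lt (hfull s)).2 hst
    obtain ⟨h1, h2⟩ := D.firstRoot_repr_pos (cs := cs) (by rw [← hsplit]; exact hc) hs hadj
    rw [← hsplit, ← hC] at h1 h2
    obtain ⟨k, hk⟩ := Nat.find_spec (hdead s)
    obtain ⟨k', hk'⟩ := Nat.find_spec (hdead t)
    constructor
    · exact hle t _ (D.neg_of_weight_eq_neg hk ((D.isRoot_firstRoot hc hfull t).map _) h1)
    · refine hle s _ ?_
      rw [pow_succ, ρ_mul]
      exact D.neg_of_weight_eq_neg hk' (((D.isRoot_firstRoot hc hfull s).map _).map _) h2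

theorem α_eq_sum_weight [Fintype B] (t : B) :
    D.α t = ∑ s, (2 * ⟪D.α s, D.α t⟫ / ⟪D.α s, D.α s⟫) • D.weight s := by
  classical
  refine D.ext_inner_α fun j => ?_
  rw [inner_sum, Finset.sum_eq_single j]
  · rw [real_inner_smul_right, inner_weight, if_pos rfl]
    have := (D.inner_α_self_pos j).ne'
    field_simp
  · intro l _ hl
    rw [real_inner_smul_right, inner_weight, if_neg hl.symm, mul_zero]
  · simp

/-- In the basis of weights, `α t` involves only those of `t` and of the letters not orthogonal to
`t`. -/
theorem ρ_α_congr {g h : W} {t : B}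
    (H : ∀ s, ⟪D.α s, D.α t⟫ ≠ 0 → D.ρ g (D.weight s) = D.ρ h (D.weight s)) :
    D.ρ g (D.α t) = D.ρ h (D.α t) := by
  have : Fintype B := FiniteDimensional.fintypeBasisIndex D.α
  rw [D.α_eq_sum_weight t, map_sum, map_sum]
  refine Finset.sum_congr rfl fun s _ => ?_
  rw [map_smul, map_smul]
  by_cases hs : ⟪D.α s, D.α t⟫ = 0
  · rw [hs, mul_zero, zero_div, zero_smul, zero_smul]
  · rw [H s hs]

end RootData
end BrickPolytope

/-! ### The sorting word of the longest element. -/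

namespace BrickPolytope

theorem list_eq_of_pairwise_lt {α : Type*} [LinearOrder α] {l₁ l₂ : List α}
    (h₁ : l₁.Pairwise (· < ·)) (h₂ : l₂.Pairwise (· < ·)) (h : ∀ x, x ∈ l₁ ↔ x ∈ l₂) : l₁ = l₂ :=
  ((List.perm_ext_iff_of_nodup (h₁.imp ne_of_lt) (h₂.imp ne_of_lt)).2 h).eq_of_pairwise
    (fun _ _ _ _ hab hba => absurd hba hab.asymm) h₁ h₂

section Greedy

variable {B : Type*} (c : List B) (hc : c ≠ []) (d : B → ℕ)

/-- The letter at a position of the infinite word `c c c ⋯`. -/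
def cycLetter (z : ℕ) : B := c.get ⟨z % c.length, Nat.mod_lt _ (List.length_pos_iff.2 hc)⟩

/-- The subword of an initial segment of `c c c ⋯` which takes the first `d s` letters `s`. -/
def runWord (z : ℕ) : List B :=
  ((List.range z).filter (fun y => y / c.length < d (cycLetter c hc y))).map (cycLetter c hc)

/-- The number of letters `s` in `runWord c hc d z`. -/
def runCount [DecidableEq B] (z : ℕ) (s : B) : ℕ :=
  min (z / c.length + if c.idxOf s < z % c.length then 1 else 0) (d s)

theorem runWord_succ (z : ℕ) : runWord c hc d (z + 1) = runWord c hc d z ++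
    if z / c.length < d (cycLetter c hc z) then [cycLetter c hc z] else [] := by
  unfold runWord
  rw [List.range_succ, List.filter_append, List.map_append]
  split_ifs with h <;> simp [h]

variable {c}

theorem runCount_succ [DecidableEq B] (hn : c.Nodup) (hfull : ∀ i, i ∈ c) (z : ℕ) (s : B) :
    runCount c d (z + 1) s = runCount c d z s +
      if s = cycLetter c hc z ∧ z / c.length < d s then 1 else 0 := by
  have hpos := List.length_pos_iff.2 hc
  have hs := List.idxOf_lt_length_of_mem (hfull s)
  have hr := Nat.mod_lt z hpos
  have hiff : s = cycLetter c hc z ↔ c.idxOf s = z % c.length := by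
    constructor
    · rintro rfl
      exact hn.idxOf_getElem _ _
    · intro h
      simp only [cycLetter, ← h]
      exact (List.getElem_idxOf hs).symm
  simp only [hiff]
  unfold runCount
  have hz := Nat.div_add_mod z c.length
  rcases Nat.lt_or_ge (z % c.length + 1) c.length with h | h
  · have h1 : (z + 1) / c.length = z / c.length := by
      rw [Nat.div_eq_iff hpos]
      constructor
      · rw [mul_comm]; omega
      · rw [mul_comm]; omega
    have h2 : (z + 1) % c.length = z % c.length + 1 := by
      rw [Nat.add_mod, Nat.mod_eq_of_lt (a := 1) (by omega), Nat.mod_eq_of_lt h]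
    rw [h1, h2]
    split_ifs <;> omega
  · have h0 : z + 1 = c.length * (z / c.length + 1) := by rw [mul_add]; omega
    have h1 : (z + 1) / c.length = z / c.length + 1 := by
      rw [h0, Nat.mul_div_cancel_left _ hpos]
    have h2 : (z + 1) % c.length = 0 := by rw [h0, Nat.mul_mod_right]
    rw [h1, h2]
    split_ifs <;> omega

end Greedy

namespace RootData

variable {B W : Type*} [Group W] {M : CoxeterMatrix B} {cs : CoxeterSystem M W}
  {V : Type*} [NormedAddCommGroup V] [InnerProductSpace ℝ V] [FiniteDimensional ℝ V]
  (D : RootData cs V)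

/-- By interlacing, when `t` is due in round `a`, its neighbours before it in `c` have been taken `a
+ 1` times, and `t` itself and its later neighbours `a` times. So `g` agrees with `C ^ a` times the
part of `c` before `t` on all weights that matter for `α t`. Once the run of `t` is exhausted, `g`
sends the weight of `t` to the negative of a fundamental weight. -/
theorem run_step [DecidableEq B] {c : List B} (hn : c.Nodup) (hfull : ∀ i, i ∈ c) (hc : c ≠ [])
    {d : B → ℕ}
    (hd : ∀ t, ∃ k, D.ρ (cs.wordProd c ^ d t) (D.weight t) = -D.weight k)
    (hadj : ∀ s t, c.idxOf s < c.idxOf t → ⟪D.α s, D.α t⟫ ≠ 0 → d t ≤ d s ∧ d s ≤ d t + 1)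
    {z : ℕ} {g : W}
    (hg : ∀ s, D.ρ g (D.weight s) = D.ρ (cs.wordProd c ^ runCount c d z s) (D.weight s)) :
    (z / c.length < d (cycLetter c hc z) → D.ρ g (D.α (cycLetter c hc z)) =
      D.ρ (cs.wordProd c ^ (z / c.length)) (D.firstRoot (cs.wordProd c) (cycLetter c hc z))) ∧
    (d (cycLetter c hc z) ≤ z / c.length →
      D.Nonneg (-D.ρ g (D.α (cycLetter c hc z)))) := by
  have hpos := List.length_pos_iff.2 hc
  have hr := Nat.mod_lt z hpos
  set t := cycLetter c hc z with ht
  have hidx : c.idxOf t = z % c.length := hn.idxOf_getElem _ _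
  constructor
  · intro hlt
    have hsplit : c = c.take (z % c.length) ++ t :: c.drop (z % c.length + 1) := by
      conv_lhs => rw [← List.take_append_drop (z % c.length) c, List.drop_eq_getElem_cons hr]
      rfl
    have hN : (c.take (z % c.length) ++ t :: c.drop (z % c.length + 1)).Nodup := by
      rw [← hsplit]; exact hn
    have hN' := hN
    rw [List.nodup_append, List.nodup_cons] at hN'
    have hta : t ∉ c.take (z % c.length) := fun h' => hN'.2.2 t h' t (by simp) rfl
    have hfr : D.firstRoot (cs.wordProd c) t =
        D.ρ (cs.wordProd (c.take (z % c.length))) (D.α t) := by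
      conv_lhs => rw [hsplit]
      exact D.firstRoot_eq hta hN'.2.1.1
    rw [hfr, ← ρ_mul]
    refine D.ρ_α_congr fun s hs => ?_
    rw [hg, ρ_mul]
    by_cases hst : c.idxOf s < z % c.length
    · have hmem : s ∈ c.take (z % c.length) := (List.mem_take_iff_idxOf_lt (hfull s)).2 hst
      have hnot : s ∉ t :: c.drop (z % c.length + 1) := fun h' => hN'.2.2 s hmem s h' rfl
      have h1 : D.ρ (cs.wordProd (c.take (z % c.length))) (D.weight s) =
          D.ρ (cs.wordProd c) (D.weight s) := by
        conv_rhs => rw [hsplit, cs.wordProd_append, ρ_mul, D.ρ_wordProd_weight_of_notMem hnot]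
      have h2 := (hadj s t (by rw [hidx]; exact hst) hs).1
      have h3 : runCount c d z s = z / c.length + 1 := by
        unfold runCount
        rw [if_pos hst]
        omega
      rw [h1, ← ρ_mul, ← pow_succ, h3]
    · have hnot : s ∉ c.take (z % c.length) := fun h' =>
        hst ((List.mem_take_iff_idxOf_lt (hfull s)).1 h')
      have h3 : runCount c d z s = z / c.length := by
        unfold runCount
        rw [if_neg hst]
        rcases eq_or_ne s t with rfl | hne
        · omega
        · have hlt' : c.idxOf t < c.idxOf s := by
            rw [hidx]
            refine lt_of_le_of_ne (not_lt.1 hst) fun he => hne ?_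
            have h5 : c.idxOf s < c.length := List.idxOf_lt_length_of_mem (hfull s)
            have h6 : c.get ⟨c.idxOf s, h5⟩ = s := List.getElem_idxOf h5
            rw [← h6, ht, cycLetter]
            simp only [he]
          have := (hadj t s hlt' (by rwa [real_inner_comm])).2
          omega
      rw [D.ρ_wordProd_weight_of_notMem hnot, h3]
  · intro hle
    obtain ⟨k, hk⟩ := hd t
    refine D.neg_of_weight_eq_neg (k := k) (t := t) ?_ ((D.isRoot_α t).map g)
      (by rw [repr_α, if_pos rfl]; exact one_pos)
    rw [hg, ← hk]
    unfold runCount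
    rw [hidx, if_neg (lt_irrefl _), add_zero, min_eq_right hle]

/-- Each letter taken has a positive root, so the word stays reduced. Taking `t` subtracts `C ^ a`
of its first root from `C ^ a` of its weight, which leaves `C ^ (a + 1)` of the weight; other
weights do not move. -/
theorem run_invariant [DecidableEq B] {c : List B} (hn : c.Nodup) (hfull : ∀ i, i ∈ c)
    (hc : c ≠ []) {d : B → ℕ}
    (hd : ∀ t, ∃ k, D.ρ (cs.wordProd c ^ d t) (D.weight t) = -D.weight k)
    (hnn : ∀ t a, a < d t →
      D.Nonneg (D.ρ (cs.wordProd c ^ a) (D.firstRoot (cs.wordProd c) t)))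
    (hadj : ∀ s t, c.idxOf s < c.idxOf t → ⟪D.α s, D.α t⟫ ≠ 0 → d t ≤ d s ∧ d s ≤ d t + 1)
    (z : ℕ) :
    (∀ s, (runWord c hc d z).count s = runCount c d z s) ∧
    cs.IsReduced (runWord c hc d z) ∧
    ∀ l, l <+: runWord c hc d z → ∀ s,
      D.ρ (cs.wordProd l) (D.weight s) = D.ρ (cs.wordProd c ^ l.count s) (D.weight s) := by
  induction z with
  | zero =>
    have h0 : runWord c hc d 0 = [] := rfl
    refine ⟨fun s => ?_, ?_, fun l hl s => ?_⟩
    · simp [h0, runCount]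
    · rw [h0]; simp [CoxeterSystem.IsReduced]
    · rw [h0, List.prefix_nil] at hl
      rw [hl, cs.wordProd_nil, List.count_nil, pow_zero]
  | succ z ih =>
    obtain ⟨hcount, hred, hpre⟩ := ih
    have hg : ∀ s, D.ρ (cs.wordProd (runWord c hc d z)) (D.weight s) =
        D.ρ (cs.wordProd c ^ runCount c d z s) (D.weight s) := fun s => by
      rw [hpre _ List.prefix_rfl, hcount]
    obtain ⟨hstep, -⟩ := D.run_step hn hfull hc hd hadj hg
    have hcount' : ∀ s, (runWord c hc d (z + 1)).count s = runCount c d (z + 1) s := fun s => by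
      rw [runWord_succ, List.count_append, hcount, runCount_succ hc d hn hfull]
      congr 1
      by_cases hs : s = cycLetter c hc z
      · subst hs
        split_ifs with h1 h2 h2 <;> simp_all
      · rw [if_neg (fun h : s = cycLetter c hc z ∧ z / c.length < d s => hs h.1)]
        split_ifs <;> simp [Ne.symm hs]
    refine ⟨hcount', ?_⟩
    rw [runWord_succ]
    split_ifs with hlt
    swap
    · rw [List.append_nil]; exact ⟨hred, hpre⟩
    have hα := hstep hlt
    set t := cycLetter c hc z with ht
    have hlen : cs.length (cs.wordProd (runWord c hc d z) * cs.simple t) =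
        cs.length (cs.wordProd (runWord c hc d z)) + 1 :=
      D.nonneg_iff_length.1 (by rw [hα]; exact hnn _ _ hlt)
    have hidx : c.idxOf t = z % c.length := hn.idxOf_getElem _ _
    have hct : (runWord c hc d z).count t = z / c.length := by
      rw [hcount, runCount, hidx, if_neg (lt_irrefl _), add_zero, min_eq_left hlt.le]
    refine ⟨?_, fun l hl s => ?_⟩
    · unfold CoxeterSystem.IsReduced at hred ⊢
      rw [cs.wordProd_append, cs.wordProd_singleton, hlen, hred, List.length_append,
        List.length_singleton]
    · rw [List.prefix_concat_iff] at hl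
      rcases hl with rfl | hl
      · rw [cs.wordProd_append, cs.wordProd_singleton, ρ_mul, List.count_append]
        rcases eq_or_ne t s with rfl | hts
        · rw [ρ_simple_weight_self, map_sub, hα, hpre _ List.prefix_rfl, hct, ρ_pow_firstRoot,
            sub_sub_cancel, List.count_singleton_self]
        · rw [D.ρ_simple_weight_of_ne hts, hpre _ List.prefix_rfl]
          simp [hts]
      · exact hpre l hl s

/-- The word of runs is the lexicographically first one because it is greedy: a letter is skipped
only when taking it would decrease the length. -/
theorem isSortingWord_spec [Finite W] [DecidableEq B] {w₀ : W} (h₀ : IsLongest cs w₀)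
    {c : List B} (hn : c.Nodup) (hfull : ∀ i, i ∈ c) {u : List B} (hu : IsSortingWord cs c w₀ u) :
    cs.IsReduced u ∧ cs.wordProd u = w₀ ∧ ∀ l, l <+: u → ∀ s,
      D.ρ (cs.wordProd l) (D.weight s) = D.ρ (cs.wordProd c ^ l.count s) (D.weight s) := by
  obtain ⟨p, ⟨hp, hprod⟩, hmin, rfl⟩ := hu
  rcases eq_or_ne c [] with rfl | hc
  · have h1 : powSubword ([] : List B) p = [] := by simp [powSubword]
    rw [h1] at hprod ⊢
    refine ⟨by simp [CoxeterSystem.IsReduced], hprod, fun l hl s => ?_⟩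
    rw [List.prefix_nil.1 hl]
    simp
  obtain ⟨d, hd, hnn, hadj⟩ := D.exists_run_lengths (cs := cs) hn hfull
  have inv := D.run_invariant hn hfull hc hd hnn hadj
  have hpos := List.length_pos_iff.2 hc
  have : Fintype B := FiniteDimensional.fintypeBasisIndex D.α
  have hpow : ∀ {N : ℕ} (q : Fin N → ℕ),
      powSubword c q = (List.ofFn q).map (cycLetter c hc) := fun q => by
    unfold powSubword
    rw [← List.filterMap_eq_map]
    refine List.filterMap_congr fun k _ => ?_
    rw [List.getElem?_eq_getElem (Nat.mod_lt _ hpos)]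
    rfl
  -- After as many rounds as the longest run, every weight has reached the negative of a fundamental
  -- weight, so all simple roots have become negative.
  set Z := c.length * Finset.univ.sup d with hZ
  have hlast : cs.wordProd (runWord c hc d Z) = w₀ := D.eq_longest h₀ fun t => by
    obtain ⟨k, hk⟩ := hd t
    refine D.neg_of_weight_eq_neg (k := k) (t := t) ?_ ((D.isRoot_α t).map _)
      (by rw [repr_α, if_pos rfl]; exact one_pos)
    rw [(inv Z).2.2 _ List.prefix_rfl, (inv Z).1, ← hk]
    unfold runCount
    rw [hZ, Nat.mul_div_cancel_left _ hpos, min_eq_right]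
    exact le_add_right (Finset.le_sup (Finset.mem_univ t))
  set G := (List.range Z).filter (fun y => y / c.length < d (cycLetter c hc y)) with hG
  have hGsort : G.Pairwise (· < ·) := (List.pairwise_lt_range).filter _
  have hlen : G.length = cs.length w₀ := by
    rw [← hlast, (inv Z).2.1]
    unfold runWord
    rw [List.length_map]
  set g : Fin (cs.length w₀) → ℕ := fun i => G.get (i.cast hlen.symm) with hgdef
  have hgofn : List.ofFn g = G := by
    apply List.ext_getElem
    · simp [hlen]
    · intro i h1 h2
      simp [hgdef]
  have hgmono : StrictMono g := by
    intro i j hij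
    exact List.pairwise_iff_getElem.1 hGsort _ _ _ _ hij
  have hgprod : powSubword c g = runWord c hc d Z := by rw [hpow, hgofn]; rfl
  have hle := hmin g ⟨hgmono, by rw [hgprod, hlast]⟩
  have hpg : p = g := by
    rcases hle.eq_or_lt with h | h
    · exact h
    exfalso
    obtain ⟨k, hk1, hk2⟩ := h
    change p k < g k at hk2
    change ∀ j < k, p j = g j at hk1
    have hgG : ∀ j, g j ∈ G := fun j => List.get_mem _ _
    have hGg : ∀ x ∈ G, ∃ j, g j = x := fun x hx => by
      rw [← hgofn] at hx
      exact (List.mem_ofFn' _ _).1 hx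
    have hkZ : p k < Z := hk2.trans (List.mem_range.1 (List.mem_filter.1 (hgG k)).1)
    have hkG : ¬ p k / c.length < d (cycLetter c hc (p k)) := fun h' => by
      obtain ⟨j, hj⟩ := hGg (p k) (List.mem_filter.2 ⟨List.mem_range.2 hkZ, by simpa using h'⟩)
      have hjk : j < k := hgmono.lt_iff_lt.1 (hj.trans_lt hk2)
      rw [← hk1 j hjk] at hj
      exact hjk.ne (hp.injective hj)
    -- At the first disagreement, `p` has taken exactly the letters of the runs before position `p
    -- k`, and then the skipped letter there. This prefix of a reduced word would not be reduced.
    have htake : (List.ofFn p).take (k + 1) =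
        (List.range (p k)).filter (fun y => y / c.length < d (cycLetter c hc y)) ++ [p k] := by
      apply list_eq_of_pairwise_lt
      · exact (List.pairwise_ofFn.2 fun i j hij => hp hij).sublist (List.take_sublist _ _)
      · rw [List.pairwise_append]
        refine ⟨(List.pairwise_lt_range).filter _, List.pairwise_singleton _ _, ?_⟩
        intro x hx y hy
        rw [List.mem_singleton.1 hy]
        exact List.mem_range.1 (List.mem_filter.1 hx).1
      · intro x
        rw [List.mem_take_iff_getElem, List.mem_append, List.mem_filter, List.mem_range,
          List.mem_singleton, decide_eq_true_iff]
        constructor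
        · rintro ⟨j, hj, rfl⟩
          rw [List.length_ofFn] at hj
          have hjN : j < cs.length w₀ := by omega
          rw [List.getElem_ofFn]
          rcases Nat.lt_or_ge j k with hjk | hjk
          · left
            refine ⟨hp hjk, ?_⟩
            rw [hk1 ⟨j, hjN⟩ hjk]
            simpa using (List.mem_filter.1 (hgG ⟨j, hjN⟩)).2
          · right
            congr 1
            ext
            simp only
            omega
        · rintro (⟨hx, hxd⟩ | rfl)
          · obtain ⟨j, rfl⟩ := hGg x (List.mem_filter.2
              ⟨List.mem_range.2 (hx.trans hkZ), by simpa using hxd⟩)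
            have hjk : j < k := hgmono.lt_iff_lt.1 (hx.trans hk2)
            refine ⟨j, ?_, ?_⟩
            · rw [List.length_ofFn]
              have := j.2
              have : (j : ℕ) < k := hjk
              omega
            · rw [List.getElem_ofFn]
              exact hk1 j hjk
          · refine ⟨k, ?_, ?_⟩
            · rw [List.length_ofFn]
              have := k.2
              omega
            · rw [List.getElem_ofFn]
    have hred : cs.IsReduced (powSubword c p) := by
      unfold CoxeterSystem.IsReduced
      rw [hprod, hpow, List.length_map, List.length_ofFn]
    have hred' := hred.take (k + 1)
    rw [hpow, ← List.map_take, htake, List.map_append] at hred'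
    change cs.IsReduced (runWord c hc d (p k) ++ [cycLetter c hc (p k)]) at hred'
    obtain ⟨-, hstep⟩ := D.run_step hn hfull hc hd hadj (z := p k)
      (g := cs.wordProd (runWord c hc d (p k))) fun s => by
        rw [(inv (p k)).2.2 _ List.prefix_rfl, (inv (p k)).1]
    have h1 := D.length_mul_simple_lt (hstep (not_lt.1 hkG))
    have h2 := (inv (p k)).2.1
    unfold CoxeterSystem.IsReduced at hred' h2
    rw [cs.wordProd_append, cs.wordProd_singleton, List.length_append, List.length_singleton]
      at hred'
    omega
  rw [hpg, hgprod]
  exact ⟨(inv Z).2.1, hlast, (inv Z).2.2⟩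

/-- A missing letter would have its weight fixed by the Coxeter element, making its first root zero.
Being reduced, `c` is no longer than a list of all letters, which leaves no room for repetition. -/
theorem coxeter_word (D : RootData cs V) {c : List B} (hred : cs.IsReduced c)
    (hc : IsCoxeterElement cs (cs.wordProd c)) : c.Nodup ∧ ∀ i, i ∈ c := by
  classical
  have : Fintype B := FiniteDimensional.fintypeBasisIndex D.α
  obtain ⟨l, hl, hfull, he⟩ := hc
  have hmem : ∀ i, i ∈ c := fun i => by
    by_contra hi
    have h1 := D.ρ_wordProd_weight_of_notMem (cs := cs) hi
    rw [← he] at h1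
    have h2 := D.isRoot_firstRoot (cs := cs) hl hfull i
    exact h2.ne_zero (by rw [firstRoot, h1, sub_self])
  refine ⟨?_, hmem⟩
  have h1 : c.length ≤ l.length := by
    rw [← hred, ← he]; exact cs.length_wordProd_le l
  have h2 : c.toFinset = Finset.univ := Finset.eq_univ_iff_forall.2 fun i => by simp [hmem i]
  have h3 : l.toFinset = Finset.univ := Finset.eq_univ_iff_forall.2 fun i => by simp [hfull i]
  have h4 := List.toFinset_card_of_nodup hl
  rw [h3, ← h2] at h4
  refine Multiset.coe_nodup.1 (Multiset.toFinset_card_eq_card_iff_nodup.1 ?_)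
  have h5 := c.toFinset_card_le
  exact le_antisymm h5 (h1.trans h4.ge)

end RootData
end BrickPolytope

/-! ### Facets of subword complexes, their roots and flips. -/

namespace BrickPolytope

section Prefix

variable {B : Type*} (Q : List B) (I : Finset (Fin Q.length))

/-- The letters of `Q` at the positions before `k` that are not in `I`. -/
def prefixWord (k : ℕ) : List B := subword Q {z | z.1 < k ∧ z ∉ I}

theorem length_subword (A : Finset (Fin Q.length)) : (subword Q A).length = A.card := by
  unfold subword
  rw [List.length_map, ← List.toFinset_card_of_nodup ((List.nodup_finRange _).filter _)]
  congr 1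
  ext x
  simp

theorem prefixWord_zero : prefixWord Q I 0 = [] := by
  rw [← List.length_eq_zero_iff, prefixWord, length_subword]
  simp

theorem prefixWord_succ (k : Fin Q.length) : prefixWord Q I (k + 1) =
    prefixWord Q I k ++ if k ∈ I then [] else [Q.get k] := by
  unfold prefixWord subword
  split_ifs with hk
  · rw [List.append_nil]
    congr 2
    ext z
    have : z ∉ I → ((z : ℕ) < k + 1 ↔ (z : ℕ) < k) := fun hz => by
      have : (z : ℕ) ≠ k := fun h => hz (by rwa [Fin.ext h])
      omega
    simp only [Finset.mem_filter, Finset.mem_univ, true_and, decide_eq_decide]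
    by_cases hz : z ∈ I
    · simp [hz]
    · simp [hz, this hz]
  · rw [← List.map_singleton (f := Q.get), ← List.map_append]
    congr 1
    apply list_eq_of_pairwise_lt
    · exact (List.pairwise_lt_finRange _).filter _
    · rw [List.pairwise_append]
      refine ⟨(List.pairwise_lt_finRange _).filter _, List.pairwise_singleton _ _, ?_⟩
      intro x hx y hy
      rw [List.mem_singleton.1 hy]
      exact (show (x : ℕ) < k ∧ x ∉ I by simpa using (List.mem_filter.1 hx).2).1
    · intro z
      simp only [List.mem_filter, List.mem_finRange, true_and, List.mem_append, decide_eq_true_iff,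
        Finset.mem_filter, Finset.mem_univ, List.mem_singleton]
      constructor
      · rintro ⟨h1, h2⟩
        rcases Nat.lt_succ_iff_lt_or_eq.1 h1 with h | h
        · exact Or.inl ⟨h, h2⟩
        · exact Or.inr (Fin.ext h)
      · rintro (⟨h1, h2⟩ | rfl)
        · exact ⟨by omega, h2⟩
        · exact ⟨Nat.lt_succ_self _, hk⟩

theorem prefixWord_prefix {k l : ℕ} (hkl : k ≤ l) (hl : l ≤ Q.length) :
    prefixWord Q I k <+: prefixWord Q I l := by
  induction l, hkl using Nat.le_induction with
  | base => exact List.prefix_rfl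
  | succ l hkl ih =>
    refine (ih (by omega)).trans ?_
    have := prefixWord_succ Q I ⟨l, by omega⟩
    simp only at this
    rw [this]
    exact List.prefix_append _ _

theorem prefixWord_length : prefixWord Q I Q.length = subword Q Iᶜ := by
  unfold prefixWord
  congr 1
  ext z
  simp

end Prefix

variable {B W : Type*} [Group W] {M : CoxeterMatrix B} (cs : CoxeterSystem M W)
  (Q : List B) (I : Finset (Fin Q.length))

/-- The product of the letters of `Q` at the positions before `k` that are not in `I`. -/
def pre (k : ℕ) : W := cs.wordProd (prefixWord Q I k)

theorem pre_zero : pre cs Q I 0 = 1 := by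
  rw [pre, prefixWord_zero, cs.wordProd_nil]

variable {Q I}

theorem pre_succ_of_mem {k : Fin Q.length} (hk : k ∈ I) : pre cs Q I (k + 1) = pre cs Q I k := by
  rw [pre, prefixWord_succ, if_pos hk, List.append_nil, pre]

theorem pre_succ_of_notMem {k : Fin Q.length} (hk : k ∉ I) :
    pre cs Q I (k + 1) = pre cs Q I k * cs.simple (Q.get k) := by
  rw [pre, prefixWord_succ, if_neg hk, cs.wordProd_append, cs.wordProd_singleton, pre]

variable (Q) in
theorem pre_empty {k : ℕ} (hk : k ≤ Q.length) : pre cs Q ∅ k = cs.wordProd (Q.take k) := by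
  induction k with
  | zero => rw [pre_zero, List.take_zero, cs.wordProd_nil]
  | succ k ih =>
    have h := pre_succ_of_notMem cs (Q := Q) (I := ∅) (k := ⟨k, hk⟩) (Finset.notMem_empty _)
    simp only at h
    rw [h, ih (by omega), List.take_add_one, List.getElem?_eq_getElem (by omega),
      cs.wordProd_append]
    simp

/-- Omitting one more letter multiplies all later prefix products on the left by the reflection
along the root of that letter. -/
theorem pre_insert {z : Fin Q.length} (hz : z ∉ I) {k : ℕ} (hk : k ≤ Q.length) :
    (k ≤ z → pre cs Q (insert z I) k = pre cs Q I k) ∧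
    (↑z < k → pre cs Q (insert z I) k =
      pre cs Q I z * cs.simple (Q.get z) * (pre cs Q I z)⁻¹ * pre cs Q I k) := by
  induction k with
  | zero => exact ⟨fun _ => by rw [pre_zero, pre_zero], fun h => absurd h (Nat.not_lt_zero _)⟩
  | succ k ih =>
    obtain ⟨ih1, ih2⟩ := ih (by omega)
    set k' : Fin Q.length := ⟨k, hk⟩ with hk'
    change ((k' : ℕ) + 1 ≤ (z : ℕ) → pre cs Q (insert z I) (k' + 1) = pre cs Q I (k' + 1)) ∧
      ((z : ℕ) < (k' : ℕ) + 1 → pre cs Q (insert z I) (k' + 1) =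
        pre cs Q I z * cs.simple (Q.get z) * (pre cs Q I z)⁻¹ * pre cs Q I (k' + 1))
    change ((k' : ℕ) ≤ (z : ℕ) → pre cs Q (insert z I) ↑k' = pre cs Q I ↑k') at ih1
    change ((z : ℕ) < (k' : ℕ) → pre cs Q (insert z I) ↑k' =
        pre cs Q I z * cs.simple (Q.get z) * (pre cs Q I z)⁻¹ * pre cs Q I ↑k') at ih2
    rcases eq_or_ne k' z with hkz | hkz
    · rw [hkz] at ih1 ⊢
      refine ⟨fun h => by omega, fun _ => ?_⟩
      rw [pre_succ_of_mem cs (Finset.mem_insert_self z I), ih1 le_rfl, pre_succ_of_notMem cs hz]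
      simp [mul_assoc]
    · have hne : (k' : ℕ) ≠ z := fun h => hkz (Fin.ext h)
      by_cases hkI : k' ∈ I
      · rw [pre_succ_of_mem cs hkI, pre_succ_of_mem cs (Finset.mem_insert_of_mem hkI)]
        exact ⟨fun h => ih1 (by omega), fun h => ih2 (by omega)⟩
      · have hkI' : k' ∉ insert z I := by simp [hkz, hkI]
        rw [pre_succ_of_notMem cs hkI, pre_succ_of_notMem cs hkI']
        refine ⟨fun h => by rw [ih1 (by omega)], fun h => ?_⟩
        rw [ih2 (by omega), mul_assoc (pre cs Q I ↑z * _ * _)]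

/-- All reduced expressions of `w` have the same length, so the complement of a facet has no spare
letter. -/
theorem isFacet_iff {w : W} :
    IsFacet cs Q w I ↔ pre cs Q I Q.length = w ∧ Iᶜ.card = cs.length w := by
  have key : ∀ A : Finset (Fin Q.length), IsReducedExpr cs w (subword Q A) ↔
      cs.wordProd (subword Q A) = w ∧ A.card = cs.length w := fun A => by
    unfold IsReducedExpr CoxeterSystem.IsReduced
    rw [length_subword]
    constructor
    · rintro ⟨h1, h2⟩; exact ⟨h2, by rw [← h1, h2]⟩
    · rintro ⟨h1, h2⟩; exact ⟨by rw [h1, h2], h1⟩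
  rw [pre, prefixWord_length, ← key]
  constructor
  · rintro ⟨⟨A, hA, hw⟩, hmax⟩
    have hIA : I ⊆ Aᶜ := fun x hx => Finset.mem_compl.2 fun h => Finset.disjoint_left.1 hA h hx
    have h2 := hmax (y := Aᶜ) ⟨A, disjoint_compl_right, hw⟩ hIA
    have h3 : I = Aᶜ := Finset.Subset.antisymm hIA h2
    rwa [h3, compl_compl]
  · intro hw
    refine ⟨⟨Iᶜ, disjoint_compl_left, hw⟩, ?_⟩
    rintro J ⟨A, hA, hw'⟩ hIJ
    have h1 : A ⊆ Iᶜ := fun x hx => Finset.mem_compl.2 fun h =>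
      Finset.disjoint_left.1 hA hx (hIJ h)
    have h2 : A = Iᶜ := Finset.eq_of_subset_of_card_le h1
      (by rw [((key _).1 hw).2, ((key _).1 hw').2])
    intro x hx
    by_contra hxI
    exact Finset.disjoint_left.1 hA (h2 ▸ Finset.mem_compl.2 hxI) hx

theorem mem_subwordComplex_iff {w : W} {A : Finset (Fin Q.length)} :
    A ∈ subwordComplex cs Q w ↔ ∃ I, IsFacet cs Q w I ∧ A ⊆ I := by
  constructor
  · intro hA
    obtain ⟨I, hAI, hI⟩ := Set.Finite.exists_le_maximal
      (Set.toFinite {J | J ∈ subwordComplex cs Q w}) hA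
    exact ⟨I, hI, hAI⟩
  · rintro ⟨I, hI, hAI⟩
    exact (subwordComplex cs Q w).lower hAI hI.prop

theorem IsFacet.isReduced {w : W} (h : IsFacet cs Q w I) {k : ℕ} (hk : k ≤ Q.length) :
    cs.IsReduced (prefixWord Q I k) := by
  obtain ⟨h1, h2⟩ := (isFacet_iff cs).1 h
  have hred : cs.IsReduced (prefixWord Q I Q.length) := by
    unfold CoxeterSystem.IsReduced
    rw [← pre, h1, prefixWord_length, length_subword, h2]
  rw [List.prefix_iff_eq_take.1 (prefixWord_prefix Q I hk le_rfl)]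
  exact hred.take _

namespace RootData

variable {cs} {V : Type*} [NormedAddCommGroup V] [InnerProductSpace ℝ V] [FiniteDimensional ℝ V]
  (D : RootData cs V)

omit [FiniteDimensional ℝ V] in
theorem rootFn_eq (k : Fin Q.length) : D.rootFn Q I k = D.ρ (pre cs Q I k) (D.α (Q.get k)) := rfl

theorem weightFn_eq (k : Fin Q.length) :
    D.weightFn Q I k = D.ρ (pre cs Q I k) (D.weight (Q.get k)) := rfl

omit [FiniteDimensional ℝ V] in
theorem isRoot_rootFn (k : Fin Q.length) : D.IsRoot (D.rootFn Q I k) :=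
  (D.isRoot_α _).map _

/-- The complement of a facet is a reduced word. Pulled back by its prefix products, the root of a
letter changes sign exactly when that letter is read, since the factors of the word on both sides
are reduced. -/
theorem facet_inversion {w : W} (h : IsFacet cs Q w I) {j : Fin Q.length} (hj : j ∉ I) {k : ℕ}
    (hk : k ≤ Q.length) :
    (k ≤ j → D.Nonneg (D.ρ (pre cs Q I k)⁻¹ (D.rootFn Q I j))) ∧
    (↑j < k → D.Nonneg (-D.ρ (pre cs Q I k)⁻¹ (D.rootFn Q I j))) := by
  have hj' : prefixWord Q I (j + 1) = prefixWord Q I j ++ [Q.get j] := by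
    rw [prefixWord_succ, if_neg hj]
  constructor
  · intro hkj
    obtain ⟨m, hm⟩ := prefixWord_prefix Q I hkj j.2.le
    have hred := (h.isReduced cs (k := j + 1) j.2).drop (prefixWord Q I k).length
    rw [hj', ← hm, List.append_assoc, List.drop_left] at hred
    have h1 := hred.take m.length
    rw [List.take_left] at h1
    rw [rootFn_eq, ← ρ_mul, pre, pre, ← hm, cs.wordProd_append, inv_mul_cancel_left,
      nonneg_iff_length]
    unfold CoxeterSystem.IsReduced at hred h1
    rw [cs.wordProd_append, cs.wordProd_singleton, List.length_append, List.length_singleton]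
      at hred
    rw [hred, h1]
  · intro hjk
    obtain ⟨m, hm⟩ := prefixWord_prefix Q I (k := j + 1) (l := k) hjk hk
    have hred := (h.isReduced cs hk).drop (prefixWord Q I j).length
    rw [← hm, hj', List.append_assoc, List.drop_left] at hred
    have h1 := hred.drop 1
    rw [List.singleton_append, List.drop_succ_cons, List.drop_zero] at h1
    rw [rootFn_eq, ← ρ_mul, pre, pre, ← hm, hj', cs.wordProd_append, cs.wordProd_append,
      cs.wordProd_singleton, mul_inv_rev, mul_inv_rev, cs.inv_simple, mul_assoc, mul_assoc,
      inv_mul_cancel, mul_one, ρ_mul, ρ_simple_α, map_neg, neg_neg, nonneg_iff_length]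
    unfold CoxeterSystem.IsReduced at hred h1
    rw [List.singleton_append, cs.wordProd_cons, List.length_cons] at hred
    rw [← cs.length_inv, mul_inv_rev, inv_inv, cs.inv_simple, hred, cs.length_inv, h1]

/-- The longest element makes `γ` negative, so its pullbacks change sign at some letter, where the
pullback is a simple root. -/
theorem exists_rootFn_eq {w₀ : W} (h₀ : IsLongest cs w₀) (h : IsFacet cs Q w₀ I) {γ : V}
    (hγ : D.IsRoot γ) (hpos : D.Nonneg γ) : ∃ j, j ∉ I ∧ D.rootFn Q I j = γ := by
  have key : ∀ k : ℕ, k ≤ Q.length → D.Nonneg (-D.ρ (pre cs Q I k)⁻¹ γ) →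
      ∃ j, j ∉ I ∧ D.rootFn Q I j = γ := by
    intro k
    induction k with
    | zero =>
      intro _ hn
      rw [pre_zero, inv_one, ρ_one] at hn
      exact absurd hn (hpos.not_neg hγ.ne_zero)
    | succ k ih =>
      intro hk hn
      by_cases hk1 : D.Nonneg (-D.ρ (pre cs Q I k)⁻¹ γ)
      · exact ih (by omega) hk1
      have hδ := ((hγ.map (pre cs Q I k)⁻¹).nonneg_or_neg).resolve_right hk1
      set k' : Fin Q.length := ⟨k, hk⟩ with hk'
      change D.Nonneg (-D.ρ (pre cs Q I (↑k' + 1))⁻¹ γ) at hn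
      by_cases hkI : k' ∈ I
      · rw [pre_succ_of_mem cs hkI] at hn
        exact absurd hn hk1
      · refine ⟨k', hkI, ?_⟩
        rw [pre_succ_of_notMem cs hkI, mul_inv_rev, cs.inv_simple, ρ_mul] at hn
        by_contra hne
        refine Nonneg.not_neg ((hγ.map (pre cs Q I k)⁻¹).ρ_simple_nonneg hδ fun he => hne ?_)
          ((hγ.map _).map _).ne_zero hn
        rw [rootFn_eq, ← he, ρ_ρ_inv]
  refine key _ le_rfl ?_
  rw [((isFacet_iff cs).1 h).1]
  exact D.longest_nonneg h₀.inv hpos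

/-- Up to sign, the root at `i` also occurs at a position `j` outside `I`; exchanging the two keeps
the product. Only weights between the two positions change, by the reflection along this root, and
all in the same direction. -/
theorem exists_facet_flip {w₀ : W} (h₀ : IsLongest cs w₀) (h : IsFacet cs Q w₀ I)
    {i : Fin Q.length} (hi : i ∈ I) :
    ∃ J, IsFacet cs Q w₀ J ∧ i ∉ J ∧ (∀ k ∈ I, k ≠ i → k ∈ J) ∧ ∃ t : ℝ, 0 < t ∧
      D.brickVector Q I - D.brickVector Q J = t • D.rootFn Q I i := by
  classical
  set β := D.rootFn Q I i with hβ
  have hβr : D.IsRoot β := D.isRoot_rootFn i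
  obtain ⟨j, hj, hjβ⟩ : ∃ j, j ∉ I ∧ (D.rootFn Q I j = β ∨ D.rootFn Q I j = -β) := by
    rcases hβr.nonneg_or_neg with hp | hp
    · obtain ⟨j, hj, hjβ⟩ := D.exists_rootFn_eq h₀ h hβr hp
      exact ⟨j, hj, Or.inl hjβ⟩
    · obtain ⟨j, hj, hjβ⟩ := D.exists_rootFn_eq h₀ h hβr.neg hp
      exact ⟨j, hj, Or.inr hjβ⟩
  set K := I.erase i with hK
  have hiK : i ∉ K := Finset.notMem_erase i I
  have hjK : j ∉ K := fun h' => hj (Finset.mem_of_mem_erase h')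
  have hij : i ≠ j := fun h' => hj (h' ▸ hi)
  have hijn : (i : ℕ) ≠ j := fun h' => hij (Fin.ext h')
  have hIK : insert i K = I := Finset.insert_erase hi
  have preI := fun {k : ℕ} (hk : k ≤ Q.length) => pre_insert cs hiK hk
  rw [hIK] at preI
  have preJ := fun {k : ℕ} (hk : k ≤ Q.length) => pre_insert cs hjK hk
  set J := insert j K with hJ
  set tI := pre cs Q K i * cs.simple (Q.get i) * (pre cs Q K i)⁻¹ with htI
  set tJ := pre cs Q K j * cs.simple (Q.get j) * (pre cs Q K j)⁻¹ with htJ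
  have hβK : D.ρ (pre cs Q K i) (D.α (Q.get i)) = β := by
    rw [hβ, rootFn_eq, (preI i.2.le).1 le_rfl]
  have hconj : pre cs Q I j * cs.simple (Q.get j) * (pre cs Q I j)⁻¹ = tI := by
    rcases hjβ with h' | h'
    · exact D.conj_eq_of_root_eq (by rw [hβK]; exact h')
    · exact D.conj_eq_of_root_eq_neg (by rw [hβK]; exact h')
  -- If `i` comes before `j`, the omission of `i` conjugates the reflection at `j` by `tI`, which
  -- does not alter the equality of reflections.
  have htt : tJ = tI := by
    rcases Nat.lt_or_ge i j with hlt | hge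
    · rw [(preI j.2.le).2 hlt] at hconj
      have h1 : tI * tJ * tI⁻¹ = tI := by
        rw [htJ]
        simpa only [mul_assoc, mul_inv_rev] using hconj
      exact mul_left_cancel (mul_inv_eq_iff_eq_mul.1 h1)
    · rwa [(preI j.2.le).1 hge] at hconj
  have htsq : tI * tI = 1 := by
    rw [htI]
    simp [mul_assoc]
  have hρt : ∀ v, D.ρ tI v = v - (2 * ⟪β, v⟫ / ⟪β, β⟫) • β := D.ρ_conj hβK
  have hfacet : IsFacet cs Q w₀ J := by
    obtain ⟨h1, h2⟩ := (isFacet_iff cs).1 h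
    refine (isFacet_iff cs).2 ⟨?_, ?_⟩
    · rw [(preJ le_rfl).2 j.2, htt, ← h1, (preI le_rfl).2 i.2]
    · rw [← h2, Finset.card_compl, Finset.card_compl, hJ, Finset.card_insert_of_notMem hjK, ← hIK,
        Finset.card_insert_of_notMem hiK]
  refine ⟨J, hfacet, by simp [hJ, hij, hiK], fun k hk hki => Finset.mem_insert_of_mem
    (Finset.mem_erase.2 ⟨hki, hk⟩), ?_⟩
  -- the letters strictly between the two exchanged positions
  have hsame : ∀ k : Fin Q.length, (↑k ≤ (i : ℕ) ∧ ↑k ≤ (j : ℕ)) ∨ ((i : ℕ) < k ∧ (j : ℕ) < k) →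
      D.weightFn Q J k = D.weightFn Q I k := by
    rintro k (⟨h1, h2⟩ | ⟨h1, h2⟩)
    · rw [weightFn_eq, weightFn_eq, (preI k.2.le).1 h1, (preJ k.2.le).1 h2]
    · rw [weightFn_eq, weightFn_eq, (preI k.2.le).2 h1, (preJ k.2.le).2 h2, htt]
  have hdiff : ∀ k : Fin Q.length, ((i : ℕ) < k ∧ ↑k ≤ (j : ℕ)) ∨ ((j : ℕ) < k ∧ ↑k ≤ (i : ℕ)) →
      D.weightFn Q J k = D.ρ tI (D.weightFn Q I k) := by
    rintro k (⟨h1, h2⟩ | ⟨h1, h2⟩)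
    · rw [weightFn_eq, weightFn_eq, (preI k.2.le).2 h1, (preJ k.2.le).1 h2, ← ρ_mul, ← mul_assoc,
        htsq, one_mul]
    · rw [weightFn_eq, weightFn_eq, (preI k.2.le).1 h2, (preJ k.2.le).2 h1, ← ρ_mul, htt]
  have hβi : D.ρ (pre cs Q I i)⁻¹ β = D.α (Q.get i) := by rw [hβ, rootFn_eq, ρ_inv_ρ]
  have hneg : ¬ D.Nonneg (-D.ρ (pre cs Q I i)⁻¹ β) := by
    rw [hβi]; exact (D.nonneg_α _).not_neg (D.isRoot_α _).ne_zero
  -- At position `i` the pullback of `β` is a simple root, which decides the sign in `hjβ`: the root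
  -- at `j` is `β` if `j` comes later and `-β` if it comes earlier. In both cases the pullback of
  -- `β` is positive throughout the interval.
  have hpos : ∀ k : Fin Q.length, ((i : ℕ) < k ∧ ↑k ≤ (j : ℕ)) ∨ ((j : ℕ) < k ∧ ↑k ≤ (i : ℕ)) →
      0 ≤ ⟪β, D.weightFn Q I k⟫ := by
    rintro k hk
    rw [weightFn_eq, inner_ρ_right, real_inner_comm]
    refine D.inner_weight_nonneg _ ?_
    rcases hk with ⟨h1, h2⟩ | ⟨h1, h2⟩
    · have h3 := (D.facet_inversion h hj k.2.le).1 h2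
      rcases hjβ with h' | h'
      · rwa [h'] at h3
      · have h4 := (D.facet_inversion h hj i.2.le).1 (by omega)
        rw [h', map_neg] at h4
        exact absurd h4 hneg
    · have h3 := (D.facet_inversion h hj k.2.le).2 h1
      rcases hjβ with h' | h'
      · have h4 := (D.facet_inversion h hj i.2.le).2 (by omega)
        rw [h'] at h4
        exact absurd h4 hneg
      · rwa [h', map_neg, neg_neg] at h3
  have hααpos : ∀ s, 0 < ⟪D.α s, D.weight s⟫ := fun s => by
    rw [inner_weight, if_pos rfl]; exact half_pos (D.inner_α_self_pos s)
  obtain ⟨k₀, hk₀, hk₀pos⟩ : ∃ k : Fin Q.length,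
      (((i : ℕ) < k ∧ ↑k ≤ (j : ℕ)) ∨ ((j : ℕ) < k ∧ ↑k ≤ (i : ℕ))) ∧
      0 < ⟪β, D.weightFn Q I k⟫ := by
    rcases Nat.lt_or_ge i j with hlt | hge
    · refine ⟨j, Or.inl ⟨hlt, le_rfl⟩, ?_⟩
      rcases hjβ with h' | h'
      · rw [← h', weightFn_eq, rootFn_eq, inner_ρ]
        exact hααpos _
      · have h4 := (D.facet_inversion h hj i.2.le).1 (by omega)
        rw [h', map_neg] at h4
        exact absurd h4 hneg
    · refine ⟨i, Or.inr ⟨by omega, le_rfl⟩, ?_⟩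
      rw [weightFn_eq, hβ, rootFn_eq, inner_ρ]
      exact hααpos _
  set f : Fin Q.length → ℝ := fun k =>
    if ((i : ℕ) < k ∧ ↑k ≤ (j : ℕ)) ∨ ((j : ℕ) < k ∧ ↑k ≤ (i : ℕ)) then
      2 * ⟪β, D.weightFn Q I k⟫ / ⟪β, β⟫ else 0 with hf
  refine ⟨∑ k, f k, Finset.sum_pos' (fun k _ => ?_) ⟨k₀, Finset.mem_univ _, ?_⟩, ?_⟩
  · simp only [hf]
    split_ifs with hk
    · exact div_nonneg (mul_nonneg zero_le_two (hpos k hk)) hβr.inner_self_pos.le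
    · exact le_rfl
  · simp only [hf, if_pos hk₀]
    exact div_pos (by linarith) hβr.inner_self_pos
  · rw [brickVector, brickVector, ← Finset.sum_sub_distrib, Finset.sum_smul]
    refine Finset.sum_congr rfl fun k _ => ?_
    simp only [hf]
    split_ifs with hk
    · rw [hdiff k hk, hρt, sub_sub_cancel]
    · rw [hsame k (by omega), sub_self, zero_smul]

end RootData
end BrickPolytope

/-! ### The fan of weights of a Cambrian word. -/

namespace BrickPolytope

variable {B W : Type*} [Group W] {M : CoxeterMatrix B} {cs : CoxeterSystem M W}

/-- The quotient of the products of all letters of `Q` before `k` and of those not in `I`. -/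
def turn (cs : CoxeterSystem M W) (Q : List B) (I : Finset (Fin Q.length)) (k : ℕ) : W :=
  pre cs Q ∅ k * (pre cs Q I k)⁻¹

theorem turn_zero (Q : List B) (I : Finset (Fin Q.length)) : turn cs Q I 0 = 1 := by
  rw [turn, pre_zero, pre_zero, inv_one, mul_one]

theorem turn_succ_of_notMem {Q : List B} {I : Finset (Fin Q.length)} {k : Fin Q.length}
    (hk : k ∉ I) : turn cs Q I (k + 1) = turn cs Q I k := by
  rw [turn, turn, pre_succ_of_notMem cs hk, pre_succ_of_notMem cs (Finset.notMem_empty k),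
    mul_inv_rev, mul_assoc, mul_inv_cancel_left]

namespace RootData

variable {V : Type*} [NormedAddCommGroup V] [InnerProductSpace ℝ V] [FiniteDimensional ℝ V]
  {D : RootData cs V} {Q : List B} {I : Finset (Fin Q.length)}

omit [FiniteDimensional ℝ V] in
theorem ρ_turn_succ_of_mem {k : Fin Q.length} (hk : k ∈ I) (v : V) :
    D.ρ (turn cs Q I (k + 1)) v = D.ρ (turn cs Q I k) v -
      (2 * ⟪D.rootFn Q ∅ k, D.ρ (turn cs Q I k) v⟫ / ⟪D.rootFn Q ∅ k, D.rootFn Q ∅ k⟫) •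
        D.rootFn Q ∅ k := by
  rw [← D.ρ_conj (D.rootFn_eq (I := ∅) k).symm, ← ρ_mul, turn, turn, pre_succ_of_mem cs hk,
    pre_succ_of_notMem cs (Finset.notMem_empty k)]
  simp only [mul_assoc, inv_mul_cancel_left]

theorem inner_rootFn_weightFn (k : Fin Q.length) :
    2 * ⟪D.rootFn Q I k, D.weightFn Q I k⟫ = ⟪D.rootFn Q I k, D.rootFn Q I k⟫ := by
  classical
  rw [rootFn_eq, weightFn_eq, inner_ρ, inner_ρ, inner_weight, if_pos rfl]
  ring

omit [FiniteDimensional ℝ V] in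
theorem inner_rootFn_self_pos (k : Fin Q.length) : 0 < ⟪D.rootFn Q I k, D.rootFn Q I k⟫ :=
  (D.isRoot_rootFn k).inner_self_pos

omit [FiniteDimensional ℝ V] in
theorem rootFn_eq_turn (k : Fin Q.length) :
    D.rootFn Q I k = D.ρ (turn cs Q I k)⁻¹ (D.rootFn Q ∅ k) := by
  rw [rootFn_eq, rootFn_eq, ← ρ_mul, turn, mul_inv_rev, inv_inv, inv_mul_cancel_right]

variable (D) in
/-- The properties of the word `c w∘(c)` on which the description of its facets rests. -/
structure IsCambrian (Q : List B) (C w₀ : W) : Prop where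
  longest : IsLongest cs w₀
  length_eq : Q.length = Module.finrank ℝ V + cs.length w₀
  wordProd_eq : cs.wordProd Q = C * w₀
  eq_zero : ∀ v, D.ρ C v = v → v = 0
  step : ∀ k, D.ρ C (D.weightFn Q ∅ k) = D.weightFn Q ∅ k - D.rootFn Q ∅ k
  sign : ∀ x y, x < y → ⟪D.weightFn Q ∅ y, D.rootFn Q ∅ x⟫ ≤ 0
  facet : ∃ I, IsFacet cs Q w₀ I

variable (D) in
/-- Sets of positions whose weights are orthogonal to the earlier roots. -/
def IsOrtho (Q : List B) (A : Finset (Fin Q.length)) : Prop :=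
  ∀ x ∈ A, ∀ y ∈ A, x < y → ⟪D.weightFn Q ∅ y, D.rootFn Q ∅ x⟫ = 0

namespace IsCambrian

variable {C w₀ : W}

theorem card_eq (h : D.IsCambrian Q C w₀) (hI : IsFacet cs Q w₀ I) :
    I.card = Module.finrank ℝ V := by
  have h1 := ((isFacet_iff cs).1 hI).2
  have h2 := I.card_add_card_compl
  have h3 := h.length_eq
  rw [Fintype.card_fin] at h2
  omega

theorem turn_length_eq_iff (h : D.IsCambrian Q C w₀) :
    turn cs Q I Q.length = C ↔ pre cs Q I Q.length = w₀ := by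
  rw [turn, pre_empty cs Q le_rfl, List.take_length, h.wordProd_eq, mul_assoc,
    mul_eq_left, mul_inv_eq_one, eq_comm]

/-- At the first position `z` where the coefficients differ, pair the difference with the root of
`z`. The term of `z` is positive, and each later term is nonnegative: it vanishes on the support set
of the larger expansion by orthogonality, and elsewhere only the other coefficient remains, with a
nonpositive pairing. -/
theorem eq_of_sum_eq (h : D.IsCambrian Q C w₀) {A A' : Finset (Fin Q.length)}
    (hA : D.IsOrtho Q A) (hA' : D.IsOrtho Q A') {f g : Fin Q.length → ℝ} (hf : ∀ k, 0 ≤ f k)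
    (hg : ∀ k, 0 ≤ g k) (hfA : ∀ k, k ∉ A → f k = 0) (hgA : ∀ k, k ∉ A' → g k = 0)
    (hfg : ∑ k, f k • D.weightFn Q ∅ k = ∑ k, g k • D.weightFn Q ∅ k) : f = g := by
  by_contra hne
  obtain ⟨z, hz, hmin⟩ : ∃ z, f z ≠ g z ∧ ∀ k < z, f k = g k := by
    obtain ⟨z₀, hz₀⟩ := Function.ne_iff.1 hne
    obtain ⟨z, hz, hmin⟩ := WellFounded.has_min (wellFounded_lt (α := Fin Q.length))
      {z | f z ≠ g z} ⟨z₀, hz₀⟩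
    exact ⟨z, hz, fun k hk => by_contra fun hn => hmin k hn hk⟩
  have key : ∀ {A : Finset (Fin Q.length)} {f g : Fin Q.length → ℝ}, D.IsOrtho Q A →
      (∀ k, 0 ≤ g k) → (∀ k, k ∉ A → f k = 0) →
      ∑ k, f k • D.weightFn Q ∅ k = ∑ k, g k • D.weightFn Q ∅ k → (∀ k < z, f k = g k) →
      ¬ g z < f z := by
    intro A f g hA hg hfA hfg hmin hlt
    have hzA : z ∈ A := by
      by_contra hzA
      rw [hfA z hzA] at hlt
      exact absurd hlt (not_lt.2 (hg z))
    have hsum : ∑ k, (f k - g k) * ⟪D.weightFn Q ∅ k, D.rootFn Q ∅ z⟫ = 0 := by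
      have h1 : ∑ k, (f k - g k) • D.weightFn Q ∅ k = 0 := by
        simp only [sub_smul, Finset.sum_sub_distrib, hfg, sub_self]
      rw [← inner_zero_left (𝕜 := ℝ) (D.rootFn Q ∅ z), ← h1, sum_inner]
      simp only [real_inner_smul_left]
    refine absurd hsum (Finset.sum_pos' (fun k _ => ?_) ⟨z, Finset.mem_univ _, ?_⟩).ne'
    · rcases lt_trichotomy k z with hk | rfl | hk
      · rw [hmin k hk, sub_self, zero_mul]
      · refine mul_nonneg (sub_pos.2 hlt).le ?_
        have := inner_rootFn_weightFn (D := D) (I := ∅) k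
        rw [real_inner_comm]
        linarith [inner_rootFn_self_pos (D := D) (I := ∅) k]
      · have h1 := h.sign z k hk
        by_cases hkA : k ∈ A
        · rw [hA z hzA k hkA hk, mul_zero]
        · rw [hfA k hkA, zero_sub]
          nlinarith [hg k]
    · refine mul_pos (sub_pos.2 hlt) ?_
      have := inner_rootFn_weightFn (D := D) (I := ∅) z
      rw [real_inner_comm]
      linarith [inner_rootFn_self_pos (D := D) (I := ∅) z]
  rcases lt_or_gt_of_ne hz with hlt | hlt
  · exact key hA' hf hgA hfg.symm (fun k hk => (hmin k hk).symm) hlt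
  · exact key hA hg hfA hfg hmin hlt

-- A telescoping sum: reading a letter of `I` multiplies the turn on the left by the reflection
-- along its full root, while other letters leave the turn unchanged.
omit [FiniteDimensional ℝ V] in
theorem sub_ρ_turn (v : V) {k : ℕ} (hk : k ≤ Q.length) :
    v - D.ρ (turn cs Q I k) v = ∑ x ∈ I, (if (x : ℕ) < k then
      2 * ⟪D.rootFn Q ∅ x, D.ρ (turn cs Q I x) v⟫ / ⟪D.rootFn Q ∅ x, D.rootFn Q ∅ x⟫ else 0) •
        D.rootFn Q ∅ x := by
  induction k with
  | zero => simp [turn_zero]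
  | succ k ih =>
    specialize ih (by omega)
    set k' : Fin Q.length := ⟨k, hk⟩ with hk'
    change v - D.ρ (turn cs Q I k') v = _ at ih
    change v - D.ρ (turn cs Q I (k' + 1)) v = _
    have hlt : ∀ x : Fin Q.length, x ≠ k' → ((x : ℕ) < k + 1 ↔ (x : ℕ) < k) := fun x hx => by
      have : (x : ℕ) ≠ k := fun he => hx (Fin.ext he)
      omega
    by_cases hkI : k' ∈ I
    · rw [ρ_turn_succ_of_mem hkI, ← sub_add, ih, ← Finset.add_sum_erase I _ hkI,
        ← Finset.add_sum_erase I _ hkI, if_neg (show ¬ (k' : ℕ) < k from lt_irrefl k),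
        if_pos (show (k' : ℕ) < k + 1 from Nat.lt_succ_self k), zero_smul, zero_add, add_comm]
      congr 1
      refine Finset.sum_congr rfl fun x hx => ?_
      rw [if_congr (hlt x (Finset.ne_of_mem_erase hx)) rfl rfl]
    · rw [turn_succ_of_notMem hkI, ih]
      refine Finset.sum_congr rfl fun x hx => ?_
      rw [if_congr (hlt x fun he => hkI (he ▸ hx)) rfl rfl]

/-- The total turn of a facet is `C`, so the image of `1 - C`, which is all of `V`, lies in the span
of these roots. Their number is the dimension. -/
theorem linearIndependent_rootFn (h : D.IsCambrian Q C w₀) (hI : IsFacet cs Q w₀ I) :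
    LinearIndependent ℝ (fun x : I => D.rootFn Q ∅ x) := by
  refine linearIndependent_of_top_le_span_of_card_eq_finrank ?_
    (by rw [Fintype.card_coe, h.card_eq hI])
  rintro v -
  set L : V →ₗ[ℝ] V := LinearMap.id - (D.ρ C).toLinearEquiv.toLinearMap with hL
  have hLapp : ∀ v, L v = v - D.ρ C v := fun v => rfl
  have hinj : Function.Injective L := (injective_iff_map_eq_zero _).2 fun v hv =>
    h.eq_zero v (sub_eq_zero.1 hv).symm
  obtain ⟨v, rfl⟩ := LinearMap.injective_iff_surjective.1 hinj v
  rw [hLapp, ← h.turn_length_eq_iff.2 ((isFacet_iff cs).1 hI).1, sub_ρ_turn v le_rfl]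
  exact Submodule.sum_mem _ fun x hx => Submodule.smul_mem _ _ (Submodule.subset_span ⟨⟨x, hx⟩, rfl⟩)

/-- By `step`, `1 - C` sends the weight at `y` to the root at `y`. Compare coefficients with the
telescoped expansion in the basis of roots. -/
theorem inner_ρ_turn (h : D.IsCambrian Q C w₀) (hI : IsFacet cs Q w₀ I) {x y : Fin Q.length}
    (hx : x ∈ I) (hy : y ∈ I) : 2 * ⟪D.rootFn Q ∅ x, D.ρ (turn cs Q I x) (D.weightFn Q ∅ y)⟫ =
      if x = y then ⟪D.rootFn Q ∅ x, D.rootFn Q ∅ x⟫ else 0 := by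
  classical
  have h1 := sub_ρ_turn (D := D) (I := I) (D.weightFn Q ∅ y) le_rfl
  rw [h.turn_length_eq_iff.2 ((isFacet_iff cs).1 hI).1, h.step, sub_sub_cancel, ← sub_eq_zero]
    at h1
  set f : Fin Q.length → ℝ := fun x => 2 * ⟪D.rootFn Q ∅ x,
    D.ρ (turn cs Q I x) (D.weightFn Q ∅ y)⟫ / ⟪D.rootFn Q ∅ x, D.rootFn Q ∅ x⟫ with hf
  have h2 := Fintype.linearIndependent_iff.1 (h.linearIndependent_rootFn hI)
    (fun x => (if (x : Fin Q.length) = y then 1 else 0) - f x) (by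
      rw [Finset.sum_coe_sort I (fun x => ((if x = y then 1 else 0) - f x) • D.rootFn Q ∅ x)]
      simp only [sub_smul, Finset.sum_sub_distrib]
      rw [← h1]
      congr 1
      · simp [ite_smul, hy]
      · exact Finset.sum_congr rfl fun x _ => by rw [if_pos x.2]) ⟨x, hx⟩
  have h3 : f x = if x = y then 1 else 0 := (sub_eq_zero.1 h2).symm
  have h4 := (inner_rootFn_self_pos (D := D) (I := ∅) x).ne'
  rw [hf] at h3
  simp only at h3
  rw [div_eq_iff h4] at h3
  rw [h3]
  split_ifs <;> simp

theorem inner_weightFn_rootFn (h : D.IsCambrian Q C w₀) (hI : IsFacet cs Q w₀ I)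
    {x y : Fin Q.length} (hx : x ∈ I) (hy : y ∈ I) : 2 * ⟪D.weightFn Q ∅ y, D.rootFn Q I x⟫ =
      if x = y then ⟪D.rootFn Q ∅ x, D.rootFn Q ∅ x⟫ else 0 := by
  rw [rootFn_eq_turn, inner_ρ_right, inv_inv, real_inner_comm, h.inner_ρ_turn hI hx hy]

/-- The weight at `y` is fixed by the turn at every `x ≤ y`, since all earlier coefficients of its
expansion vanish. `inner_ρ_turn` then loses its turn. -/
theorem isOrtho (h : D.IsCambrian Q C w₀) (hI : IsFacet cs Q w₀ I) : D.IsOrtho Q I := by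
  intro x hx y hy hxy
  have h1 := sub_ρ_turn (D := D) (I := I) (D.weightFn Q ∅ y) x.2.le
  rw [Finset.sum_eq_zero, sub_eq_zero] at h1
  · have h2 := h.inner_ρ_turn hI hx hy
    rw [← h1, if_neg hxy.ne, real_inner_comm] at h2
    linarith
  · intro z hz
    split_ifs with hzx
    · rw [h.inner_ρ_turn hI hz hy, if_neg (fun he => ?_), zero_div, zero_smul]
      have : (z : ℕ) < y := lt_trans hzx hxy
      rw [he] at this
      omega
    · rw [zero_smul]

open Classical in
theorem fanPolytope (h : D.IsCambrian Q C w₀) :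
    FanPolytope (Finset.univ.filter fun I => IsFacet cs Q w₀ I) (D.brickVector Q)
      (D.weightFn Q ∅) (D.rootFn Q) where
  nonempty := by
    obtain ⟨I, hI⟩ := h.facet
    exact ⟨I, by simpa using hI⟩
  card_eq I hI := h.card_eq (by simpa using hI)
  inner_eq_zero I hI x hx y hy hxy := by
    have := h.inner_weightFn_rootFn (by simpa using hI) hx hy
    rw [if_neg hxy] at this
    linarith
  inner_pos I hI x hx := by
    have := h.inner_weightFn_rootFn (by simpa using hI) hx hx
    rw [if_pos rfl] at this
    linarith [inner_rootFn_self_pos (D := D) (I := ∅) x]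
  exists_flip I hI i hi := by
    obtain ⟨J, hJ, h1⟩ := D.exists_facet_flip h.longest (by simpa using hI) hi
    exact ⟨J, by simpa using hJ, h1⟩
  unique I hI J hJ f g hf hg hfg i hi hpos := by
    have key : ∀ (A : Finset (Fin Q.length)) (f : Fin Q.length → ℝ),
        ∑ k, (if k ∈ A then f k else 0) • D.weightFn Q ∅ k = ∑ k ∈ A, f k • D.weightFn Q ∅ k :=
      fun A f => by simp [ite_smul]
    have h1 := h.eq_of_sum_eq (f := fun k => if k ∈ I then f k else 0)
      (g := fun k => if k ∈ J then g k else 0) (h.isOrtho (by simpa using hI))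
      (h.isOrtho (by simpa using hJ)) (fun k => by split_ifs; exacts [hf k, le_rfl])
      (fun k => by split_ifs; exacts [hg k, le_rfl]) (fun k hk => if_neg hk)
      (fun k hk => if_neg hk) (by rw [key, key, hfg])
    have h2 := congrFun h1 i
    simp only [if_pos hi] at h2
    by_contra hiJ
    rw [if_neg hiJ] at h2
    exact hpos.ne' h2

/-- The sum of the weights of an orthogonal set lies in the cone of some facet; uniqueness of
expansions puts the whole set in that facet. The complex is thus determined by its pairs. -/
theorem mem_subwordComplex_iff_isOrtho (h : D.IsCambrian Q C w₀) {A : Finset (Fin Q.length)} :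
    A ∈ subwordComplex cs Q w₀ ↔ D.IsOrtho Q A := by
  classical
  rw [mem_subwordComplex_iff]
  constructor
  · rintro ⟨I, hI, hAI⟩ x hx y hy hxy
    exact h.isOrtho hI x (hAI hx) y (hAI hy) hxy
  · intro hA
    obtain ⟨I, hI, f, hf, hsum⟩ := h.fanPolytope.exists_expansion (∑ x ∈ A, D.weightFn Q ∅ x)
    have hI' : IsFacet cs Q w₀ I := by simpa using hI
    refine ⟨I, hI', fun x hx => ?_⟩
    have h1 := h.eq_of_sum_eq (f := fun k => if k ∈ A then 1 else 0)
      (g := fun k => if k ∈ I then f k else 0) hA (h.isOrtho hI')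
      (fun k => by split_ifs <;> norm_num) (fun k => by split_ifs; exacts [hf k, le_rfl])
      (fun k hk => if_neg hk) (fun k hk => if_neg hk) (by simpa [ite_smul] using hsum)
    have h2 := congrFun h1 x
    simp only [if_pos hx] at h2
    by_contra hxI
    rw [if_neg hxI] at h2
    exact one_ne_zero h2

theorem brickPolytope_eq (D : RootData cs V) (Q : List B) (w₀ : W) [DecidablePred (IsFacet cs Q w₀)] :
    D.brickPolytope Q w₀ = convexHull ℝ (D.brickVector Q ''
      ((Finset.univ.filter fun I => IsFacet cs Q w₀ I : Finset _) : Set (Finset (Fin Q.length)))) := by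
  unfold brickPolytope
  congr 1
  ext v
  simp [eq_comm]

theorem interior_nonempty (h : D.IsCambrian Q C w₀) :
    (interior (D.brickPolytope Q w₀)).Nonempty := by
  classical
  rw [brickPolytope_eq]
  exact h.fanPolytope.interior_nonempty

theorem realizes (h : D.IsCambrian Q C w₀) {p : V} (hp : p ∈ interior (D.brickPolytope Q w₀)) :
    Realizes (polarAt p (D.brickPolytope Q w₀)) (subwordComplex cs Q w₀) := by
  classical
  rw [brickPolytope_eq] at hp ⊢
  exact h.fanPolytope.realizes hp fun A => by simp [mem_subwordComplex_iff]

theorem isRealizing (h : D.IsCambrian Q C w₀) (hQ : demazure cs Q = w₀) : D.IsRealizing Q w₀ := by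
  classical
  exact ⟨hQ, fun I hI => ⟨h.fanPolytope.linearIndependent_edge (by simpa using hI),
    h.fanPolytope.span_edge (by simpa using hI)⟩⟩

end IsCambrian
end RootData
end BrickPolytope

/-! ### The word c w∘(c) is Cambrian. -/

namespace BrickPolytope

/-- The positions of the letters of `c` in the word `c ++ u`. -/
def initialPositions {B : Type*} (c u : List B) : Finset (Fin (c ++ u).length) :=
  {x | x.1 < c.length}

theorem mem_initialPositions {B : Type*} {c u : List B} {x : Fin (c ++ u).length} :
    x ∈ initialPositions c u ↔ x.1 < c.length := by
  simp [initialPositions]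

theorem get_notMem_take {B : Type*} {c : List B} (hn : c.Nodup) {x y : ℕ} (hx : x < c.length)
    (hyx : y ≤ x) : c.get ⟨x, hx⟩ ∉ c.take y := fun h => by
  rw [List.mem_take_iff_getElem] at h
  obtain ⟨i, hi, he⟩ := h
  have := Fin.mk.inj_iff.1 (List.nodup_iff_injective_get.1 hn
    (a₁ := ⟨i, by omega⟩) (a₂ := ⟨x, hx⟩) he)
  omega

variable {B W : Type*} [Group W] {M : CoxeterMatrix B} {cs : CoxeterSystem M W}

theorem pre_initialPositions_of_le {c u : List B} {k : ℕ} (hk : k ≤ c.length) :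
    pre cs (c ++ u) (initialPositions c u) k = 1 := by
  induction k with
  | zero => exact pre_zero cs _ _
  | succ k ih =>
    have hk' : k < (c ++ u).length := by rw [List.length_append]; omega
    rw [← ih (by omega)]
    exact pre_succ_of_mem cs (k := ⟨k, hk'⟩) (mem_initialPositions.2 hk)

theorem pre_empty_eq_mul {c u : List B} {k : ℕ} (hk : c.length ≤ k) (hk' : k ≤ (c ++ u).length) :
    pre cs (c ++ u) ∅ k = cs.wordProd c * pre cs (c ++ u) (initialPositions c u) k := by
  induction k, hk using Nat.le_induction with
  | base =>
    rw [pre_initialPositions_of_le le_rfl, pre_empty cs _ hk', List.take_left, mul_one]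
  | succ k hk ih =>
    have h1 := pre_succ_of_notMem cs (I := ∅) (k := ⟨k, hk'⟩) (Finset.notMem_empty _)
    have h2 := pre_succ_of_notMem cs (I := initialPositions c u) (k := ⟨k, hk'⟩)
      (by rw [mem_initialPositions]; exact not_lt.2 hk)
    simp only at h1 h2
    rw [h1, h2, ih (by omega), mul_assoc]

theorem isFacet_initialPositions {c u : List B} {w : W} (hu : cs.IsReduced u)
    (hw : cs.wordProd u = w) : IsFacet cs (c ++ u) w (initialPositions c u) := by
  rw [isFacet_iff]
  constructor
  · have h1 := pre_empty_eq_mul (cs := cs) (c := c) (u := u) (by simp) le_rfl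
    rw [pre_empty cs _ le_rfl, List.take_length, cs.wordProd_append, hw] at h1
    exact (mul_left_cancel h1).symm
  · have h1 : (initialPositions c u).card = c.length := by
      unfold initialPositions
      rw [Fin.card_filter_val_lt]
      simp
    have h2 := (initialPositions c u).card_add_card_compl
    have h3 : (c ++ u).length = c.length + u.length := List.length_append
    rw [Fintype.card_fin] at h2
    rw [← hw, hu]
    omega

namespace RootData

variable {V : Type*} [NormedAddCommGroup V] [InnerProductSpace ℝ V] [FiniteDimensional ℝ V]
  (D : RootData cs V)

theorem weightFn_initial {c u : List B} (hn : c.Nodup) {x : Fin (c ++ u).length}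
    (hx : x.1 < c.length) : D.weightFn (c ++ u) ∅ x = D.weight (c.get ⟨x, hx⟩) := by
  have hget : (c ++ u).get x = c.get ⟨x, hx⟩ := by
    rw [List.get_eq_getElem, List.get_eq_getElem, List.getElem_append_left hx]
  rw [weightFn_eq, pre_empty cs _ x.2.le, hget, List.take_append_of_le_length hx.le,
    D.ρ_wordProd_weight_of_notMem (get_notMem_take hn hx le_rfl)]

omit [FiniteDimensional ℝ V] in
theorem rootFn_eq_map {c u : List B} {x : Fin (c ++ u).length} (hx : c.length ≤ x.1) :
    D.rootFn (c ++ u) ∅ x =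
      D.ρ (cs.wordProd c) (D.rootFn (c ++ u) (initialPositions c u) x) := by
  rw [rootFn_eq, rootFn_eq, pre_empty_eq_mul hx x.2.le, ρ_mul]

theorem weightFn_eq_map {c u : List B} {x : Fin (c ++ u).length} (hx : c.length ≤ x.1) :
    D.weightFn (c ++ u) ∅ x =
      D.ρ (cs.wordProd c) (D.weightFn (c ++ u) (initialPositions c u) x) := by
  rw [weightFn_eq, weightFn_eq, pre_empty_eq_mul hx x.2.le, ρ_mul]

theorem ρ_wordProd_weight_of_prefix [DecidableEq B] {c u : List B} (hn : c.Nodup)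
    (hpre : ∀ l, l <+: u → ∀ s, D.ρ (cs.wordProd l) (D.weight s) =
      D.ρ (cs.wordProd c ^ l.count s) (D.weight s)) {l : List B} (hl : l <+: c ++ u) (s : B) :
    D.ρ (cs.wordProd l) (D.weight s) = D.ρ (cs.wordProd c ^ l.count s) (D.weight s) := by
  rcases le_total l.length c.length with hlc | hlc
  · obtain ⟨b, rfl⟩ : l <+: c := List.prefix_of_prefix_length_le hl (List.prefix_append _ _) hlc
    by_cases hs : s ∈ l
    · rw [List.count_eq_one_of_mem (hn.sublist (List.sublist_append_left _ _)) hs, pow_one,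
        cs.wordProd_append, ρ_mul, D.ρ_wordProd_weight_of_notMem
          fun hb => (List.nodup_append.1 hn).2.2 _ hs _ hb rfl]
    · rw [List.count_eq_zero_of_not_mem hs, pow_zero, ρ_one, D.ρ_wordProd_weight_of_notMem hs]
  · obtain ⟨l', rfl⟩ : c <+: l := List.prefix_of_prefix_length_le (List.prefix_append _ _) hl hlc
    rw [List.prefix_append_right_inj] at hl
    rw [cs.wordProd_append, ρ_mul, hpre l' hl, List.count_append, pow_add, ρ_mul]
    by_cases hs : s ∈ c
    · rw [List.count_eq_one_of_mem hn hs, pow_one]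
    · have hfix : D.ρ (cs.wordProd c) (D.weight s) = D.weight s :=
        D.ρ_wordProd_weight_of_notMem hs
      have hpow : ∀ k, D.ρ (cs.wordProd c ^ k) (D.weight s) = D.weight s := fun k => by
        induction k with
        | zero => rw [pow_zero, ρ_one]
        | succ k ih => rw [pow_succ, ρ_mul, hfix, ih]
      rw [hpow, hpow, hfix]

theorem length_eq_finrank (D : RootData cs V) {c : List B} (hn : c.Nodup) (hfull : ∀ i, i ∈ c) :
    c.length = Module.finrank ℝ V := by
  classical
  have : Fintype B := FiniteDimensional.fintypeBasisIndex D.α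
  rw [Module.finrank_eq_card_basis D.α, ← List.toFinset_card_of_nodup hn, ← Finset.card_univ]
  congr 1
  ext i
  simp [hfull]

theorem inner_weightFn_rootFn_initial {c u : List B} (hn : c.Nodup) {x y : Fin (c ++ u).length}
    (hxy : x < y) (hy : y.1 < c.length) :
    ⟪D.weightFn (c ++ u) ∅ y, D.rootFn (c ++ u) ∅ x⟫ = 0 := by
  classical
  have hxy' : (x : ℕ) < y := hxy
  have hx := hxy'.trans hy
  have hget : (c ++ u).get x = c.get ⟨x, hx⟩ := by
    rw [List.get_eq_getElem, List.get_eq_getElem, List.getElem_append_left hx]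
  rw [D.weightFn_initial hn hy, inner_weight_eq_zero_iff, rootFn_eq, hget,
    pre_empty cs _ x.2.le, List.take_append_of_le_length hx.le,
    D.repr_ρ_wordProd_of_notMem (get_notMem_take hn hy hxy'.le), repr_α, if_neg fun h => ?_]
  have := Fin.mk.inj_iff.1 (List.nodup_iff_injective_get.1 hn h)
  omega

variable {D} in
theorem rootFn_eq_sub {c u : List B}
    (step : ∀ k, D.ρ (cs.wordProd c) (D.weightFn (c ++ u) ∅ k) =
      D.weightFn (c ++ u) ∅ k - D.rootFn (c ++ u) ∅ k)
    {y : Fin (c ++ u).length} (hy : c.length ≤ y.1) :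
    D.rootFn (c ++ u) (initialPositions c u) y = D.weightFn (c ++ u) (initialPositions c u) y -
      D.ρ (cs.wordProd c) (D.weightFn (c ++ u) (initialPositions c u) y) := by
  have h2 := step y
  rw [D.weightFn_eq_map hy, D.rootFn_eq_map hy, ← map_sub] at h2
  rw [(D.ρ (cs.wordProd c)).injective h2, sub_sub_cancel]

-- Both roots are images of weights under `1 - C`, and `⟪C a, b - C b⟫ = -⟪b, a - C a⟫` because `C`
-- is an isometry.
variable {D} in
theorem inner_weightFn_rootFn_of_initial {c u : List B} (hn : c.Nodup)
    (step : ∀ k, D.ρ (cs.wordProd c) (D.weightFn (c ++ u) ∅ k) =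
      D.weightFn (c ++ u) ∅ k - D.rootFn (c ++ u) ∅ k)
    {x y : Fin (c ++ u).length} (hx : x.1 < c.length) (hy : c.length ≤ y.1) :
    ⟪D.weightFn (c ++ u) ∅ y, D.rootFn (c ++ u) ∅ x⟫ =
      -⟪D.weight (c.get ⟨x, hx⟩), D.rootFn (c ++ u) (initialPositions c u) y⟫ := by
  have h1 : D.rootFn (c ++ u) ∅ x =
      D.weightFn (c ++ u) ∅ x - D.ρ (cs.wordProd c) (D.weightFn (c ++ u) ∅ x) := by
    rw [step, sub_sub_cancel]
  rw [h1, D.weightFn_eq_map hy, inner_sub_right, inner_ρ, D.weightFn_initial hn hx,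
    rootFn_eq_sub step hy, real_inner_comm, inner_sub_right, neg_sub,
    real_inner_comm (D.weight _) (D.weightFn _ _ y)]

/-- Reading one more letter `s` advances its weight by one power of the Coxeter element, which is
`step`. For `sign`, two positions in `c` are orthogonal; otherwise the pairing reduces to one of a
fundamental weight with a root whose sign is given by `facet_inversion` for the initial facet. -/
theorem isCambrian [DecidableEq B] {w₀ : W} (h₀ : IsLongest cs w₀) {c u : List B} (hn : c.Nodup)
    (hfull : ∀ i, i ∈ c) (hu : cs.IsReduced u) (hw : cs.wordProd u = w₀)
    (hpre : ∀ l, l <+: u → ∀ s, D.ρ (cs.wordProd l) (D.weight s) =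
      D.ρ (cs.wordProd c ^ l.count s) (D.weight s)) :
    D.IsCambrian (c ++ u) (cs.wordProd c) w₀ := by
  have hI := isFacet_initialPositions (c := c) hu hw
  have step : ∀ k, D.ρ (cs.wordProd c) (D.weightFn (c ++ u) ∅ k) =
      D.weightFn (c ++ u) ∅ k - D.rootFn (c ++ u) ∅ k := fun k => by
    have h1 : D.weightFn (c ++ u) ∅ k - D.rootFn (c ++ u) ∅ k =
        D.ρ (cs.wordProd ((c ++ u).take (k + 1))) (D.weight ((c ++ u).get k)) := by
      rw [weightFn_eq, rootFn_eq, ← map_sub, ← ρ_simple_weight_self, ← ρ_mul,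
        ← pre_succ_of_notMem cs (Finset.notMem_empty k), pre_empty cs _ k.2]
    rw [h1, weightFn_eq, pre_empty cs _ k.2.le,
      D.ρ_wordProd_weight_of_prefix hn hpre (List.take_prefix _ _),
      D.ρ_wordProd_weight_of_prefix hn hpre (List.take_prefix _ _), ← ρ_mul, ← pow_succ',
      List.take_add_one, List.count_append, List.getElem?_eq_getElem k.2]
    simp
  refine ⟨h₀, ?_, by rw [cs.wordProd_append, hw], fun v => D.coxeter_fixed hn hfull, step, ?_,
    ⟨_, hI⟩⟩
  · rw [List.length_append, ← hw, hu, D.length_eq_finrank hn hfull]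
  · intro x y hxy
    have hxy' : (x : ℕ) < y := hxy
    rcases lt_or_ge y.1 c.length with hy | hy
    · exact (D.inner_weightFn_rootFn_initial hn hxy hy).le
    have hy' : y ∉ initialPositions c u := by rw [mem_initialPositions]; omega
    rcases lt_or_ge x.1 c.length with hx | hx
    · have h3 := (D.facet_inversion hI hy' (Nat.zero_le _)).1 (Nat.zero_le _)
      rw [pre_zero, inv_one, ρ_one] at h3
      rw [inner_weightFn_rootFn_of_initial hn step hx hy, neg_nonpos]
      exact D.inner_weight_nonneg _ h3
    · have hx' : x ∉ initialPositions c u := by rw [mem_initialPositions]; omega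
      have h1 := (D.facet_inversion hI hx' y.2.le).2 hxy'
      have h2 := D.inner_weight_nonneg ((c ++ u).get y) h1
      rw [D.weightFn_eq_map (by omega), D.rootFn_eq_map hx, inner_ρ, weightFn_eq, inner_ρ_left]
      rw [inner_neg_right] at h2
      linarith

end RootData
end BrickPolytope

/-! ### Compatibility through the Euler form of a Coxeter element. -/

namespace BrickPolytope
namespace RootData

variable {B W : Type*} [Group W] {M : CoxeterMatrix B} {cs : CoxeterSystem M W}
  {V : Type*} [NormedAddCommGroup V] [InnerProductSpace ℝ V]
  (D : RootData cs V)

/-- Nonnegativity of the form `⟪(1 - C)⁻¹ β, γ⟫` on a pair of vectors, in both orders. -/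
def EulerNonneg (C : W) (β γ : V) : Prop :=
  ∀ u v, u - D.ρ C u = β → v - D.ρ C v = γ → 0 ≤ ⟪u, γ⟫ ∧ 0 ≤ ⟪v, β⟫

/-- A description of `c`-compatibility of distinct almost positive roots without recursion. -/
structure EulerCompatible (C : W) (β γ : V) : Prop where
  ne : β ≠ γ
  left_mem : β ∈ D.almostPositive
  right_mem : γ ∈ D.almostPositive
  left_neg : ∀ s, β = -D.α s → D.α.repr γ s = 0
  right_neg : ∀ s, γ = -D.α s → D.α.repr β s = 0
  eulerNonneg : D.Nonneg β → D.Nonneg γ → D.EulerNonneg C β γ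

theorem isRoot_of_mem {β : V} (h : β ∈ D.almostPositive) : D.IsRoot β := by
  rcases h with ⟨i, rfl⟩ | h
  · exact (D.isRoot_α i).neg
  · exact h.1

theorem not_nonneg_neg_α (i : B) : ¬ D.Nonneg (-D.α i) :=
  (D.nonneg_α i).not_neg (D.isRoot_α i).ne_zero

theorem repr_neg_α [DecidableEq B] (i j : B) :
    D.α.repr (-D.α i) j = if i = j then -1 else 0 := by
  rw [map_neg, Finsupp.neg_apply, repr_α]
  split_ifs <;> simp

variable {D}

theorem EulerCompatible.symm {C : W} {β γ : V} (h : D.EulerCompatible C β γ) :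
    D.EulerCompatible C γ β :=
  ⟨h.ne.symm, h.right_mem, h.left_mem, h.right_neg, h.left_neg, fun h1 h2 u v hu hv =>
    (h.eulerNonneg h2 h1 v u hv hu).symm⟩

theorem eulerCompatible_comm {C : W} {β γ : V} :
    D.EulerCompatible C β γ ↔ D.EulerCompatible C γ β := ⟨fun h => h.symm, fun h => h.symm⟩

theorem eulerCompatible_neg_α_iff {C : W} {i : B} {γ : V} (hγ : γ ∈ D.almostPositive) :
    D.EulerCompatible C (-D.α i) γ ↔ D.α.repr γ i = 0 := by
  classical
  refine ⟨fun h => h.left_neg i rfl, fun h => ⟨?_, Or.inl ⟨i, rfl⟩, hγ, fun s hs => ?_,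
    fun s hs => ?_, fun h1 => absurd h1 (D.not_nonneg_neg_α i)⟩⟩
  · rintro rfl
    rw [repr_neg_α, if_pos rfl] at h
    norm_num at h
  · rwa [← D.α.injective (neg_injective hs)]
  · rw [hs, repr_neg_α] at h
    rw [repr_neg_α, if_neg fun he => ?_]
    rw [if_pos he.symm] at h
    norm_num at h

theorem eulerCompatible_iff_of_nonneg {C : W} {β γ : V} (hβ : D.IsRoot β) (hβ' : D.Nonneg β)
    (hγ : D.IsRoot γ) (hγ' : D.Nonneg γ) :
    D.EulerCompatible C β γ ↔ β ≠ γ ∧ D.EulerNonneg C β γ :=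
  ⟨fun h => ⟨h.ne, h.eulerNonneg hβ' hγ'⟩, fun h => ⟨h.1, Or.inr ⟨hβ, hβ'⟩, Or.inr ⟨hγ, hγ'⟩,
    fun s hs => absurd (hs ▸ hβ') (D.not_nonneg_neg_α s),
    fun s hs => absurd (hs ▸ hγ') (D.not_nonneg_neg_α s), fun _ _ => h.2⟩⟩

variable (D)

theorem sub_conj_iff {C : W} {s : B} {u β : V} :
    u - D.ρ (cs.simple s * C * cs.simple s) u = D.ρ (cs.simple s) β ↔
      D.ρ (cs.simple s) u - D.ρ C (D.ρ (cs.simple s) u) = β := by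
  have hs : ∀ v, D.ρ (cs.simple s) (D.ρ (cs.simple s) v) = v := fun v => by
    rw [← ρ_mul, cs.simple_mul_simple_self, ρ_one]
  rw [← (D.ρ (cs.simple s)).injective.eq_iff, hs, map_sub, ρ_mul, ρ_mul, hs]

theorem eulerNonneg_conj_iff {C : W} {s : B} {β γ : V} :
    D.EulerNonneg (cs.simple s * C * cs.simple s) (D.ρ (cs.simple s) β) (D.ρ (cs.simple s) γ) ↔
      D.EulerNonneg C β γ := by
  have hs : ∀ v, D.ρ (cs.simple s) (D.ρ (cs.simple s) v) = v := fun v => by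
    rw [← ρ_mul, cs.simple_mul_simple_self, ρ_one]
  constructor
  · intro h u v hu hv
    have := h (D.ρ (cs.simple s) u) (D.ρ (cs.simple s) v) (D.sub_conj_iff.2 (by rwa [hs]))
      (D.sub_conj_iff.2 (by rwa [hs]))
    rwa [inner_ρ, inner_ρ] at this
  · intro h u v hu hv
    have := h _ _ (D.sub_conj_iff.1 hu) (D.sub_conj_iff.1 hv)
    rwa [inner_ρ_left, inner_ρ_left, cs.inv_simple] at this

/-- The symmetrized Euler form is the inner product, so one order of arguments determines the other.
-/
theorem inner_add_inner_eq {C : W} {u v β γ : V} (hu : u - D.ρ C u = β) (hv : v - D.ρ C v = γ) :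
    ⟪u, γ⟫ + ⟪v, β⟫ = ⟪β, γ⟫ := by
  have h1 := D.inner_ρ C u v
  rw [← hu, ← hv]
  simp only [inner_sub_left, inner_sub_right, h1]
  rw [real_inner_comm u v, real_inner_comm (D.ρ C u) v]
  ring

variable [FiniteDimensional ℝ V]

theorem exists_unique_sub {C : W} (hC : IsCoxeterElement cs C) (β : V) :
    ∃ u, u - D.ρ C u = β ∧ ∀ u', u' - D.ρ C u' = β → u' = u := by
  obtain ⟨c, hn, hfull, rfl⟩ := hC
  set L : V →ₗ[ℝ] V := LinearMap.id - (D.ρ (cs.wordProd c)).toLinearEquiv.toLinearMap with hL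
  have hinj : Function.Injective L := fun u v h => D.coxeter_sub_injective hn hfull h
  obtain ⟨u, hu⟩ := LinearMap.injective_iff_surjective.1 hinj β
  exact ⟨u, hu, fun u' hu' => hinj (hu'.trans hu.symm)⟩

/-- The simple root of an initial letter is made negative by `C⁻¹`, hence is a first root; its
coordinates show of which letter. -/
theorem weight_sub_of_isLeftDescent {C : W} (hC : IsCoxeterElement cs C) {s : B}
    (hs : cs.IsLeftDescent C s) : D.weight s - D.ρ C (D.weight s) = D.α s := by
  classical
  obtain ⟨c, hn, hfull, rfl⟩ := hC
  have hneg : D.Nonneg (-D.ρ (cs.wordProd c)⁻¹ (D.α s)) := by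
    refine ((D.isRoot_α s).map _).nonneg_or_neg.resolve_left fun h => ?_
    have h1 := D.length_lt_mul_simple h
    rw [← cs.length_inv, ← cs.length_inv ((cs.wordProd c)⁻¹ * _), mul_inv_rev, inv_inv,
      cs.inv_simple] at h1
    exact absurd hs (not_lt.2 h1.le)
  obtain ⟨k, hk⟩ := D.exists_eq_firstRoot hn (D.isRoot_α s) (D.nonneg_α s) hneg
  have h1 := D.repr_firstRoot_self hn hfull k
  rw [← hk, repr_α] at h1
  have h2 : s = k := by
    by_contra hne
    rw [if_neg hne] at h1
    exact zero_ne_one h1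
  rw [← h2] at hk
  exact hk.symm

variable {D} {C : W} {s : B}

theorem inner_weight_α_sub (γ : V) : ⟪D.α s, γ⟫ - ⟪D.weight s, γ⟫ =
    -(⟪D.α s, D.α s⟫ / 2 * D.α.repr (D.ρ (cs.simple s) γ) s) := by
  rw [repr_ρ_simple_self, inner_weight_left]
  have := (D.inner_α_self_pos s).ne'
  field_simp
  ring

/-- Compatibility with a simple root which is initial in the Coxeter element. -/
theorem eulerNonneg_α_iff (hC : IsCoxeterElement cs C) (hs : cs.IsLeftDescent C s) {γ : V}
    (hγ : D.Nonneg γ) (hγs : D.Nonneg (D.ρ (cs.simple s) γ)) :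
    D.EulerNonneg C (D.α s) γ ↔ D.α.repr (D.ρ (cs.simple s) γ) s = 0 := by
  have hw := D.weight_sub_of_isLeftDescent hC hs
  have hα := D.inner_α_self_pos s
  -- This pairing is never positive, as the reflected root is positive. Asking it to be nonnegative
  -- means that it vanishes.
  have key : ∀ v, v - D.ρ C v = γ → ⟪v, D.α s⟫ =
      -(⟪D.α s, D.α s⟫ / 2 * D.α.repr (D.ρ (cs.simple s) γ) s) := fun v hv => by
    have h1 := D.inner_add_inner_eq hw hv
    rw [← inner_weight_α_sub]
    linarith
  constructor
  · intro h
    obtain ⟨v, hv, -⟩ := D.exists_unique_sub hC γ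
    have h1 := (h _ v hw hv).2
    rw [key v hv] at h1
    have h2 := hγs s
    nlinarith
  · intro h u v hu hv
    obtain ⟨u', -, huniq⟩ := D.exists_unique_sub hC (D.α s)
    rw [huniq u hu, ← huniq _ hw]
    refine ⟨D.inner_weight_nonneg s hγ, ?_⟩
    rw [key v hv, h, mul_zero, neg_zero]

/-- Although `-α s` is not positive, the Euler condition is needed for it: rotation turns it into `α
s`, and undoing the conjugation returns to `-α s`. Here one pairing is automatically nonnegative and
the other automatically nonpositive. -/
theorem eulerNonneg_neg_α_iff (hC : IsCoxeterElement cs C) (hs : cs.IsLeftDescent C s) {γ : V}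
    (hγ : D.Nonneg γ) (hγs : D.Nonneg (D.ρ (cs.simple s) γ)) :
    D.EulerNonneg C (-D.α s) γ ↔ D.α.repr γ s = 0 := by
  have hw : -D.weight s - D.ρ C (-D.weight s) = -D.α s := by
    rw [← D.weight_sub_of_isLeftDescent hC hs, map_neg]
    abel
  have hα := D.inner_α_self_pos s
  have key : ∀ v, v - D.ρ C v = γ → ⟪v, -D.α s⟫ =
      ⟪D.α s, D.α s⟫ / 2 * D.α.repr (D.ρ (cs.simple s) γ) s := fun v hv => by
    have h1 := D.inner_add_inner_eq hw hv
    have h2 := inner_weight_α_sub (D := D) (s := s) γ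
    rw [inner_neg_left, inner_neg_left] at h1
    linarith
  constructor
  · intro h
    obtain ⟨v, hv, -⟩ := D.exists_unique_sub hC γ
    have h1 := (h _ v hw hv).1
    rw [inner_neg_left, inner_weight_left] at h1
    have h2 := hγ s
    nlinarith
  · intro h u v hu hv
    obtain ⟨u', -, huniq⟩ := D.exists_unique_sub hC (-D.α s)
    rw [huniq u hu, ← huniq _ hw, inner_neg_left, inner_weight_left, h, mul_zero, neg_zero,
      key v hv]
    exact ⟨le_rfl, mul_nonneg (by linarith) (hγs s)⟩

omit [FiniteDimensional ℝ V] in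
theorem sigma_neg_α_of_ne {t : B} (h : t ≠ s) : D.sigma s (-D.α t) = -D.α t := by
  unfold sigma
  rw [if_pos ⟨t, h, rfl⟩]

omit [FiniteDimensional ℝ V] in
theorem sigma_eq {β : V} (h : ∀ t, t ≠ s → β ≠ -D.α t) : D.sigma s β = D.ρ (cs.simple s) β := by
  unfold sigma
  rw [if_neg]
  rintro ⟨t, ht, he⟩
  exact h t ht he

omit [FiniteDimensional ℝ V] in
theorem sigma_neg_α_self : D.sigma s (-D.α s) = D.α s := by
  rw [sigma_eq fun t ht he => ht (D.α.injective (neg_injective he)).symm, map_neg, ρ_simple_α,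
    neg_neg]

omit [FiniteDimensional ℝ V] in
theorem sigma_of_nonneg {β : V} (h : D.Nonneg β) : D.sigma s β = D.ρ (cs.simple s) β :=
  sigma_eq fun t _ he => D.not_nonneg_neg_α t (he ▸ h)

omit [FiniteDimensional ℝ V] in
theorem sigma_α_self : D.sigma s (D.α s) = -D.α s := by
  rw [sigma_of_nonneg (D.nonneg_α s), ρ_simple_α]

/-- The four kinds of almost positive roots with respect to a simple reflection. -/
theorem almostPositive_cases {β : V} (h : β ∈ D.almostPositive) (s : B) :
    (∃ t, t ≠ s ∧ β = -D.α t) ∨ β = -D.α s ∨ β = D.α s ∨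
      (D.IsRoot β ∧ D.Nonneg β ∧ β ≠ D.α s ∧ D.Nonneg (D.ρ (cs.simple s) β)) := by
  rcases h with ⟨t, rfl⟩ | ⟨h1, h2⟩
  · by_cases ht : t = s
    · exact Or.inr (Or.inl (by rw [ht]))
    · exact Or.inl ⟨t, ht, rfl⟩
  · by_cases hs : β = D.α s
    · exact Or.inr (Or.inr (Or.inl hs))
    · exact Or.inr (Or.inr (Or.inr ⟨h1, h2, hs, IsRoot.ρ_simple_nonneg h1 h2 hs⟩))

theorem sigma_mem {β : V} (h : β ∈ D.almostPositive) : D.sigma s β ∈ D.almostPositive := by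
  rcases almostPositive_cases h s with ⟨t, ht, rfl⟩ | rfl | rfl | ⟨h1, h2, -, h3⟩
  · rw [sigma_neg_α_of_ne ht]; exact h
  · rw [sigma_neg_α_self]; exact Or.inr ⟨D.isRoot_α s, D.nonneg_α s⟩
  · rw [sigma_α_self]; exact Or.inl ⟨s, rfl⟩
  · rw [sigma_of_nonneg h2]; exact Or.inr ⟨h1.map _, h3⟩

/-- Conjugation carries the Euler form of `C` to that of the rotated element, so roots that stay
positive cause no change. The fixed negative simple roots see only a coordinate unaffected by `s`,
and the pairs involving `α s` or `-α s` are the two vanishing criteria above. -/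
theorem eulerCompatible_conj_iff (hC : IsCoxeterElement cs C) (hs : cs.IsLeftDescent C s)
    {β γ : V} (hβ : β ∈ D.almostPositive) (hγ : γ ∈ D.almostPositive) :
    D.EulerCompatible (cs.simple s * C * cs.simple s) (D.sigma s β) (D.sigma s γ) ↔
      D.EulerCompatible C β γ := by
  classical
  have hsne : ∀ {t : B}, t ≠ s → ∀ v, D.α.repr (D.ρ (cs.simple s) v) t = D.α.repr v t :=
    fun ht v => D.repr_ρ_simple_of_ne ht.symm v
  have hss : ∀ v, D.ρ (cs.simple s) (D.ρ (cs.simple s) v) = v := fun v => by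
    rw [← ρ_mul, cs.simple_mul_simple_self, ρ_one]
  -- one of the two roots is a fixed negative simple root
  have case_a : ∀ {t : B} {γ : V}, t ≠ s → γ ∈ D.almostPositive →
      (D.EulerCompatible (cs.simple s * C * cs.simple s) (D.sigma s (-D.α t)) (D.sigma s γ) ↔
        D.EulerCompatible C (-D.α t) γ) := by
    intro t γ ht hγ
    rw [sigma_neg_α_of_ne ht, eulerCompatible_neg_α_iff (sigma_mem hγ),
      eulerCompatible_neg_α_iff hγ]
    by_cases h : ∃ r, r ≠ s ∧ γ = -D.α r
    · obtain ⟨r, hr, rfl⟩ := h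
      rw [sigma_neg_α_of_ne hr]
    · rw [sigma_eq fun r hr he => h ⟨r, hr, he⟩, hsne ht]
  have case_b : ∀ {γ : V}, (γ = D.α s ∨ γ = -D.α s ∨ (D.IsRoot γ ∧ D.Nonneg γ ∧ γ ≠ D.α s ∧
      D.Nonneg (D.ρ (cs.simple s) γ))) →
      (D.EulerCompatible (cs.simple s * C * cs.simple s) (D.sigma s (-D.α s)) (D.sigma s γ) ↔
        D.EulerCompatible C (-D.α s) γ) := by
    rintro γ (rfl | rfl | ⟨h1, h2, h3, h4⟩)
    · rw [sigma_neg_α_self, sigma_α_self, eulerCompatible_comm,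
        eulerCompatible_neg_α_iff (Or.inr ⟨D.isRoot_α s, D.nonneg_α s⟩),
        eulerCompatible_neg_α_iff (Or.inr ⟨D.isRoot_α s, D.nonneg_α s⟩)]
    · exact ⟨fun h => absurd rfl h.ne, fun h => absurd rfl h.ne⟩
    · rw [sigma_neg_α_self, sigma_of_nonneg h2, eulerCompatible_neg_α_iff (Or.inr ⟨h1, h2⟩),
        eulerCompatible_iff_of_nonneg (D.isRoot_α s) (D.nonneg_α s) (h1.map _) h4]
      have h5 : D.α s = D.ρ (cs.simple s) (-D.α s) := by rw [map_neg, ρ_simple_α, neg_neg]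
      have h6 : D.α s ≠ D.ρ (cs.simple s) γ := fun he => by
        rw [h5] at he
        exact D.not_nonneg_neg_α s ((D.ρ (cs.simple s)).injective he ▸ h2)
      rw [and_iff_right h6]
      nth_rw 1 [h5]
      rw [eulerNonneg_conj_iff, eulerNonneg_neg_α_iff hC hs h2 h4]
  have case_c : ∀ {γ : V}, (γ = D.α s ∨ (D.IsRoot γ ∧ D.Nonneg γ ∧ γ ≠ D.α s ∧
      D.Nonneg (D.ρ (cs.simple s) γ))) →
      (D.EulerCompatible (cs.simple s * C * cs.simple s) (D.sigma s (D.α s)) (D.sigma s γ) ↔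
        D.EulerCompatible C (D.α s) γ) := by
    rintro γ (rfl | ⟨h1, h2, h3, h4⟩)
    · exact ⟨fun h => absurd rfl h.ne, fun h => absurd rfl h.ne⟩
    · rw [sigma_α_self, sigma_of_nonneg h2, eulerCompatible_neg_α_iff (Or.inr ⟨h1.map _, h4⟩),
        eulerCompatible_iff_of_nonneg (D.isRoot_α s) (D.nonneg_α s) h1 h2,
        and_iff_right h3.symm, eulerNonneg_α_iff hC hs h2 h4]
  have swap : (D.EulerCompatible (cs.simple s * C * cs.simple s) (D.sigma s γ) (D.sigma s β) ↔
      D.EulerCompatible C γ β) →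
      (D.EulerCompatible (cs.simple s * C * cs.simple s) (D.sigma s β) (D.sigma s γ) ↔
      D.EulerCompatible C β γ) := fun h => by
    rwa [eulerCompatible_comm, eulerCompatible_comm (C := C)]
  rcases almostPositive_cases hβ s with ⟨t, ht, rfl⟩ | rfl | rfl | hb
  · exact case_a ht hγ
  · rcases almostPositive_cases hγ s with ⟨t, ht, rfl⟩ | rfl | rfl | hg
    · exact swap (case_a ht hβ)
    · exact case_b (Or.inr (Or.inl rfl))
    · exact case_b (Or.inl rfl)
    · exact case_b (Or.inr (Or.inr hg))
  · rcases almostPositive_cases hγ s with ⟨t, ht, rfl⟩ | rfl | rfl | hg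
    · exact swap (case_a ht hβ)
    · exact swap (case_b (Or.inl rfl))
    · exact case_c (Or.inl rfl)
    · exact case_c (Or.inr hg)
  · rcases almostPositive_cases hγ s with ⟨t, ht, rfl⟩ | rfl | rfl | ⟨h1, h2, h3, h4⟩
    · exact swap (case_a ht hβ)
    · exact swap (case_b (Or.inr (Or.inr hb)))
    · exact swap (case_c (Or.inr hb))
    · obtain ⟨b1, b2, b3, b4⟩ := hb
      rw [sigma_of_nonneg b2, sigma_of_nonneg h2,
        eulerCompatible_iff_of_nonneg (b1.map _) b4 (h1.map _) h4,
        eulerCompatible_iff_of_nonneg b1 b2 h1 h2, eulerNonneg_conj_iff,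
        (D.ρ (cs.simple s)).injective.ne_iff]

theorem Compatible.eulerCompatible {β γ : V} (h : D.Compatible C β γ) :
    D.EulerCompatible C β γ := by
  induction h with
  | neg_simple hc hβ h => exact (eulerCompatible_neg_α_iff hβ).2 h
  | of_rotate hc hi hβ hγ h ih => exact (eulerCompatible_conj_iff hc hi hβ hγ).1 ih
  | rotate hc hi hβ hγ h ih => exact (eulerCompatible_conj_iff hc hi hβ hγ).2 ih

omit [FiniteDimensional ℝ V] in
theorem EulerCompatible.of_neg_α (hC : IsCoxeterElement cs C) {i : B} {γ : V}
    (h : D.EulerCompatible C (-D.α i) γ) : D.Compatible C (-D.α i) γ :=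
  Compatible.neg_simple hC h.right_mem (h.left_neg i rfl)

omit [FiniteDimensional ℝ V] in
theorem EulerCompatible.nonneg_or_eq {β γ : V} (h : D.EulerCompatible C β γ) :
    (∃ i, β = -D.α i) ∨ D.Nonneg β := h.left_mem.imp_right And.right

theorem isLeftDescent_cons (D : RootData cs V) {s : B} {l : List B} (hn : (s :: l).Nodup) :
    cs.IsLeftDescent (cs.wordProd (s :: l)) s := by
  unfold CoxeterSystem.IsLeftDescent
  have h1 : 0 < D.α.repr (D.ρ (cs.wordProd l)⁻¹ (D.α s)) s := by
    rw [← cs.wordProd_reverse, D.repr_ρ_wordProd_of_notMem (by simpa using (List.nodup_cons.1 hn).1),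
      Module.Basis.repr_self, Finsupp.single_eq_same]
    exact one_pos
  have h2 := D.length_lt_mul_simple (((D.isRoot_α s).map _).nonneg_of_repr_pos h1)
  rw [cs.length_inv, ← cs.length_inv (_ * _), mul_inv_rev, inv_inv, cs.inv_simple] at h2
  rwa [cs.wordProd_cons, cs.simple_mul_simple_cancel_left]

/-- Rotate through the letters of `a` one by one. Either `β` becomes the negative of a simple root
on the way, and the first rule decides, or it is only moved by reflections and the hypothesis `H`
takes over. -/
theorem Compatible.of_round {a b : List B} (hn : (a ++ b).Nodup) (hfull : ∀ i, i ∈ a ++ b)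
    {β γ : V} (h : D.EulerCompatible (cs.wordProd (a ++ b)) β γ)
    (H : D.Nonneg (D.ρ (cs.wordProd a)⁻¹ β) → ∀ γ',
      D.EulerCompatible (cs.wordProd (b ++ a)) (D.ρ (cs.wordProd a)⁻¹ β) γ' →
      D.Compatible (cs.wordProd (b ++ a)) (D.ρ (cs.wordProd a)⁻¹ β) γ') :
    D.Compatible (cs.wordProd (a ++ b)) β γ := by
  induction a generalizing b β γ with
  | nil =>
    rcases h.nonneg_or_eq with ⟨i, rfl⟩ | hβ
    · exact EulerCompatible.of_neg_α ⟨_, hn, hfull, rfl⟩ h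
    · simp only [cs.wordProd_nil, inv_one, ρ_one, List.append_nil, List.nil_append] at H h ⊢
      exact H hβ γ h
  | cons s a ih =>
    have hC : IsCoxeterElement cs (cs.wordProd (s :: a ++ b)) := ⟨_, hn, hfull, rfl⟩
    have hconj : cs.simple s * cs.wordProd (s :: a ++ b) * cs.simple s =
        cs.wordProd (a ++ (b ++ [s])) := by
      rw [List.cons_append, cs.wordProd_cons, cs.simple_mul_simple_cancel_left, ← List.append_assoc,
        cs.wordProd_append _ [s], cs.wordProd_singleton]
    have hperm : (a ++ (b ++ [s])).Perm (s :: a ++ b) := by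
      rw [← List.append_assoc]
      exact List.perm_append_singleton s (a ++ b)
    have hn' : (a ++ (b ++ [s])).Nodup := hperm.nodup_iff.2 hn
    have hfull' : ∀ i, i ∈ a ++ (b ++ [s]) := fun i => hperm.mem_iff.2 (hfull i)
    have hs : cs.IsLeftDescent (cs.wordProd (s :: a ++ b)) s := isLeftDescent_cons D hn
    rcases h.nonneg_or_eq with ⟨i, rfl⟩ | hβ
    · exact EulerCompatible.of_neg_α hC h
    refine Compatible.of_rotate hC hs h.left_mem h.right_mem ?_
    have h' := (eulerCompatible_conj_iff hC hs h.left_mem h.right_mem).2 h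
    rw [hconj] at h' ⊢
    by_cases hβs : β = D.α s
    · rw [hβs, sigma_α_self] at h' ⊢
      exact EulerCompatible.of_neg_α ⟨_, hn', hfull', rfl⟩ h'
    · refine ih hn' hfull' h' ?_
      have h2 : D.ρ (cs.wordProd a)⁻¹ (D.sigma s β) = D.ρ (cs.wordProd (s :: a))⁻¹ β := by
        rw [sigma_of_nonneg hβ, cs.wordProd_cons, mul_inv_rev, cs.inv_simple, ρ_mul]
      rw [h2, List.append_assoc, List.singleton_append]
      exact H

/-- Some inverse power of the Coxeter element makes `β` negative, so within finitely many rounds of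
rotation `β` must pass through the negative of a simple root. -/
theorem EulerCompatible.compatible [Finite W] (hC : IsCoxeterElement cs C) {β γ : V}
    (h : D.EulerCompatible C β γ) : D.Compatible C β γ := by
  obtain ⟨c, hn, hfull, rfl⟩ := hC
  have key : ∀ (k : ℕ) (β γ : V), D.EulerCompatible (cs.wordProd c) β γ →
      D.Nonneg (-D.ρ (cs.wordProd c ^ k)⁻¹ β) → D.Compatible (cs.wordProd c) β γ := by
    intro k
    induction k with
    | zero =>
      intro β γ h hneg
      rw [pow_zero, inv_one, ρ_one] at hneg
      rcases h.nonneg_or_eq with ⟨i, rfl⟩ | hβ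
      · exact EulerCompatible.of_neg_α ⟨_, hn, hfull, rfl⟩ h
      · exact absurd hneg (hβ.not_neg (D.isRoot_of_mem h.left_mem).ne_zero)
    | succ k ih =>
      intro β γ h hneg
      have := Compatible.of_round (a := c) (b := []) (D := D) (cs := cs) (β := β) (γ := γ)
      simp only [List.append_nil, List.nil_append] at this
      refine this hn hfull h fun _ γ' h' => ih _ _ h' ?_
      rwa [← ρ_mul, ← mul_inv_rev, ← pow_succ']
  obtain ⟨a, ha⟩ := D.exists_neg hn hfull (D.isRoot_of_mem h.left_mem)
  -- This exponent makes the inverse power equal to the positive power `a` found by `exists_neg`.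
  refine key ((orderOf (cs.wordProd c) - 1) * a) β γ h ?_
  have h1 : (cs.wordProd c ^ ((orderOf (cs.wordProd c) - 1) * a))⁻¹ = cs.wordProd c ^ a := by
    rw [inv_eq_iff_mul_eq_one, ← pow_add, ← Nat.succ_mul, Nat.succ_eq_add_one,
      Nat.sub_add_cancel (orderOf_pos _), pow_mul, pow_orderOf_eq_one, one_pow]
  rwa [h1]

theorem compatible_iff [Finite W] (hC : IsCoxeterElement cs C) {β γ : V} :
    D.Compatible C β γ ↔ D.EulerCompatible C β γ :=
  ⟨Compatible.eulerCompatible, EulerCompatible.compatible hC⟩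

end RootData
end BrickPolytope

/-! ### From positions of c w∘(c) to almost positive roots. -/

namespace BrickPolytope
namespace RootData

variable {B W : Type*} [Group W] {M : CoxeterMatrix B} {cs : CoxeterSystem M W}
  {V : Type*} [NormedAddCommGroup V] [InnerProductSpace ℝ V] [FiniteDimensional ℝ V]
  (D : RootData cs V) {c u : List B} {w₀ : W}

/-- The almost positive root of a position of `c w∘(c)`. -/
noncomputable def clusterRoot (c u : List B) (x : Fin (c ++ u).length) : V :=
  if h : x.1 < c.length then -D.α (c.get ⟨x, h⟩)
  else D.rootFn (c ++ u) (initialPositions c u) x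

omit [FiniteDimensional ℝ V] in
theorem clusterRoot_of_lt {x : Fin (c ++ u).length} (h : x.1 < c.length) :
    D.clusterRoot c u x = -D.α (c.get ⟨x, h⟩) := dif_pos h

omit [FiniteDimensional ℝ V] in
theorem clusterRoot_of_le {x : Fin (c ++ u).length} (h : c.length ≤ x.1) :
    D.clusterRoot c u x = D.rootFn (c ++ u) (initialPositions c u) x := dif_neg (not_lt.2 h)

variable {D}

theorem nonneg_clusterRoot (hI : IsFacet cs (c ++ u) w₀ (initialPositions c u))
    {x : Fin (c ++ u).length} (h : c.length ≤ x.1) : D.Nonneg (D.clusterRoot c u x) := by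
  have h3 := (D.facet_inversion hI (j := x) (by rw [mem_initialPositions]; omega)
    (Nat.zero_le _)).1 (Nat.zero_le _)
  rwa [pre_zero, inv_one, ρ_one, ← clusterRoot_of_le D h] at h3

omit [FiniteDimensional ℝ V] in
theorem isRoot_clusterRoot {x : Fin (c ++ u).length} : D.IsRoot (D.clusterRoot c u x) := by
  rcases lt_or_ge x.1 c.length with h | h
  · rw [clusterRoot_of_lt D h]
    exact (D.isRoot_α _).neg
  · rw [clusterRoot_of_le D h]
    exact D.isRoot_rootFn x

theorem clusterRoot_mem (hI : IsFacet cs (c ++ u) w₀ (initialPositions c u))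
    (x : Fin (c ++ u).length) : D.clusterRoot c u x ∈ D.almostPositive := by
  rcases lt_or_ge x.1 c.length with h | h
  · rw [clusterRoot_of_lt D h]
    exact Or.inl ⟨_, rfl⟩
  · exact Or.inr ⟨isRoot_clusterRoot, nonneg_clusterRoot hI h⟩

theorem clusterRoot_ne_of_lt (hn : c.Nodup)
    (hI : IsFacet cs (c ++ u) w₀ (initialPositions c u)) {x y : Fin (c ++ u).length}
    (hxy : x < y) : D.clusterRoot c u x ≠ D.clusterRoot c u y := by
  have hxy' : (x : ℕ) < y := hxy
  rcases lt_or_ge y.1 c.length with hy | hy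
  · rw [clusterRoot_of_lt D hy, clusterRoot_of_lt D (hxy'.trans hy)]
    intro h
    have := Fin.mk.inj_iff.1 (List.nodup_iff_injective_get.1 hn (D.α.injective (neg_injective h)))
    omega
  · rcases lt_or_ge x.1 c.length with hx | hx
    · rw [clusterRoot_of_lt D hx]
      intro h
      exact D.not_nonneg_neg_α _ (h ▸ nonneg_clusterRoot hI hy)
    · rw [clusterRoot_of_le D hx, clusterRoot_of_le D hy]
      intro h
      have h1 := (D.facet_inversion hI (j := x) (by rw [mem_initialPositions]; omega) y.2.le).2 hxy'
      have h2 := (D.facet_inversion hI (j := y) (by rw [mem_initialPositions]; omega) y.2.le).1 le_rfl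
      rw [h] at h1
      exact h2.not_neg ((D.isRoot_rootFn y).map _).ne_zero h1

theorem clusterRoot_injective (hn : c.Nodup)
    (hI : IsFacet cs (c ++ u) w₀ (initialPositions c u)) :
    Function.Injective (D.clusterRoot c u) := fun x y h => by
  rcases lt_trichotomy x y with hxy | hxy | hxy
  · exact absurd h (clusterRoot_ne_of_lt hn hI hxy)
  · exact hxy
  · exact absurd h.symm (clusterRoot_ne_of_lt hn hI hxy)

theorem exists_clusterRoot_eq (h₀ : IsLongest cs w₀) (hfull : ∀ i, i ∈ c)
    (hI : IsFacet cs (c ++ u) w₀ (initialPositions c u)) {β : V} (hβ : β ∈ D.almostPositive) :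
    ∃ x, D.clusterRoot c u x = β := by
  rcases hβ with ⟨i, rfl⟩ | ⟨h1, h2⟩
  · obtain ⟨k, hk⟩ := List.get_of_mem (hfull i)
    refine ⟨⟨k, by rw [List.length_append]; omega⟩, ?_⟩
    rw [clusterRoot_of_lt D k.2]
    exact congrArg (fun i => -D.α i) hk
  · obtain ⟨j, hj, hjβ⟩ := D.exists_rootFn_eq h₀ hI h1 h2
    rw [mem_initialPositions, not_lt] at hj
    exact ⟨j, by rw [clusterRoot_of_le D hj, hjβ]⟩

/-- For two positions after `c`, each root is the image under `1 - C` of its weight for the initial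
facet. The pairing of the earlier weight with the later root is nonnegative by `facet_inversion` and
the opposite one is nonpositive by `sign`, so the Euler condition means that the latter vanishes. A
position in `c` gives a negative simple root, and the pairing is then a coordinate. -/
theorem eulerCompatible_clusterRoot_iff (hn : c.Nodup) (hfull : ∀ i, i ∈ c)
    (h : D.IsCambrian (c ++ u) (cs.wordProd c) w₀)
    (hI : IsFacet cs (c ++ u) w₀ (initialPositions c u)) {x y : Fin (c ++ u).length} (hxy : x < y) :
    D.EulerCompatible (cs.wordProd c) (D.clusterRoot c u x) (D.clusterRoot c u y) ↔
      ⟪D.weightFn (c ++ u) ∅ y, D.rootFn (c ++ u) ∅ x⟫ = 0 := by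
  classical
  have hxy' : (x : ℕ) < y := hxy
  rcases lt_or_ge x.1 c.length with hx | hx
  · rw [clusterRoot_of_lt D hx, eulerCompatible_neg_α_iff (clusterRoot_mem hI y)]
    rcases lt_or_ge y.1 c.length with hy | hy
    · rw [D.inner_weightFn_rootFn_initial hn hxy hy, clusterRoot_of_lt D hy, repr_neg_α,
        if_neg fun he => ?_]
      have := Fin.mk.inj_iff.1 (List.nodup_iff_injective_get.1 hn he)
      omega
    · rw [inner_weightFn_rootFn_of_initial hn h.step hx hy, neg_eq_zero, inner_weight_eq_zero_iff,
        clusterRoot_of_le D hy]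
  · have hy : c.length ≤ y.1 := hx.trans hxy'.le
    rw [eulerCompatible_iff_of_nonneg isRoot_clusterRoot (nonneg_clusterRoot hI hx)
      isRoot_clusterRoot (nonneg_clusterRoot hI hy), and_iff_right (clusterRoot_ne_of_lt hn hI hxy),
      clusterRoot_of_le D hx, clusterRoot_of_le D hy, weightFn_eq_map D hy, rootFn_eq_map D hx, inner_ρ]
    have hsign := h.sign x y hxy
    rw [weightFn_eq_map D hy, rootFn_eq_map D hx, inner_ρ] at hsign
    have hpos : 0 ≤ ⟪D.weightFn (c ++ u) (initialPositions c u) x,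
        D.rootFn (c ++ u) (initialPositions c u) y⟫ := by
      rw [weightFn_eq, inner_ρ_left]
      exact D.inner_weight_nonneg _ ((D.facet_inversion hI (j := y)
        (by rw [mem_initialPositions]; omega) x.2.le).1 hxy'.le)
    have ex := rootFn_eq_sub h.step hx
    have ey := rootFn_eq_sub h.step hy
    constructor
    · intro hE
      exact le_antisymm hsign (hE _ _ ex.symm ey.symm).2
    · intro h0 a b ha hb
      rw [D.coxeter_sub_injective hn hfull (ha.trans ex),
        D.coxeter_sub_injective hn hfull (hb.trans ey)]
      exact ⟨hpos, h0.ge⟩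

/-- Both complexes are determined by their pairs, and the bijection between positions and almost
positive roots matches the pairs. -/
theorem mem_clusterComplex_iff [Finite W] (hn : c.Nodup) (hfull : ∀ i, i ∈ c)
    (h : D.IsCambrian (c ++ u) (cs.wordProd c) w₀)
    (hI : IsFacet cs (c ++ u) w₀ (initialPositions c u)) (G : Finset V) :
    G ∈ D.clusterComplex (cs.wordProd c) ↔ ∃ A ∈ subwordComplex cs (c ++ u) w₀,
      D.clusterRoot c u '' (A : Set (Fin (c ++ u).length)) = G := by
  classical
  have hC : IsCoxeterElement cs (cs.wordProd c) := ⟨c, hn, hfull, rfl⟩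
  constructor
  · rintro ⟨hG, hpair⟩
    refine ⟨Finset.univ.filter fun x => D.clusterRoot c u x ∈ G, ?_, ?_⟩
    · rw [h.mem_subwordComplex_iff_isOrtho]
      intro x hx y hy hxy
      rw [Finset.mem_filter] at hx hy
      rw [← eulerCompatible_clusterRoot_iff hn hfull h hI hxy, ← compatible_iff hC]
      exact hpair hx.2 hy.2 (clusterRoot_ne_of_lt hn hI hxy)
    · ext β
      constructor
      · rintro ⟨x, hx, rfl⟩
        simpa using hx
      · intro hβ
        obtain ⟨x, rfl⟩ := exists_clusterRoot_eq h.longest hfull hI (hG hβ)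
        exact ⟨x, by simpa using hβ, rfl⟩
  · rintro ⟨A, hA, hAG⟩
    rw [h.mem_subwordComplex_iff_isOrtho] at hA
    change (G : Set V) ⊆ D.almostPositive ∧
      (G : Set V).Pairwise fun β γ => D.Compatible (cs.wordProd c) β γ
    rw [← hAG]
    refine ⟨?_, ?_⟩
    · rintro _ ⟨x, -, rfl⟩
      exact clusterRoot_mem hI x
    · rintro _ ⟨x, hx, rfl⟩ _ ⟨y, hy, rfl⟩ hne
      rw [compatible_iff hC]
      rcases lt_trichotomy x y with hxy | rfl | hxy
      · exact (eulerCompatible_clusterRoot_iff hn hfull h hI hxy).2 (hA x hx y hy hxy)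
      · exact absurd rfl hne
      · exact ((eulerCompatible_clusterRoot_iff hn hfull h hI hxy).2 (hA y hy x hx hxy)).symm

end RootData
end BrickPolytope

theorem mainTheorem6 {B W V : Type*} [Group W] [Finite W] {M : CoxeterMatrix B}
    (cs : CoxeterSystem M W)
    [NormedAddCommGroup V] [InnerProductSpace ℝ V] [FiniteDimensional ℝ V]
    (D : BrickPolytope.RootData cs V)
    (w₀ : W) (hw₀ : BrickPolytope.IsLongest cs w₀)
    (c : List B) (hred : cs.IsReduced c)
    (hc : BrickPolytope.IsCoxeterElement cs (cs.wordProd c))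
    (u : List B) (hu : BrickPolytope.IsSortingWord cs c w₀ u) :
    D.IsRealizing (c ++ u) w₀ ∧
    (interior (D.brickPolytope (c ++ u) w₀)).Nonempty ∧
    ∀ p ∈ interior (D.brickPolytope (c ++ u) w₀),
      BrickPolytope.Realizes (BrickPolytope.polarAt p (D.brickPolytope (c ++ u) w₀))
        (BrickPolytope.subwordComplex cs (c ++ u) w₀) ∧
      BrickPolytope.Realizes (BrickPolytope.polarAt p (D.brickPolytope (c ++ u) w₀))
        (D.clusterComplex (cs.wordProd c)) := by
  classical
  obtain ⟨hn, hfull⟩ := D.coxeter_word hred hc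
  obtain ⟨hur, huw, hpre⟩ := D.isSortingWord_spec hw₀ hn hfull hu
  have h := D.isCambrian hw₀ hn hfull hur huw hpre
  have hI := BrickPolytope.isFacet_initialPositions (c := c) hur huw
  refine ⟨h.isRealizing (D.demazure_append hw₀ c u hur huw), h.interior_nonempty, fun p hp =>
    ⟨h.realizes hp, (h.realizes hp).map (D.clusterRoot c u) ?_ ?_⟩⟩
  · exact BrickPolytope.RootData.clusterRoot_injective hn hI
  · exact BrickPolytope.RootData.mem_clusterComplex_iff hn hfull h hI
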